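/- Let $(M,g)$ be a connected smooth semi-Riemannian manifold of dimension $n$, let $\varepsilon\in\{1,-1\}$, and let $\bar M=M\times\mathbb{R}$ carry the metric $\langle\,,\rangle=g+\varepsilon\,dt^2$. A (vertical) translating soliton is a smooth hypersurface of $\bar M$ with nondegenerate induced metric whose mean curvature vector $\vec H$ (the trace of the second fundamental form) equals the normal component $\partial_t^{\perp}$ of the vertical field $\partial_t$; it is graphical if it is the graph $\{(x,u(x)):x\in\Omega\}$ of a smooth function $u$ on an open set $\Omega\subset M$. Let $\Sigma$ be a Lie group acting smoothly by isometries on $M$, let $I\subset\mathbb{R}$ be an open interval, and let $\pi:M\to I$ be a smooth submersion whose fibers $\pi^{-1}(s)$, $s\in I$, are orbits of the action. Assume that $|\nabla\pi|^2=\widetilde\varepsilon$ with a constant $\widetilde\varepsilon\in\{1,-1\}$ and that $\mathrm{div}(\nabla\pi)=h\circ\pi$ for some function $h:I\to\mathbb{R}$. Then for each $y_0\in\mathbb{R}$ and each $s_0\in I$ with $h(s_0)\neq0$ there exist $\rho>0$ and a translating soliton $F:(y_0-\rho,y_0+\rho)\times\Sigma\to\bar M$ which is the union of two graphical translating solitons,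 in the following sense. (1) There is a curve $c:(y_0-\rho,y_0+\rho)\to M$ such that $F(y,\sigma)=(\sigma\cdot c(y),y)$, and all points $c(y)$ have the same isotropy group $K\subset\Sigma$. $F$ is smooth of constant rank $n$, so it induces an injective immersion of $(y_0-\rho,y_0+\rho)\times(\Sigma/K)$ (and $F$ itself is an immersion if $\dim\Sigma=n-1$), and this hypersurface is a translating soliton. (2) There are $b_1,b_2\in I\setminus\{s_0\}$ on the same side of $s_0$ such that, with $I_i$ the open interval between $s_0$ and $b_i$, there are functions $u_i$, continuous on $\pi^{-1}(I_i\cup\{s_0\})$, with $u_i=y_0$ on the neck $\pi^{-1}(s_0)$, $u_1<y_0$ on $\pi^{-1}(I_1)$, $u_2>y_0$ on $\pi^{-1}(I_2)$, such that each $u_i$ is smooth on $\pi^{-1}(I_i)$ and its graph over $\pi^{-1}(I_i)$ is a graphical translating soliton, and the image of $F$ is the union of the graphs of $u_1$ over $\pi^{-1}(I_1\cup\{s_0\})$ and of $u_2$ over $\pi^{-1}(I_2\cup\{s_0\})$. -/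

import Mathlib

open Set
open scoped Manifold ContDiff

noncomputable section

/-! ### Semi-Riemannian metrics and their Levi-Civita connection

All manifolds below are without boundary.  The tangent space `TangentSpace I x` is the model
vector space `E`, identified through the preferred chart at `x`. -/

section General

variable {E : Type*} [NormedAddCommGroup E] [NormedSpace ℝ E]
  {H : Type*} [TopologicalSpace H] (I : ModelWithCorners ℝ E H)
  {M : Type*} [TopologicalSpace M] [ChartedSpace H M]

/-- A field of bilinear forms on the tangent spaces of `M`. -/
abbrev BilinField (M : Type*) [TopologicalSpace M] [ChartedSpace H M] : Type _ :=
  ∀ x : M, TangentSpace I x →L[ℝ] TangentSpace I x →L[ℝ] ℝ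

/-- `g` is a smooth semi-Riemannian metric: a smooth field of symmetric nondegenerate
bilinear forms on the tangent spaces. -/
structure IsSemiRiemannianMetric [IsManifold I ∞ M] (g : BilinField I M) : Prop where
  symm : ∀ (x : M) (v w : TangentSpace I x), g x v w = g x w v
  nondegenerate : ∀ (x : M) (v : TangentSpace I x), (∀ w, g x v w = 0) → v = 0
  contMDiff : ContMDiff I (I.prod 𝓘(ℝ, E →L[ℝ] E →L[ℝ] ℝ)) ∞
    (fun x => Bundle.TotalSpace.mk' (E →L[ℝ] E →L[ℝ] ℝ)
      (E := fun x : M => TangentSpace I x →L[ℝ] TangentSpace I x →L[ℝ] ℝ) x (g x))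

/-- The components of `g` in the preferred chart at `x₀`: the pullback of `g` to the model
space `E` by the inverse of the chart. -/
def metricInChart (g : BilinField I M) (x₀ : M) (z : E) : E →L[ℝ] E →L[ℝ] ℝ :=
  let A : E →L[ℝ] E := mfderiv 𝓘(ℝ, E) I (extChartAt I x₀).symm z
  let B : E →L[ℝ] E →L[ℝ] ℝ := g ((extChartAt I x₀).symm z)
  B.bilinearComp A A

/-- The vector `v ∈ T_x M` with `g(v, ·) = φ`. -/
def sharp (g : BilinField I M) (x : M) (φ : TangentSpace I x →L[ℝ] ℝ) : TangentSpace I x :=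
  (g x).inverse φ

/-- The Christoffel symbols at `x` of the first kind, in the preferred chart at `x`: the linear
form `w ↦ ½ (∂_u g(v, w) + ∂_v g(u, w) - ∂_w g(u, v))`. -/
def christoffelForm (g : BilinField I M) (x : M) (u v : E) : E →L[ℝ] ℝ :=
  let D : E →L[ℝ] E →L[ℝ] E →L[ℝ] ℝ := fderiv ℝ (metricInChart I g x) (extChartAt I x x)
  (1 / 2 : ℝ) • (D u v + D v u - (D.flip u).flip v)

/-- The Christoffel symbols at `x` of the second kind, in the preferred chart at `x`: the vector
`Γ(u, v)` with `g(Γ(u, v), w) = ½ (∂_u g(v, w) + ∂_v g(u, w) - ∂_w g(u, v))`. -/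
def christoffel (g : BilinField I M) (x : M) (u v : TangentSpace I x) : TangentSpace I x :=
  sharp I g x (christoffelForm (E := E) I g x u v)

/-- The components of a vector field `V` in the preferred chart at `x₀`. -/
def vectorInChart (V : ∀ x : M, TangentSpace I x) (x₀ : M) (z : E) : E :=
  mfderiv I 𝓘(ℝ, E) (extChartAt I x₀) ((extChartAt I x₀).symm z) (V ((extChartAt I x₀).symm z))

/-- The partial derivatives at `x` of the components of `V` in the preferred chart at `x`. -/
def chartDeriv (V : ∀ x : M, TangentSpace I x) (x : M) : TangentSpace I x →L[ℝ] TangentSpace I x :=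
  let D : E →L[ℝ] E := fderiv ℝ (vectorInChart I V x) (extChartAt I x x)
  D

/-- The covariant derivative `v ↦ (∇_v V)(x)` of a vector field for the Levi-Civita connection
of `g`. -/
def leviCivita (g : BilinField I M) (V : ∀ x : M, TangentSpace I x) (x : M)
    (v : TangentSpace I x) : TangentSpace I x :=
  chartDeriv I V x v + christoffel I g x v (V x)

theorem christoffelForm_add (g : BilinField I M) (x : M) (u u' v : E) :
    christoffelForm I g x (u + u') v = christoffelForm I g x u v + christoffelForm I g x u' v := by
  ext w
  simp only [christoffelForm, map_add, add_apply,
    smul_apply, sub_apply, ContinuousLinearMap.flip_apply,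
    smul_eq_mul]
  ring

theorem christoffelForm_smul (g : BilinField I M) (x : M) (c : ℝ) (u v : E) :
    christoffelForm I g x (c • u) v = c • christoffelForm I g x u v := by
  ext w
  simp only [christoffelForm, map_smul, add_apply,
    smul_apply, sub_apply, ContinuousLinearMap.flip_apply,
    smul_eq_mul]
  ring

theorem christoffel_add (g : BilinField I M) (x : M) (u u' v : TangentSpace I x) :
    christoffel I g x (u + u') v = christoffel I g x u v + christoffel I g x u' v :=
  (congrArg (sharp I g x) (christoffelForm_add (E := E) I g x u u' v)).trans ((g x).inverse.map_add _ _)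

theorem christoffel_smul (g : BilinField I M) (x : M) (c : ℝ) (u v : TangentSpace I x) :
    christoffel I g x (c • u) v = c • christoffel I g x u v :=
  (congrArg (sharp I g x) (christoffelForm_smul (E := E) I g x c u v)).trans ((g x).inverse.map_smul _ _)

/-- The divergence of a vector field: the trace of `v ↦ (∇_v V)(x)`. -/
def divergence (g : BilinField I M) (V : ∀ x : M, TangentSpace I x) (x : M) : ℝ :=
  LinearMap.trace ℝ (TangentSpace I x)
    { toFun := leviCivita I g V x
      map_add' := fun u v => by
        rw [leviCivita, map_add, christoffel_add I g x u v (V x)]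
        exact add_add_add_comm _ _ _ _
      map_smul' := fun c v => by
        rw [leviCivita, map_smul, christoffel_smul I g x c v (V x)]
        exact (smul_add _ _ _).symm }

/-- The gradient of a function: `g(grad f, v) = df(v)`. -/
def semiGradient (g : BilinField I M) (f : M → ℝ) (x : M) : TangentSpace I x :=
  sharp I g x (mfderiv I 𝓘(ℝ, ℝ) f x)

/-- The product metric `g + ε dt²` on `M × ℝ`. -/
def prodMetric (g : BilinField I M) (ε : ℝ) : BilinField (I.prod 𝓘(ℝ, ℝ)) (M × ℝ) :=
  fun p =>
    let B : E →L[ℝ] E →L[ℝ] ℝ := g p.1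
    (B.bilinearComp (ContinuousLinearMap.fst ℝ E ℝ) (ContinuousLinearMap.fst ℝ E ℝ)
      + ε • (ContinuousLinearMap.mul ℝ ℝ).bilinearComp (ContinuousLinearMap.snd ℝ E ℝ)
          (ContinuousLinearMap.snd ℝ E ℝ) : E × ℝ →L[ℝ] E × ℝ →L[ℝ] ℝ)

/-- The vertical vector field `∂_t` on `M × ℝ`. -/
def verticalField (p : M × ℝ) : TangentSpace (I.prod 𝓘(ℝ, ℝ)) p := ((0, 1) : E × ℝ)

end General

/-! ### Mean curvature of parametrized submanifolds, translating solitons -/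

section MeanCurvature

variable {E' : Type*} [NormedAddCommGroup E'] [NormedSpace ℝ E']
  {H' : Type*} [TopologicalSpace H'] (J : ModelWithCorners ℝ E' H')
  {P : Type*} [TopologicalSpace P] [ChartedSpace H' P]
  {E : Type*} [NormedAddCommGroup E] [NormedSpace ℝ E]
  {H : Type*} [TopologicalSpace H] (I : ModelWithCorners ℝ E H)
  {N : Type*} [TopologicalSpace N] [ChartedSpace H N]

/-- The second derivative of `F` at `p`, in the preferred charts at `p` and `F p`. -/
def chartSecondDeriv (F : P → N) (p : P) (X Y : TangentSpace J p) : TangentSpace I (F p) :=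
  let D : E' →L[ℝ] E' →L[ℝ] E := fderiv ℝ (fderiv ℝ (writtenInExtChartAt J I p F)) (extChartAt J p p)
  D X Y

/-- The covariant derivative `∇_X (dF(Y))` at `p` along a map `F : P → N`, where `X`, `Y` are
extended to vector fields that are constant in the preferred chart at `p`.  Its component normal
to the image is the second fundamental form `II(X, Y)` (and does not depend on the chart). -/
def covDerivAlong (g : BilinField I N) (F : P → N) (p : P)
    (X Y : TangentSpace J p) : TangentSpace I (F p) :=
  chartSecondDeriv J I F p X Y
    + christoffel I g (F p) (mfderiv J I F p X) (mfderiv J I F p Y)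

/-- `v ∈ T_{F p} N` is normal to (the tangent space `dF(T_p P)` of the image of) `F` at `p`. -/
def IsNormalAt (g : BilinField I N) (F : P → N) (p : P) (v : TangentSpace I (F p)) : Prop :=
  ∀ X : TangentSpace J p, g (F p) (mfderiv J I F p X) v = 0

/-- `X₁, …, Xₙ ∈ T_p P` are such that `dF(X₁), …, dF(Xₙ)` is an orthonormal frame, with signs
`η₁, …, ηₙ`, for the induced metric. -/
def IsOrthonormalFrameAt (g : BilinField I N) (F : P → N) (p : P) {n : ℕ}
    (X : Fin n → TangentSpace J p) (η : Fin n → ℝ) : Prop :=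
  (∀ i, η i = 1 ∨ η i = -1) ∧
  ∀ i j, g (F p) (mfderiv J I F p (X i)) (mfderiv J I F p (X j)) = if i = j then η i else 0

/-- `v` is the mean curvature vector at `p` of the `n`-dimensional submanifold parametrized
by `F`: the trace of the second fundamental form, that is, the normal vector with
`⟨v, ν⟩ = ∑ᵢ ηᵢ ⟨II(Xᵢ, Xᵢ), ν⟩` for all normal `ν`. -/
def IsMeanCurvatureVectorAt (g : BilinField I N) (n : ℕ) (F : P → N) (p : P)
    (v : TangentSpace I (F p)) : Prop :=
  IsNormalAt J I g F p v ∧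
  ∀ (X : Fin n → TangentSpace J p) (η : Fin n → ℝ), IsOrthonormalFrameAt J I g F p X η →
    ∀ ν : TangentSpace I (F p), IsNormalAt J I g F p ν →
      g (F p) v ν = ∑ i, η i * g (F p) (covDerivAlong J I g F p (X i) (X i)) ν

end MeanCurvature

section Soliton

variable {E' : Type*} [NormedAddCommGroup E'] [NormedSpace ℝ E']
  {H' : Type*} [TopologicalSpace H'] (J : ModelWithCorners ℝ E' H')
  {P : Type*} [TopologicalSpace P] [ChartedSpace H' P]
  {E : Type*} [NormedAddCommGroup E] [NormedSpace ℝ E]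
  {H : Type*} [TopologicalSpace H] (I : ModelWithCorners ℝ E H)
  {M : Type*} [TopologicalSpace M] [ChartedSpace H M]

/-- `F : P → M × ℝ` is, on the open set `U`, a (vertical) translating soliton in
`(M × ℝ, g + ε dt²)`.  It is a smooth map of constant rank `n = dim M` (so that it locally
parametrizes an immersed hypersurface; it is an immersion if and only if `dim P = n`), the metric
induced on the hypersurface is nondegenerate, and the mean curvature vector is the normal
component of `∂_t`, that is, the difference between `∂_t` and the mean curvature vector
is tangent to the hypersurface. -/
def IsTranslatingSolitonOn (g : BilinField I M) (ε : ℝ) (F : P → M × ℝ) (U : Set P) : Prop :=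
  ContMDiffOn J (I.prod 𝓘(ℝ, ℝ)) ∞ F U ∧
  ∀ p ∈ U,
    Module.finrank ℝ (LinearMap.range
      (mfderiv J (I.prod 𝓘(ℝ, ℝ)) F p : E' →L[ℝ] E × ℝ).toLinearMap) = Module.finrank ℝ E ∧
    (∀ X : TangentSpace J p,
      IsNormalAt J (I.prod 𝓘(ℝ, ℝ)) (prodMetric I g ε) F p (mfderiv J (I.prod 𝓘(ℝ, ℝ)) F p X) →
        mfderiv J (I.prod 𝓘(ℝ, ℝ)) F p X = 0) ∧
    ∃ v : TangentSpace (I.prod 𝓘(ℝ, ℝ)) (F p),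
      IsMeanCurvatureVectorAt J (I.prod 𝓘(ℝ, ℝ)) (prodMetric I g ε)
        (Module.finrank ℝ E) F p v ∧
      ∃ X : TangentSpace J p,
        verticalField I (F p) - v = mfderiv J (I.prod 𝓘(ℝ, ℝ)) F p X

/-- The graph of `u` over `A`, as a subset of `M × ℝ`. -/
def graphOver {M : Type*} (u : M → ℝ) (A : Set M) : Set (M × ℝ) :=
  (fun x => (x, u x)) '' A

/-- `u` defines over the open set `Ω` a graphical translating soliton in `(M × ℝ, g + ε dt²)`. -/
def IsGraphicalTranslatingSolitonOn (g : BilinField I M) (ε : ℝ) (u : M → ℝ) (Ω : Set M) :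
    Prop :=
  IsTranslatingSolitonOn I I g ε (fun x => (x, u x)) Ω

end Soliton

end

noncomputable section

/-! ### Linear algebra of nondegenerate bilinear forms -/

section LinearAlgebra

variable {E : Type*} [NormedAddCommGroup E] [NormedSpace ℝ E] [FiniteDimensional ℝ E]

/-! Everything takes place on hypersurfaces along which `π x = φ t`. Such a hypersurface has normal
`N = (∇π, -ε φ' ∂_t)`, the gradient of `π - φ(t)`, with `⟨N, N⟩ = ε' + ε φ'²`, and its second
fundamental form paired with `N` is minus the Hessian of `π - φ(t)`. The trace over the tangent
space is the full trace `div ∇π - ε φ''` minus the contribution of `N`. Since `|∇π|²` is constant,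
`Hess π (∇π, ∇π) = 0`, so this contribution is `-φ'' φ'² / ⟨N, N⟩`. As `⟨∂_t, N⟩ = -φ'`, the soliton
condition turns into the ordinary differential equation `φ'' = ε ε' (ε' + ε φ'²) (h(φ) - φ')`. The
direction needed is `translatingSoliton_at_of_equation`. It concerns any map into the level set
whose differential has rank `n`, so it serves both the graphs and `F`.

The equation is solved with `φ(y₀) = s₀`, `φ'(y₀) = 0` (`exists_soliton_profile`). Then `φ''(y₀) = ε
h(s₀) ≠ 0`, so `φ` has a strict extremum at `y₀` and is injective on each side of it. The inverses
`ψ₁`, `ψ₂` of the two halves (`exists_isSmoothInverseOn_pair`) give `u_i = ψ_i ∘ π`. Using the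
height as the parameter is what lets `F` pass smoothly through the neck, where `φ' = 0` and the
graphs become vertical.

An integral curve `α` of `ε' ∇π` satisfies `π (α s) = s`, and `F (y, σ) = (σ • α (φ y), y)`. Because
`∇π` is invariant under the group, uniqueness of integral curves makes the isotropy groups along `α`
equal (`exists_curve_of_gradient_unit`). The same curve shows that `h` is smooth near `s₀`, by
restricting the Laplacian of `π` to it (`contDiffAt_of_divergence_eq`).

The rank of `F` requires that tangent vectors of the orbits fill `ker dπ` (`exists_orbitDeriv_eq`).
An orbit map has constant rank `r`, so by second countability its image has Hausdorff dimension at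
most `r` in a chart. That image is a whole level set, of dimension `n - 1`, hence `r ≥ n - 1`. -/

theorem isInvertible_of_injective_of_finrank_eq {F : Type*} [NormedAddCommGroup F]
    [NormedSpace ℝ F] [FiniteDimensional ℝ F] (f : E →L[ℝ] F) (hf : Function.Injective f)
    (hd : Module.finrank ℝ E = Module.finrank ℝ F) : f.IsInvertible :=
  ⟨(LinearMap.linearEquivOfInjective f.toLinearMap hf hd).toContinuousLinearEquiv, by
    ext v; rfl⟩

theorem finrank_dual_clm : Module.finrank ℝ (E →L[ℝ] ℝ) = Module.finrank ℝ E := by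
  rw [← (LinearMap.toContinuousLinearMap (𝕜 := ℝ) (E := E) (F' := ℝ)).finrank_eq]
  exact Subspace.dual_finrank_eq

theorem isInvertible_of_nondegenerate (B : E →L[ℝ] E →L[ℝ] ℝ)
    (hB : ∀ v, (∀ w, B v w = 0) → v = 0) : B.IsInvertible := by
  refine isInvertible_of_injective_of_finrank_eq B ?_ finrank_dual_clm.symm
  refine (injective_iff_map_eq_zero B).2 fun v hv => hB v fun w => ?_
  rw [hv]; rfl

/-- The trace of an endomorphism in terms of a pseudo-orthonormal frame of a hyperplane and a
vector normal to it. -/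
theorem trace_eq_sum_orthonormal_add_normal {V : Type*} [AddCommGroup V] [Module ℝ V]
    [FiniteDimensional ℝ V] (B : V →ₗ[ℝ] V →ₗ[ℝ] ℝ) (hB : ∀ v w, B v w = B w v)
    {n : ℕ} (hn : Module.finrank ℝ V = n + 1) (e : Fin n → V) (η : Fin n → ℝ)
    (hη : ∀ i, η i = 1 ∨ η i = -1) (he : ∀ i j, B (e i) (e j) = if i = j then η i else 0)
    (N : V) (hN : B N N ≠ 0) (heN : ∀ i, B (e i) N = 0) (A : V →ₗ[ℝ] V) :
    LinearMap.trace ℝ V A = ∑ i, η i * B (A (e i)) (e i) + B (A N) N / B N N := by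
  have hηη : ∀ i, η i * η i = 1 := fun i => by rcases hη i with h | h <;> simp [h]
  -- The frame is completed by `N`; the numbers `c i` are the inverse squared lengths, so that `c i
  -- * B v (b' i)` is the `i`-th coordinate of `v`.
  let b' : Fin (n + 1) → V := Fin.cons N e
  let c : Fin (n + 1) → ℝ := Fin.cons (B N N)⁻¹ η
  have horth : ∀ i j, c i * B (b' j) (b' i) = if i = j then 1 else 0 := by
    intro i j
    refine Fin.cases ?_ (fun i => ?_) i <;> refine Fin.cases ?_ (fun j => ?_) j
    · simp [b', c, hN]
    · simp [b', c, heN, (Fin.succ_ne_zero j).symm]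
    · simp [b', c, hB N, heN, Fin.succ_ne_zero]
    · simp only [b', c, Fin.cons_succ, he, Fin.succ_inj]
      by_cases hij : i = j
      · subst hij; simp [hηη]
      · simp [hij, Ne.symm hij]
  have hli : LinearIndependent ℝ b' := by
    rw [Fintype.linearIndependent_iff]
    intro a ha i
    have h1 : c i * B (∑ j, a j • b' j) (b' i) = 0 := by rw [ha]; simp
    simpa [Finset.mul_sum, mul_left_comm (c i), horth] using h1
  let b := basisOfLinearIndependentOfCardEqFinrank hli (by simp [hn])
  have hb : ∀ i, b i = b' i := fun i => by simp [b]
  have hrepr : ∀ v i, b.repr v i = c i * B v (b' i) := by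
    intro v i
    conv_rhs => rw [← b.sum_repr v]
    simp [hb, Finset.mul_sum, mul_left_comm (c i), horth]
  rw [LinearMap.trace_eq_matrix_trace ℝ b, Matrix.trace, Fin.sum_univ_succ]
  simp only [Matrix.diag_apply, LinearMap.toMatrix_apply, hrepr, hb]
  simp only [b', c, Fin.cons_zero, Fin.cons_succ]
  rw [add_comm, div_eq_inv_mul]

end LinearAlgebra

/-! ### Gradient, Hessian and Laplacian in a chart -/

section ChartCalculus

variable {E : Type*} [NormedAddCommGroup E] [NormedSpace ℝ E]

/-- The Christoffel symbols of the first kind `½ (D_u(v, w) + D_v(u, w) - D_w(u, v))` contracted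
with `w`, as a bilinear form in `u` and `v`. -/
def christoffelBilin (D : E →L[ℝ] E →L[ℝ] E →L[ℝ] ℝ) (w : E) : E →L[ℝ] E →L[ℝ] ℝ :=
  let B : E →L[ℝ] E →L[ℝ] ℝ :=
    (((ContinuousLinearMap.flipₗᵢ ℝ E E ℝ : _ →L[ℝ] E →L[ℝ] E →L[ℝ] ℝ)).comp D).flip w
  (1 / 2 : ℝ) • (B + B.flip - D w)

theorem christoffelBilin_apply (D : E →L[ℝ] E →L[ℝ] E →L[ℝ] ℝ) (u v w : E) :
    christoffelBilin D w u v = 1 / 2 * (D u v w + D v u w - D w u v) := by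
  simp [christoffelBilin]

/-- The gradient of `p` for the metric `G` on `E`. -/
def chartGrad (G : E → E →L[ℝ] E →L[ℝ] ℝ) (p : E → ℝ) (z : E) : E :=
  (G z).inverse (fderiv ℝ p z)

/-- The Hessian of `p` for the metric `G` on `E`. -/
def chartHess (G : E → E →L[ℝ] E →L[ℝ] ℝ) (p : E → ℝ) (z : E) : E →L[ℝ] E →L[ℝ] ℝ :=
  fderiv ℝ (fderiv ℝ p) z - christoffelBilin (fderiv ℝ G z) (chartGrad G p z)

/-- The Laplacian of `p` for the metric `G` on `E`. -/
def chartLapl (G : E → E →L[ℝ] E →L[ℝ] ℝ) (p : E → ℝ) (z : E) : ℝ :=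
  LinearMap.trace ℝ E ((G z).inverse.comp (chartHess G p z)).toLinearMap

variable {G G' : E → E →L[ℝ] E →L[ℝ] ℝ} {p p' : E → ℝ} {z : E}

theorem chartHess_apply (u v : E) : chartHess G p z u v = fderiv ℝ (fderiv ℝ p) z u v
    - 1 / 2 * (fderiv ℝ G z u v (chartGrad G p z) + fderiv ℝ G z v u (chartGrad G p z)
      - fderiv ℝ G z (chartGrad G p z) u v) := by
  simp [chartHess, christoffelBilin_apply]

theorem apply_chartGrad (hinv : (G z).IsInvertible) (w : E) :
    G z (chartGrad G p z) w = fderiv ℝ p z w := by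
  rw [chartGrad, hinv.self_apply_inverse]

theorem eventually_isInvertible [CompleteSpace E] (hG : ContinuousAt G z) (hinv : (G z).IsInvertible) :
    ∀ᶠ z' in nhds z, (G z').IsInvertible := by
  obtain ⟨e, he⟩ := hinv
  have : {f : E →L[ℝ] E →L[ℝ] ℝ | f.IsInvertible} ∈ nhds (G z) := by
    rw [← he]; exact ContinuousLinearEquiv.nhds e
  exact hG this

theorem contDiffAt_chartGrad [CompleteSpace E] {n : WithTop ℕ∞} (hG : ContDiffAt ℝ n G z)
    (hp : ContDiffAt ℝ (n + 1) p z) (hinv : (G z).IsInvertible) :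
    ContDiffAt ℝ n (chartGrad G p) z :=
  (hinv.contDiffAt_map_inverse.comp z hG).clm_apply (hp.fderiv_right le_rfl)

theorem fderiv_symm (hsymm : ∀ᶠ z' in nhds z, ∀ v w, G z' v w = G z' w v)
    (hG : DifferentiableAt ℝ G z) (u v w : E) :
    fderiv ℝ G z u v w = fderiv ℝ G z u w v := by
  have h1 : ∀ v w, fderiv ℝ (fun z' => G z' v w) z u = fderiv ℝ G z u v w := by
    intro v w
    have h2 : HasFDerivAt (fun z' => G z' v w) _ z :=
      ((hG.hasFDerivAt.clm_apply (hasFDerivAt_const v z)).clm_apply (hasFDerivAt_const w z))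
    rw [h2.fderiv]; simp
  rw [← h1, ← h1]
  congr 1
  exact Filter.EventuallyEq.fderiv_eq (hsymm.mono fun z' h => h v w)

/-- Product rule applied to `G (grad p) = dp`, which holds on a whole neighbourhood because
invertibility is an open condition. It trades second derivatives of `p` for derivatives of the
gradient. -/
theorem fderiv_apply_chartGrad [CompleteSpace E] (hG : ContDiffAt ℝ 1 G z) (hp : ContDiffAt ℝ 2 p z)
    (hinv : (G z).IsInvertible) (v w : E) :
    fderiv ℝ G z v (chartGrad G p z) w + G z (fderiv ℝ (chartGrad G p) z v) w
      = fderiv ℝ (fderiv ℝ p) z v w := by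
  have hgrad : DifferentiableAt ℝ (chartGrad G p) z :=
    (contDiffAt_chartGrad hG hp hinv).differentiableAt one_ne_zero
  have hp2 : DifferentiableAt ℝ (fderiv ℝ p) z :=
    (hp.fderiv_right (m := 1) le_rfl).differentiableAt one_ne_zero
  have h1 : HasFDerivAt (fun z' => G z' (chartGrad G p z')) _ z :=
    (hG.differentiableAt one_ne_zero).hasFDerivAt.clm_apply hgrad.hasFDerivAt
  have h2 : (fun z' => G z' (chartGrad G p z')) =ᶠ[nhds z] fderiv ℝ p := by
    filter_upwards [eventually_isInvertible hG.continuousAt hinv] with z' hz'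
    exact hz'.self_apply_inverse _
  have h3 := h2.fderiv_eq (𝕜 := ℝ)
  rw [h1.fderiv] at h3
  have h4 := congrArg (fun L : E →L[ℝ] E →L[ℝ] ℝ => L v w) h3
  simp only [add_apply, ContinuousLinearMap.comp_apply,
    ContinuousLinearMap.flip_apply] at h4
  rw [← h4, add_comm]

/-- The Hessian is the covariant derivative of the gradient. -/
theorem chartHess_eq_of_christoffel [CompleteSpace E] (hsymm : ∀ᶠ z' in nhds z, ∀ v w, G z' v w = G z' w v)
    (hG : ContDiffAt ℝ 1 G z) (hp : ContDiffAt ℝ 2 p z) (hinv : (G z).IsInvertible) (v w Γ : E)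
    (hΓ : G z Γ w = 1 / 2 * (fderiv ℝ G z v (chartGrad G p z) w
      + fderiv ℝ G z (chartGrad G p z) v w - fderiv ℝ G z w v (chartGrad G p z))) :
    G z (fderiv ℝ (chartGrad G p) z v + Γ) w = chartHess G p z v w := by
  have h1 := fderiv_apply_chartGrad hG hp hinv v w
  have h2 := fderiv_symm hsymm (hG.differentiableAt one_ne_zero)
  rw [map_add, add_apply, hΓ, chartHess_apply, ← h1, h2 v w]
  ring

/-- The gradient of a function with gradient of constant length is in the kernel of the Hessian,
as a quadratic form. -/
theorem chartHess_grad_grad [CompleteSpace E] (hsymm : ∀ᶠ z' in nhds z, ∀ v w, G z' v w = G z' w v)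
    (hG : ContDiffAt ℝ 1 G z) (hp : ContDiffAt ℝ 2 p z) (hinv : (G z).IsInvertible) {c : ℝ}
    (hc : ∀ᶠ z' in nhds z, G z' (chartGrad G p z') (chartGrad G p z') = c) :
    chartHess G p z (chartGrad G p z) (chartGrad G p z) = 0 := by
  have hgrad : DifferentiableAt ℝ (chartGrad G p) z :=
    (contDiffAt_chartGrad hG hp hinv).differentiableAt one_ne_zero
  have h1 : HasFDerivAt (fun z' => G z' (chartGrad G p z') (chartGrad G p z')) _ z :=
    ((hG.differentiableAt one_ne_zero).hasFDerivAt.clm_apply hgrad.hasFDerivAt).clm_apply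
      hgrad.hasFDerivAt
  have h2 : (fun z' => G z' (chartGrad G p z') (chartGrad G p z')) =ᶠ[nhds z] fun _ => c := hc
  have h3 := h2.fderiv_eq (𝕜 := ℝ)
  rw [h1.fderiv, fderiv_const_apply] at h3
  have h4 := congrArg (fun L : E →L[ℝ] ℝ => L (chartGrad G p z)) h3
  have h5 := hsymm.self_of_nhds (chartGrad G p z) (fderiv ℝ (chartGrad G p) z (chartGrad G p z))
  simp only [add_apply, ContinuousLinearMap.comp_apply,
    ContinuousLinearMap.flip_apply, zero_apply] at h4
  -- With `V = grad p`, constancy of the length gives `∂_V G(V, V) + 2 G(∂_V V, V) = 0`, while `h6`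
  -- turns `Hess p (V, V)` into half of this expression.
  have h6 := fderiv_apply_chartGrad hG hp hinv (chartGrad G p z) (chartGrad G p z)
  rw [chartHess_apply]
  linarith

/-- The Hessian is invariant under changes of coordinates. -/
theorem chartHess_comp {ψ : E → E} (hψ : ContDiffAt ℝ 2 ψ z)
    (hψi : (fderiv ℝ ψ z).IsInvertible)
    (hGψ : ∀ᶠ z' in nhds z, ∀ u v, G z' u v = G' (ψ z') (fderiv ℝ ψ z' u) (fderiv ℝ ψ z' v))
    (hpψ : p =ᶠ[nhds z] p' ∘ ψ)
    (hG' : DifferentiableAt ℝ G' (ψ z)) (hp' : ContDiffAt ℝ 2 p' (ψ z))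
    (hsymm : ∀ v w, G' (ψ z) v w = G' (ψ z) w v)
    (hinv : (G z).IsInvertible) (hinv' : (G' (ψ z)).IsInvertible)
    (hGd : DifferentiableAt ℝ G z) (u v : E) :
    fderiv ℝ ψ z (chartGrad G p z) = chartGrad G' p' (ψ z) ∧
    chartHess G p z u v = chartHess G' p' (ψ z) (fderiv ℝ ψ z u) (fderiv ℝ ψ z v) := by
  have hψd : DifferentiableAt ℝ ψ z := hψ.differentiableAt two_ne_zero
  have hψ2 : DifferentiableAt ℝ (fderiv ℝ ψ) z :=
    (hψ.fderiv_right (m := 1) le_rfl).differentiableAt one_ne_zero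
  have hp'd : DifferentiableAt ℝ p' (ψ z) := hp'.differentiableAt two_ne_zero
  have hp'2 : DifferentiableAt ℝ (fderiv ℝ p') (ψ z) :=
    (hp'.fderiv_right (m := 1) le_rfl).differentiableAt one_ne_zero
  have hdp : fderiv ℝ p =ᶠ[nhds z] fun z' => (fderiv ℝ p' (ψ z')).comp (fderiv ℝ ψ z') := by
    have h1 : ∀ᶠ z' in nhds z, DifferentiableAt ℝ ψ z' :=
      (hψ.eventually (by simp)).mono fun _ h => h.differentiableAt two_ne_zero
    have h2 : ∀ᶠ z' in nhds z, DifferentiableAt ℝ p' (ψ z') :=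
      hψ.continuousAt.eventually
        ((hp'.eventually (by simp)).mono fun _ h => h.differentiableAt two_ne_zero)
    filter_upwards [hpψ.fderiv (𝕜 := ℝ), h1, h2] with z' h h1 h2
    rw [h, fderiv_comp z' h2 h1]
  have hgrad : fderiv ℝ ψ z (chartGrad G p z) = chartGrad G' p' (ψ z) := by
    rw [chartGrad, chartGrad, eq_comm, hinv'.inverse_apply_eq]
    ext w
    obtain ⟨w, rfl⟩ := hψi.surjective w
    have h1 := hGψ.self_of_nhds (chartGrad G p z) w
    rw [apply_chartGrad hinv, hdp.self_of_nhds] at h1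
    exact h1
  refine ⟨hgrad, ?_⟩
  have hGe : ∀ a b c, fderiv ℝ G z a b c
      = fderiv ℝ G' (ψ z) (fderiv ℝ ψ z a) (fderiv ℝ ψ z b) (fderiv ℝ ψ z c)
        + G' (ψ z) (fderiv ℝ (fderiv ℝ ψ) z a b) (fderiv ℝ ψ z c)
        + G' (ψ z) (fderiv ℝ ψ z b) (fderiv ℝ (fderiv ℝ ψ) z a c) := by
    intro a b c
    have h1 : HasFDerivAt (fun z' => G z' b c) _ z :=
      ((hGd.hasFDerivAt.clm_apply (hasFDerivAt_const b z)).clm_apply (hasFDerivAt_const c z))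
    have h2 : HasFDerivAt (fun z' => G' (ψ z') (fderiv ℝ ψ z' b) (fderiv ℝ ψ z' c)) _ z :=
      (((hG'.hasFDerivAt.comp z hψd.hasFDerivAt).clm_apply
        (hψ2.hasFDerivAt.clm_apply (hasFDerivAt_const b z))).clm_apply
        (hψ2.hasFDerivAt.clm_apply (hasFDerivAt_const c z)))
    have h3 : (fun z' => G z' b c) =ᶠ[nhds z]
        fun z' => G' (ψ z') (fderiv ℝ ψ z' b) (fderiv ℝ ψ z' c) := hGψ.mono fun z' h => h b c
    have h4 := congrArg (fun L : E →L[ℝ] ℝ => L a) (h3.fderiv_eq (𝕜 := ℝ))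
    rw [h1.fderiv, h2.fderiv] at h4
    simp at h4
    rw [h4]; ring
  have hpe : fderiv ℝ (fderiv ℝ p) z u v
      = fderiv ℝ (fderiv ℝ p') (ψ z) (fderiv ℝ ψ z u) (fderiv ℝ ψ z v)
        + fderiv ℝ p' (ψ z) (fderiv ℝ (fderiv ℝ ψ) z u v) := by
    have h2 : HasFDerivAt (fun z' => (fderiv ℝ p' (ψ z')).comp (fderiv ℝ ψ z')) _ z :=
      (hp'2.hasFDerivAt.comp z hψd.hasFDerivAt).clm_comp hψ2.hasFDerivAt
    rw [hdp.fderiv_eq (𝕜 := ℝ), h2.fderiv]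
    simp [add_comm]
  have hsy : ∀ a b, fderiv ℝ (fderiv ℝ ψ) z a b = fderiv ℝ (fderiv ℝ ψ) z b a := fun a b =>
    (hψ.isSymmSndFDerivAt (by simp)).eq a b
  -- The second derivatives of `ψ` coming from the three metric terms combine to `G'(ψ''(u, v), grad
  -- p')`, which is exactly the extra term of the second derivative of `p' ∘ ψ`.
  rw [chartHess_apply, chartHess_apply, hGe, hGe, hGe, hpe, hgrad,
    ← apply_chartGrad (p := p') hinv', hsy v u, hsy v (chartGrad G p z), hsy u (chartGrad G p z),
    hsymm (fderiv ℝ ψ z v), hsymm (fderiv ℝ ψ z u),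
    hsymm (chartGrad G' p' (ψ z))]
  ring

/-- The endomorphisms dual to the two Hessians are conjugate under `dψ`, and the trace is invariant
under conjugation. -/
theorem chartLapl_comp {ψ : E → E} (hψ : ContDiffAt ℝ 2 ψ z)
    (hψi : (fderiv ℝ ψ z).IsInvertible)
    (hGψ : ∀ᶠ z' in nhds z, ∀ u v, G z' u v = G' (ψ z') (fderiv ℝ ψ z' u) (fderiv ℝ ψ z' v))
    (hpψ : p =ᶠ[nhds z] p' ∘ ψ)
    (hG' : DifferentiableAt ℝ G' (ψ z)) (hp' : ContDiffAt ℝ 2 p' (ψ z))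
    (hsymm : ∀ v w, G' (ψ z) v w = G' (ψ z) w v)
    (hinv : (G z).IsInvertible) (hinv' : (G' (ψ z)).IsInvertible)
    (hGd : DifferentiableAt ℝ G z) :
    chartLapl G p z = chartLapl G' p' (ψ z) := by
  have h1 := fun u v =>
    (chartHess_comp hψ hψi hGψ hpψ hG' hp' hsymm hinv hinv' hGd u v).2
  obtain ⟨e, he⟩ := hψi
  rw [chartLapl, chartLapl, ← LinearMap.trace_conj' _ e.toLinearEquiv]
  congr 1
  ext w
  obtain ⟨w, rfl⟩ := e.surjective w
  have he' : ∀ v, fderiv ℝ ψ z v = e v := fun v => by rw [← he]; rfl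
  simp only [LinearEquiv.conj_apply, LinearMap.comp_apply]
  change e ((G z).inverse (chartHess G p z (e.symm (e w)))) =
    (G' (ψ z)).inverse (chartHess G' p' (ψ z) (e w))
  rw [e.symm_apply_apply, eq_comm, hinv'.inverse_apply_eq]
  ext v
  obtain ⟨v, rfl⟩ := e.surjective v
  rw [← he', ← he' v, ← h1, ← he', ← hGψ.self_of_nhds, hinv.self_apply_inverse]

set_option maxSynthPendingDepth 3 in
theorem contDiffAt_chartHess [CompleteSpace E] (hG : ContDiffAt ℝ ∞ G z)
    (hp : ContDiffAt ℝ ∞ p z) (hinv : (G z).IsInvertible) :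
    ContDiffAt ℝ ∞ (chartHess G p) z := by
  have hgrad : ContDiffAt ℝ ∞ (chartGrad G p) z := contDiffAt_chartGrad hG hp hinv
  have hdG : ContDiffAt ℝ ∞ (fderiv ℝ G) z := hG.fderiv_right (by simp)
  have hddp : ContDiffAt ℝ ∞ (fderiv ℝ (fderiv ℝ p)) z :=
    (hp.fderiv_right (m := ∞) (by simp)).fderiv_right (by simp)
  -- The two flips, as bounded linear maps, build the Christoffel term from `fderiv ℝ G` and the
  -- gradient by operations known to preserve smoothness.
  let FL : (E →L[ℝ] E →L[ℝ] ℝ) →L[ℝ] (E →L[ℝ] E →L[ℝ] ℝ) :=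
    (ContinuousLinearMap.flipₗᵢ ℝ E E ℝ : _ →L[ℝ] E →L[ℝ] E →L[ℝ] ℝ)
  let FL' : (E →L[ℝ] E →L[ℝ] E →L[ℝ] ℝ) →L[ℝ] (E →L[ℝ] E →L[ℝ] E →L[ℝ] ℝ) :=
    (ContinuousLinearMap.flipₗᵢ ℝ E E (E →L[ℝ] ℝ) : _ →L[ℝ] E →L[ℝ] E →L[ℝ] E →L[ℝ] ℝ)
  have hB : ContDiffAt ℝ ∞
      (fun z' => FL' (FL.comp (fderiv ℝ G z')) (chartGrad G p z')) z :=
    (FL'.contDiff.contDiffAt.comp z (contDiffAt_const.clm_comp hdG)).clm_apply hgrad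
  exact hddp.sub (((hB.add (FL.contDiff.contDiffAt.comp z hB)).sub
    (hdG.clm_apply hgrad)).const_smul (1 / 2 : ℝ))

theorem contDiffAt_chartLapl [FiniteDimensional ℝ E] (hG : ContDiffAt ℝ ∞ G z)
    (hp : ContDiffAt ℝ ∞ p z) (hinv : (G z).IsInvertible) :
    ContDiffAt ℝ ∞ (chartLapl G p) z := by
  let tr : (E →L[ℝ] E) →L[ℝ] ℝ := LinearMap.toContinuousLinearMap
    ((LinearMap.trace ℝ E).comp (ContinuousLinearMap.coeLM ℝ))
  have : CompleteSpace E := FiniteDimensional.complete ℝ E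
  exact tr.contDiff.contDiffAt.comp z
    ((hinv.contDiffAt_map_inverse.comp z hG).clm_comp (contDiffAt_chartHess hG hp hinv))

end ChartCalculus

/-! ### Metrics, gradients and divergences in charts -/

section InCharts

variable {E : Type*} [NormedAddCommGroup E] [NormedSpace ℝ E]
  {M : Type*} [TopologicalSpace M] [ChartedSpace E M] [IsManifold 𝓘(ℝ, E) ∞ M]
  {g : BilinField 𝓘(ℝ, E) M}

/-- The trivialization of the tangent bundle over the chart domain has the derivative of the inverse
chart as its inverse on fibres. Pairing `g` with these coordinate fields yields smoothness of its
components. -/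
theorem contMDiffOn_symm_section (x₀ : M) (v : E) :
    ContMDiffOn 𝓘(ℝ, E) (𝓘(ℝ, E).prod 𝓘(ℝ, E)) ∞
      (fun z : E => (Bundle.TotalSpace.mk' E ((extChartAt 𝓘(ℝ, E) x₀).symm z)
        (mfderiv 𝓘(ℝ, E) 𝓘(ℝ, E) (extChartAt 𝓘(ℝ, E) x₀).symm z v :
          TangentSpace 𝓘(ℝ, E) ((extChartAt 𝓘(ℝ, E) x₀).symm z)) :
          TangentBundle 𝓘(ℝ, E) M))
      (extChartAt 𝓘(ℝ, E) x₀).target := by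
  let e := trivializationAt E (TangentSpace 𝓘(ℝ, E) : M → Type _) x₀
  have h1 : ContMDiffOn 𝓘(ℝ, E) (𝓘(ℝ, E).prod 𝓘(ℝ, E)) ∞
      (fun z : E => ((extChartAt 𝓘(ℝ, E) x₀).symm z, v)) (extChartAt 𝓘(ℝ, E) x₀).target :=
    (contMDiffOn_extChartAt_symm x₀).prodMk contMDiffOn_const
  have h2 := (Bundle.Trivialization.contMDiffOn_symm (n := ∞) (IB := 𝓘(ℝ, E)) e).comp h1
    (fun z hz => by
      have : (extChartAt 𝓘(ℝ, E) x₀).symm z ∈ (chartAt E x₀).source := by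
        simpa using (extChartAt 𝓘(ℝ, E) x₀).map_target hz
      simpa [e, Bundle.Trivialization.mem_target] using this)
  refine h2.congr fun z hz => ?_
  have hs : (extChartAt 𝓘(ℝ, E) x₀).symm z ∈ (chartAt E x₀).source := by
    simpa using (extChartAt 𝓘(ℝ, E) x₀).map_target hz
  have h3 := TangentBundle.symmL_trivializationAt (I := 𝓘(ℝ, E)) hs
  rw [(extChartAt 𝓘(ℝ, E) x₀).right_inv hz] at h3
  simp only [modelWithCornersSelf_coe, range_id, mfderivWithin_univ] at h3
  have h4 := congrArg (fun L : E →L[ℝ] E => L v) h3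
  have h5 := Bundle.Trivialization.symmL_apply (R := ℝ) e (by simpa [e] using hs) v
  rw [Function.comp_apply, ← Bundle.Trivialization.mk_symm e (by simpa [e] using hs)]
  exact congrArg (Bundle.TotalSpace.mk' E ((extChartAt 𝓘(ℝ, E) x₀).symm z))
    (h4.symm.trans h5)

/-- The value of `g` at `x`, as a bilinear form on the model space. -/
def bilinAt (g : BilinField 𝓘(ℝ, E) M) (x : M) : E →L[ℝ] E →L[ℝ] ℝ := g x

/-- The derivative of the inverse of the preferred chart at `x₀`, on the model space. -/
def symmDeriv (x₀ : M) (z : E) : E →L[ℝ] E :=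
  mfderiv 𝓘(ℝ, E) 𝓘(ℝ, E) (extChartAt 𝓘(ℝ, E) x₀).symm z

/-- The derivative of the preferred chart at `x₀`, on the model space. -/
def chartFwdDeriv (x₀ x : M) : E →L[ℝ] E :=
  mfderiv 𝓘(ℝ, E) 𝓘(ℝ, E) (extChartAt 𝓘(ℝ, E) x₀) x

/-- The derivative of a function, on the model space. -/
def funDeriv (f : M → ℝ) (x : M) : E →L[ℝ] ℝ := mfderiv 𝓘(ℝ, E) 𝓘(ℝ, ℝ) f x

/-- The gradient of a function, as a vector of the model space. -/
def gradAt (g : BilinField 𝓘(ℝ, E) M) (f : M → ℝ) (x : M) : E := semiGradient 𝓘(ℝ, E) g f x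

/-- The vector dual to a linear form on the model space. -/
def sharpAt (g : BilinField 𝓘(ℝ, E) M) (x : M) (φ : E →L[ℝ] ℝ) : E := sharp 𝓘(ℝ, E) g x φ

section Symm

omit [IsManifold 𝓘(ℝ, E) ∞ M]

variable [IsManifold 𝓘(ℝ, E) 1 M]

theorem chartFwdDeriv_symmDeriv {x₀ : M} {z : E} (hz : z ∈ (extChartAt 𝓘(ℝ, E) x₀).target)
    (v : E) : chartFwdDeriv x₀ ((extChartAt 𝓘(ℝ, E) x₀).symm z) (symmDeriv x₀ z v) = v := by
  have h := mfderiv_extChartAt_comp_mfderivWithin_extChartAt_symm (I := 𝓘(ℝ, E)) hz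
  simp only [modelWithCornersSelf_coe, range_id, mfderivWithin_univ] at h
  exact congrArg (fun L : E →L[ℝ] E => L v) h

theorem symmDeriv_chartFwdDeriv {x₀ : M} {z : E} (hz : z ∈ (extChartAt 𝓘(ℝ, E) x₀).target)
    (v : E) : symmDeriv x₀ z (chartFwdDeriv x₀ ((extChartAt 𝓘(ℝ, E) x₀).symm z) v) = v := by
  have h := mfderivWithin_extChartAt_symm_comp_mfderiv_extChartAt (I := 𝓘(ℝ, E)) hz
  simp only [modelWithCornersSelf_coe, range_id, mfderivWithin_univ] at h
  exact congrArg (fun L : E →L[ℝ] E => L v) h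

theorem symmDeriv_self (x : M) (v : E) : symmDeriv x (extChartAt 𝓘(ℝ, E) x x) v = v := by
  have h := mfderivWithin_range_extChartAt_symm (I := 𝓘(ℝ, E)) (x := x)
  simp only [modelWithCornersSelf_coe, range_id, mfderivWithin_univ] at h
  exact congrArg (fun L : E →L[ℝ] E => L v) h

theorem mdifferentiableAt_extChartAt_symm {x₀ : M} {z : E}
    (hz : z ∈ (extChartAt 𝓘(ℝ, E) x₀).target) :
    MDifferentiableAt 𝓘(ℝ, E) 𝓘(ℝ, E) (extChartAt 𝓘(ℝ, E) x₀).symm z := by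
  have h := mdifferentiableWithinAt_extChartAt_symm (I := 𝓘(ℝ, E)) hz
  rwa [modelWithCornersSelf_coe, range_id, mdifferentiableWithinAt_univ] at h

end Symm

omit [IsManifold 𝓘(ℝ, E) ∞ M] in
theorem metricInChart_apply (x₀ : M) (z v w : E) :
    metricInChart 𝓘(ℝ, E) g x₀ z v w = bilinAt g ((extChartAt 𝓘(ℝ, E) x₀).symm z)
      (symmDeriv x₀ z v) (symmDeriv x₀ z w) := rfl

theorem metricInChart_self (x : M) (v w : E) :
    metricInChart 𝓘(ℝ, E) g x (extChartAt 𝓘(ℝ, E) x x) v w = bilinAt g x v w := by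
  have : IsManifold 𝓘(ℝ, E) 1 M := .of_le (n := ∞) (by simp)
  rw [metricInChart_apply, symmDeriv_self, symmDeriv_self, extChartAt_to_inv]

theorem contDiffOn_metricInChart [FiniteDimensional ℝ E] (hg : IsSemiRiemannianMetric 𝓘(ℝ, E) g)
    (x₀ : M) :
    ContDiffOn ℝ ∞ (metricInChart 𝓘(ℝ, E) g x₀) (extChartAt 𝓘(ℝ, E) x₀).target := by
  rw [contDiffOn_clm_apply]
  intro v
  rw [contDiffOn_clm_apply]
  intro w
  have h1 : ContMDiffOn 𝓘(ℝ, E) (𝓘(ℝ, E).prod 𝓘(ℝ, E →L[ℝ] E →L[ℝ] ℝ)) ∞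
      (fun z : E => Bundle.TotalSpace.mk' (E →L[ℝ] E →L[ℝ] ℝ)
        (E := fun x : M => TangentSpace 𝓘(ℝ, E) x →L[ℝ] TangentSpace 𝓘(ℝ, E) x →L[ℝ] ℝ)
        ((extChartAt 𝓘(ℝ, E) x₀).symm z) (g ((extChartAt 𝓘(ℝ, E) x₀).symm z)))
      (extChartAt 𝓘(ℝ, E) x₀).target :=
    hg.contMDiff.comp_contMDiffOn (contMDiffOn_extChartAt_symm x₀)
  have h2 := ContMDiffOn.clm_bundle_apply₂ (F₃ := ℝ) (E₃ := Bundle.Trivial M ℝ) h1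
    (contMDiffOn_symm_section x₀ v) (contMDiffOn_symm_section x₀ w)
  rw [← contMDiffOn_iff_contDiffOn]
  intro z hz
  have h3 := (h2 z hz)
  rw [Bundle.contMDiffWithinAt_totalSpace] at h3
  exact h3.2

theorem bilinAt_symm (hg : IsSemiRiemannianMetric 𝓘(ℝ, E) g) (x : M) (v w : E) :
    bilinAt g x v w = bilinAt g x w v := hg.symm x v w

theorem metricInChart_symm (hg : IsSemiRiemannianMetric 𝓘(ℝ, E) g) (x₀ : M) (z v w : E) :
    metricInChart 𝓘(ℝ, E) g x₀ z v w = metricInChart 𝓘(ℝ, E) g x₀ z w v :=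
  bilinAt_symm hg _ _ _

variable [FiniteDimensional ℝ E]

theorem isInvertible_bilinAt (hg : IsSemiRiemannianMetric 𝓘(ℝ, E) g) (x : M) :
    (bilinAt g x).IsInvertible :=
  isInvertible_of_nondegenerate (E := E) (g x) (hg.nondegenerate x)

theorem bilinAt_sharpAt (hg : IsSemiRiemannianMetric 𝓘(ℝ, E) g) (x : M)
    (φ : E →L[ℝ] ℝ) (w : E) : bilinAt g x (sharpAt g x φ) w = φ w :=
  congrArg (fun L : E →L[ℝ] ℝ => L w) ((isInvertible_bilinAt hg x).self_apply_inverse φ)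

theorem bilinAt_gradAt (hg : IsSemiRiemannianMetric 𝓘(ℝ, E) g) (f : M → ℝ) (x : M) (w : E) :
    bilinAt g x (gradAt g f x) w = funDeriv f x w :=
  bilinAt_sharpAt hg x _ w

theorem isInvertible_metricInChart (hg : IsSemiRiemannianMetric 𝓘(ℝ, E) g) {x₀ : M} {z : E}
    (hz : z ∈ (extChartAt 𝓘(ℝ, E) x₀).target) :
    (metricInChart 𝓘(ℝ, E) g x₀ z).IsInvertible := by
  have : IsManifold 𝓘(ℝ, E) 1 M := .of_le (n := ∞) (by simp)
  refine isInvertible_of_nondegenerate _ fun v hv => ?_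
  have h1 : symmDeriv x₀ z v = 0 := by
    refine hg.nondegenerate ((extChartAt 𝓘(ℝ, E) x₀).symm z) _ fun (w : E) => ?_
    have h2 := hv (chartFwdDeriv x₀ ((extChartAt 𝓘(ℝ, E) x₀).symm z) w)
    rw [metricInChart_apply, symmDeriv_chartFwdDeriv hz] at h2
    exact h2
  rw [← chartFwdDeriv_symmDeriv hz v, h1, map_zero]

omit [FiniteDimensional ℝ E] [IsManifold 𝓘(ℝ, E) ∞ M] in
theorem fderiv_comp_extChartAt_symm [IsManifold 𝓘(ℝ, E) 1 M] {x₀ : M} {z : E}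
    (hz : z ∈ (extChartAt 𝓘(ℝ, E) x₀).target) {f : M → ℝ}
    (hf : MDifferentiableAt 𝓘(ℝ, E) 𝓘(ℝ, ℝ) f ((extChartAt 𝓘(ℝ, E) x₀).symm z)) (v : E) :
    fderiv ℝ (f ∘ (extChartAt 𝓘(ℝ, E) x₀).symm) z v
      = funDeriv f ((extChartAt 𝓘(ℝ, E) x₀).symm z) (symmDeriv x₀ z v) := by
  rw [← mfderiv_eq_fderiv, mfderiv_comp z hf (mdifferentiableAt_extChartAt_symm hz)]
  rfl

/-- The components of the gradient in a chart. -/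
theorem vectorInChart_semiGradient (hg : IsSemiRiemannianMetric 𝓘(ℝ, E) g) {x₀ : M} {z : E}
    (hz : z ∈ (extChartAt 𝓘(ℝ, E) x₀).target) {f : M → ℝ}
    (hf : MDifferentiableAt 𝓘(ℝ, E) 𝓘(ℝ, ℝ) f ((extChartAt 𝓘(ℝ, E) x₀).symm z)) :
    vectorInChart 𝓘(ℝ, E) (semiGradient 𝓘(ℝ, E) g f) x₀ z
      = chartGrad (metricInChart 𝓘(ℝ, E) g x₀) (f ∘ (extChartAt 𝓘(ℝ, E) x₀).symm) z := by
  have : IsManifold 𝓘(ℝ, E) 1 M := .of_le (n := ∞) (by simp)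
  rw [chartGrad, eq_comm, (isInvertible_metricInChart hg hz).inverse_apply_eq]
  ext w
  rw [fderiv_comp_extChartAt_symm hz hf, metricInChart_apply, ← bilinAt_gradAt hg]
  change _ = bilinAt g _ (symmDeriv x₀ z (chartFwdDeriv x₀ _ (gradAt g f _))) _
  rw [symmDeriv_chartFwdDeriv hz]

theorem gradAt_eq_chartGrad (hg : IsSemiRiemannianMetric 𝓘(ℝ, E) g) (x : M) {f : M → ℝ}
    (hf : MDifferentiableAt 𝓘(ℝ, E) 𝓘(ℝ, ℝ) f x) :
    gradAt g f x = chartGrad (metricInChart 𝓘(ℝ, E) g x)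
      (f ∘ (extChartAt 𝓘(ℝ, E) x).symm) (extChartAt 𝓘(ℝ, E) x x) := by
  have : IsManifold 𝓘(ℝ, E) 1 M := .of_le (n := ∞) (by simp)
  rw [← vectorInChart_semiGradient hg (mem_extChartAt_target x) (by rwa [extChartAt_to_inv]),
    vectorInChart, extChartAt_to_inv, mfderiv_extChartAt_self]
  rfl

omit [FiniteDimensional ℝ E] in
theorem contDiffOn_comp_extChartAt_symm {f : M → ℝ} (hf : ContMDiff 𝓘(ℝ, E) 𝓘(ℝ, ℝ) ∞ f) (x₀ : M) :
    ContDiffOn ℝ ∞ (f ∘ (extChartAt 𝓘(ℝ, E) x₀).symm) (extChartAt 𝓘(ℝ, E) x₀).target := by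
  rw [← contMDiffOn_iff_contDiffOn]
  exact hf.comp_contMDiffOn (contMDiffOn_extChartAt_symm x₀)

omit [FiniteDimensional ℝ E] [IsManifold 𝓘(ℝ, E) ∞ M] in
theorem extChartAt_target_mem_nhds_of_mem {x₀ : M} {z : E}
    (hz : z ∈ (extChartAt 𝓘(ℝ, E) x₀).target) : (extChartAt 𝓘(ℝ, E) x₀).target ∈ nhds z :=
  (isOpen_extChartAt_target x₀).mem_nhds hz

/-- The covariant derivative of the gradient is the Hessian. -/
theorem bilinAt_leviCivita_semiGradient (hg : IsSemiRiemannianMetric 𝓘(ℝ, E) g) {f : M → ℝ}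
    (hf : ContMDiff 𝓘(ℝ, E) 𝓘(ℝ, ℝ) ∞ f) (x : M) (v w : E) :
    bilinAt g x (leviCivita 𝓘(ℝ, E) g (semiGradient 𝓘(ℝ, E) g f) x v : E) w
      = chartHess (metricInChart 𝓘(ℝ, E) g x) (f ∘ (extChartAt 𝓘(ℝ, E) x).symm)
          (extChartAt 𝓘(ℝ, E) x x) v w := by
  have : IsManifold 𝓘(ℝ, E) 1 M := .of_le (n := ∞) (by simp)
  have hcomp : CompleteSpace E := FiniteDimensional.complete ℝ E
  have hx := mem_extChartAt_target (I := 𝓘(ℝ, E)) x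
  have hx' := extChartAt_target_mem_nhds_of_mem hx
  have hmd : ∀ y, MDifferentiableAt 𝓘(ℝ, E) 𝓘(ℝ, ℝ) f y := fun y =>
    (hf y).mdifferentiableAt (by simp)
  have h1 := chartHess_eq_of_christoffel (G := metricInChart 𝓘(ℝ, E) g x)
    (p := f ∘ (extChartAt 𝓘(ℝ, E) x).symm) (z := extChartAt 𝓘(ℝ, E) x x)
    (.of_forall fun z => metricInChart_symm hg x z)
    (((contDiffOn_metricInChart hg x).contDiffAt hx').of_le (by simp))
    (((contDiffOn_comp_extChartAt_symm hf x).contDiffAt hx').of_le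
      ENat.LEInfty.out) (isInvertible_metricInChart hg hx) v w
    (sharpAt g x (christoffelForm (E := E) 𝓘(ℝ, E) g x v (gradAt g f x))) ?_
  · rw [← h1, metricInChart_self]
    have h2 : vectorInChart 𝓘(ℝ, E) (semiGradient 𝓘(ℝ, E) g f) x
        =ᶠ[nhds (extChartAt 𝓘(ℝ, E) x x)] chartGrad (metricInChart 𝓘(ℝ, E) g x)
          (f ∘ (extChartAt 𝓘(ℝ, E) x).symm) := by
      filter_upwards [hx'] with z hz
      exact vectorInChart_semiGradient hg hz (hmd _)
    rw [← h2.fderiv_eq (𝕜 := ℝ)]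
    rfl
  · rw [metricInChart_self, bilinAt_sharpAt hg, gradAt_eq_chartGrad hg x (hmd x)]
    rfl

/-- Both traces are of the same endomorphism, since the covariant derivative of the gradient is dual
to the Hessian and the metric is invertible. -/
theorem divergence_semiGradient (hg : IsSemiRiemannianMetric 𝓘(ℝ, E) g) {f : M → ℝ}
    (hf : ContMDiff 𝓘(ℝ, E) 𝓘(ℝ, ℝ) ∞ f) (x : M) :
    divergence 𝓘(ℝ, E) g (semiGradient 𝓘(ℝ, E) g f) x
      = chartLapl (metricInChart 𝓘(ℝ, E) g x) (f ∘ (extChartAt 𝓘(ℝ, E) x).symm)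
          (extChartAt 𝓘(ℝ, E) x x) := by
  have hinv := isInvertible_metricInChart hg (mem_extChartAt_target (I := 𝓘(ℝ, E)) x)
  refine congrArg (LinearMap.trace ℝ E) ?_
  refine LinearMap.ext fun v => ?_
  refine hinv.injective ?_
  ext w
  refine (metricInChart_self x _ w).trans ((bilinAt_leviCivita_semiGradient hg hf x v w).trans ?_)
  exact (congrArg (fun L : E →L[ℝ] ℝ => L w) (hinv.self_apply_inverse _)).symm

/-- The divergence of the gradient can be computed in any chart. -/
theorem divergence_semiGradient_eq_chartLapl (hg : IsSemiRiemannianMetric 𝓘(ℝ, E) g) {f : M → ℝ}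
    (hf : ContMDiff 𝓘(ℝ, E) 𝓘(ℝ, ℝ) ∞ f) (x₀ : M) {z : E}
    (hz : z ∈ (extChartAt 𝓘(ℝ, E) x₀).target) :
    divergence 𝓘(ℝ, E) g (semiGradient 𝓘(ℝ, E) g f) ((extChartAt 𝓘(ℝ, E) x₀).symm z)
      = chartLapl (metricInChart 𝓘(ℝ, E) g x₀) (f ∘ (extChartAt 𝓘(ℝ, E) x₀).symm) z := by
  have : IsManifold 𝓘(ℝ, E) 1 M := .of_le (n := ∞) (by simp)
  set x := (extChartAt 𝓘(ℝ, E) x₀).symm z with hxdef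
  rw [divergence_semiGradient hg hf]
  -- The divergence at `x` is defined through the chart at `x`, and `ψ` is the transition map to it.
  -- A fixed chart is needed in order to vary the point smoothly.
  let ψ : E → E := extChartAt 𝓘(ℝ, E) x ∘ (extChartAt 𝓘(ℝ, E) x₀).symm
  have hψz : ψ z = extChartAt 𝓘(ℝ, E) x x := rfl
  have hxt := mem_extChartAt_target (I := 𝓘(ℝ, E)) x
  have hz' := extChartAt_target_mem_nhds_of_mem hz
  have hsrc : ∀ᶠ z' in nhds z, (extChartAt 𝓘(ℝ, E) x₀).symm z' ∈ (extChartAt 𝓘(ℝ, E) x).source :=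
    (continuousAt_extChartAt_symm'' hz).eventually
      (extChartAt_source_mem_nhds (I := 𝓘(ℝ, E)) x)
  have hmd : ∀ y, MDifferentiableAt 𝓘(ℝ, E) 𝓘(ℝ, ℝ) f y := fun y =>
    (hf y).mdifferentiableAt (by simp)
  have hψ : ContDiffAt ℝ ∞ ψ z := by
    rw [← contMDiffAt_iff_contDiffAt]
    exact (contMDiffAt_extChartAt (n := ∞) (I := 𝓘(ℝ, E)) (x := x)).comp z
      ((contMDiffOn_extChartAt_symm x₀).contMDiffAt hz')
  have hdψ : ∀ᶠ z' in nhds z, ∀ v,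
      symmDeriv x (ψ z') (fderiv ℝ ψ z' v) = symmDeriv x₀ z' v := by
    filter_upwards [hsrc, hz'] with z' h1 h2 v
    have h3 : fderiv ℝ ψ z' v
        = chartFwdDeriv x ((extChartAt 𝓘(ℝ, E) x₀).symm z') (symmDeriv x₀ z' v) := by
      rw [← mfderiv_eq_fderiv, mfderiv_comp z'
        (mdifferentiableAt_extChartAt (by simpa using h1)) (mdifferentiableAt_extChartAt_symm h2)]
      rfl
    have h4 := symmDeriv_chartFwdDeriv ((extChartAt 𝓘(ℝ, E) x).map_source h1) (symmDeriv x₀ z' v)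
    rw [(extChartAt 𝓘(ℝ, E) x).left_inv h1] at h4
    rw [h3]
    exact h4
  have hinj : Function.Injective (fderiv ℝ ψ z) := by
    rw [injective_iff_map_eq_zero]
    intro v hv
    have h1 := hdψ.self_of_nhds v
    rw [hv, map_zero] at h1
    rw [← chartFwdDeriv_symmDeriv hz v, ← h1, map_zero]
  refine (chartLapl_comp (ψ := ψ) (hψ.of_le ENat.LEInfty.out)
    (isInvertible_of_injective_of_finrank_eq _ hinj rfl) ?_ ?_ ?_ ?_
    (metricInChart_symm hg x _) (isInvertible_metricInChart hg hz)
    (isInvertible_metricInChart hg hxt) ?_).symm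
  · filter_upwards [hdψ, hsrc] with z' h1 h2 u v
    rw [metricInChart_apply, metricInChart_apply, ← h1 u, ← h1 v]
    have h3 : (extChartAt 𝓘(ℝ, E) x).symm (ψ z') = (extChartAt 𝓘(ℝ, E) x₀).symm z' :=
      (extChartAt 𝓘(ℝ, E) x).left_inv h2
    rw [h3]
  · filter_upwards [hsrc] with z' h2
    have h3 : (extChartAt 𝓘(ℝ, E) x).symm (ψ z') = (extChartAt 𝓘(ℝ, E) x₀).symm z' :=
      (extChartAt 𝓘(ℝ, E) x).left_inv h2
    exact (congrArg f h3).symm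
  · exact ((contDiffOn_metricInChart hg x).contDiffAt
      (extChartAt_target_mem_nhds_of_mem hxt)).differentiableAt (by simp)
  · exact ((contDiffOn_comp_extChartAt_symm hf x).contDiffAt
      (extChartAt_target_mem_nhds_of_mem hxt)).of_le ENat.LEInfty.out
  · exact ((contDiffOn_metricInChart hg x₀).contDiffAt hz').differentiableAt (by simp)

end InCharts

/-! ### Maps of constant rank and the dimension of their images -/

section ConstantRank

variable {E : Type*} [NormedAddCommGroup E] [NormedSpace ℝ E] [FiniteDimensional ℝ E]
  {F : Type*} [NormedAddCommGroup F] [NormedSpace ℝ F] [FiniteDimensional ℝ F]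

/-- A surjective linear map can be completed to an isomorphism by a projection to its kernel. -/
theorem exists_isInvertible_prod_ker (T : E →L[ℝ] F) (hT : Function.Surjective T) :
    ∃ Q : E →L[ℝ] LinearMap.ker T.toLinearMap, (T.prod Q).IsInvertible := by
  obtain ⟨q, hq⟩ := LinearMap.exists_leftInverse_of_injective
    (LinearMap.ker T.toLinearMap).subtype (Submodule.ker_subtype _)
  refine ⟨LinearMap.toContinuousLinearMap q, isInvertible_of_injective_of_finrank_eq _ ?_ ?_⟩
  · refine (injective_iff_map_eq_zero _).2 fun v hv => ?_
    have h1 : T v = 0 := congrArg Prod.fst hv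
    have h2 : q v = 0 := congrArg Prod.snd hv
    have h3 : q v = ⟨v, h1⟩ := LinearMap.congr_fun hq ⟨v, h1⟩
    rw [h2] at h3
    exact (congrArg Subtype.val h3).symm
  · have h := LinearMap.finrank_range_add_finrank_ker T.toLinearMap
    rw [LinearMap.range_eq_top.2 hT, finrank_top] at h
    rw [Module.finrank_prod, h]

/-- The image of a small neighbourhood of a point under a map of constant rank `r` has Hausdorff
dimension at most `r`. -/
theorem exists_mem_nhds_dimH_image_le_of_finrank_range_eq {f : E → F} {z : E} {r : ℕ}
    (hf : ContDiffAt ℝ 1 f z)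
    (hr : ∀ᶠ w in nhds z,
      Module.finrank ℝ (LinearMap.range (fderiv ℝ f w).toLinearMap) = r) :
    ∃ U ∈ nhds z, dimH (f '' U) ≤ r := by
  have hE : CompleteSpace E := FiniteDimensional.complete ℝ E
  set R := LinearMap.range (fderiv ℝ f z).toLinearMap with hR
  have hRr : Module.finrank ℝ R = r := hr.self_of_nhds
  -- `P` projects onto the range of the derivative at `z`. Then `θ = (P ∘ f, Q)` is a local
  -- diffeomorphism whose first coordinate records `f` modulo `ker P`.
  obtain ⟨P₀, hP₀⟩ := LinearMap.exists_leftInverse_of_injective R.subtype (Submodule.ker_subtype _)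
  let P : F →L[ℝ] R := LinearMap.toContinuousLinearMap P₀
  have hP : ∀ v : R, P v = v := fun v => LinearMap.congr_fun hP₀ v
  obtain ⟨Q, e, he⟩ := exists_isInvertible_prod_ker (P.comp (fderiv ℝ f z)) (by
    rintro ⟨w, v, rfl⟩
    exact ⟨v, hP ⟨fderiv ℝ f z v, v, rfl⟩⟩)
  let θ : E → R × LinearMap.ker (P.comp (fderiv ℝ f z)).toLinearMap := fun w => (P (f w), Q w)
  have hdf : ∀ᶠ w in nhds z, DifferentiableAt ℝ f w :=
    (hf.eventually (by simp)).mono fun _ h => h.differentiableAt one_ne_zero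
  have hθd : ∀ᶠ w in nhds z, HasFDerivAt θ ((P.comp (fderiv ℝ f w)).prod Q) w :=
    hdf.mono fun w hw => (P.hasFDerivAt.comp w hw.hasFDerivAt).prodMk Q.hasFDerivAt
  have hθ : ContDiffAt ℝ 1 θ z :=
    (P.contDiff.contDiffAt.comp z hf).prodMk Q.contDiff.contDiffAt
  have hθe : HasFDerivAt θ (e : E →L[ℝ] _) z := by rw [he]; exact hθd.self_of_nhds
  let hom := hθ.toOpenPartialHomeomorph θ hθe one_ne_zero
  have hz : z ∈ hom.source := hθ.mem_toOpenPartialHomeomorph_source hθe one_ne_zero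
  have homθ : ∀ w, hom w = θ w := fun w => rfl
  have hinvC : ContDiffAt ℝ 1 hom.symm (θ z) := hθ.to_localInverse hθe one_ne_zero
  have hsymmz : hom.symm (θ z) = z := hom.left_inv hz
  have htend : Filter.Tendsto hom.symm (nhds (θ z)) (nhds z) := by
    have := hinvC.continuousAt.tendsto; rwa [hsymmz] at this
  -- Constancy of the rank enters here: near `z` the map `P` sends the range of `df_w` onto `R`, and
  -- equal dimensions make it injective there.
  have hP' : ∀ᶠ w in nhds z, ∀ v, P (fderiv ℝ f w v) = 0 → fderiv ℝ f w v = 0 := by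
    have hcont : ContinuousAt (fun w => (P.comp (fderiv ℝ f w)).prod Q) z := by
      have h1 : ContinuousAt (fderiv ℝ f) z :=
        (hf.fderiv_right (m := 0) (by simp)).continuousAt
      have h2 : ContinuousAt (fun w => P.comp (fderiv ℝ f w)) z :=
        continuousAt_const.clm_comp h1
      have h3 : Continuous fun L : E →L[ℝ] R => L.prod Q := by
        have h4 : Continuous fun x : (E →L[ℝ] R) ×
            (E →L[ℝ] LinearMap.ker (P.comp (fderiv ℝ f z)).toLinearMap) => x.1.prod x.2 :=
          (ContinuousLinearMap.prodₗᵢ ℝ).continuous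
        exact h4.comp (continuous_id.prodMk continuous_const)
      exact h3.continuousAt.comp h2
    have hnear : ∀ᶠ w in nhds z, ((P.comp (fderiv ℝ f w)).prod Q).IsInvertible := by
      have hmem : {L : E →L[ℝ] R × LinearMap.ker (P.comp (fderiv ℝ f z)).toLinearMap |
          L.IsInvertible} ∈ nhds ((P.comp (fderiv ℝ f z)).prod Q) := by
        rw [← he]; exact ContinuousLinearEquiv.nhds e
      exact hcont hmem
    filter_upwards [hnear, hr] with w hw hrw v hv
    let φ : LinearMap.range (fderiv ℝ f w).toLinearMap →ₗ[ℝ] R :=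
      P.toLinearMap.comp (LinearMap.range (fderiv ℝ f w).toLinearMap).subtype
    have hφ : Function.Surjective φ := by
      intro a
      obtain ⟨v, hv⟩ := hw.surjective (a, 0)
      exact ⟨⟨fderiv ℝ f w v, v, rfl⟩, congrArg Prod.fst hv⟩
    have hφi : Function.Injective φ :=
      (LinearMap.injective_iff_surjective_of_finrank_eq_finrank (by rw [hrw, hRr])).2 hφ
    have h1 : φ ⟨fderiv ℝ f w v, v, rfl⟩ = φ 0 := by rw [map_zero]; exact hv
    exact congrArg Subtype.val (hφi h1)
  have hgood : ∀ᶠ y in nhds (θ z), ContDiffAt ℝ 1 hom.symm y ∧ ContDiffAt ℝ 1 f (hom.symm y) ∧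
      HasFDerivAt θ ((P.comp (fderiv ℝ f (hom.symm y))).prod Q) (hom.symm y) ∧
      (∀ v, P (fderiv ℝ f (hom.symm y) v) = 0 → fderiv ℝ f (hom.symm y) v = 0) ∧
      y ∈ hom.target :=
    (hinvC.eventually (by simp)).and ((htend.eventually (hf.eventually (by simp))).and
      ((htend.eventually hθd).and ((htend.eventually hP').and
        (hom.open_target.mem_nhds (hom.map_source hz)))))
  obtain ⟨δ, hδ, hball⟩ := Metric.eventually_nhds_iff_ball.1 hgood
  let fh : R × LinearMap.ker (P.comp (fderiv ℝ f z)).toLinearMap → F := f ∘ hom.symm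
  have hfh : ∀ y ∈ Metric.ball (θ z) δ, ContDiffAt ℝ 1 fh y := fun y hy =>
    (hball y hy).2.1.comp y (hball y hy).1
  -- In the coordinates `θ`, moving only the second coordinate leaves `P ∘ f` unchanged. By `hP'`
  -- the derivative of `f` in that direction vanishes, so `f` factors locally through `R`.
  have hconst : ∀ a b, (a, b) ∈ Metric.ball (θ z) δ → fh (a, b) = fh (a, (θ z).2) := by
    intro a b hab
    rw [← ball_prod_same, mem_prod] at hab
    have hmem : ∀ b' ∈ Metric.ball (θ z).2 δ, (a, b') ∈ Metric.ball (θ z) δ := fun b' hb' => by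
      rw [← ball_prod_same]; exact ⟨hab.1, hb'⟩
    have hder : ∀ b' ∈ Metric.ball (θ z).2 δ, HasFDerivAt (fun b' => fh (a, b'))
        (0 : LinearMap.ker (P.comp (fderiv ℝ f z)).toLinearMap →L[ℝ] F) b' := by
      intro b' hb'
      obtain ⟨h1, h2, h3, h4, h5⟩ := hball _ (hmem b' hb')
      have hs : HasFDerivAt hom.symm (fderiv ℝ hom.symm (a, b')) (a, b') :=
        (h1.differentiableAt one_ne_zero).hasFDerivAt
      have hf' := (h2.differentiableAt one_ne_zero).hasFDerivAt
      have hid := h3.comp (a, b') hs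
      have hid' : (θ ∘ hom.symm) =ᶠ[nhds (a, b')] id := by
        filter_upwards [hom.open_target.mem_nhds h5] with y hy using hom.right_inv hy
      have hid2 := hid.unique ((hasFDerivAt_id (𝕜 := ℝ) (a, b')).congr_of_eventuallyEq hid')
      have hj : HasFDerivAt (fun b' => (a, b')) (ContinuousLinearMap.inr ℝ R _) b' :=
        hasFDerivAt_prodMk_right a b'
      have hcomp := (hf'.comp (a, b') hs).comp b' hj
      refine hcomp.congr_fderiv ?_
      ext β
      have h6 := congrArg Prod.fst (DFunLike.congr_fun hid2 (0, β))
      exact h4 _ h6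
    have hb0 : (θ z).2 ∈ Metric.ball (θ z).2 δ := Metric.mem_ball_self hδ
    exact Metric.isOpen_ball.is_const_of_fderiv_eq_zero (𝕜 := ℝ)
      (f := fun b' => fh (a, b')) (convex_ball _ _).isPreconnected
      (fun b' hb' => (hder b' hb').differentiableAt.differentiableWithinAt)
      (fun b' hb' => (hder b' hb').fderiv) hab.2 hb0
  refine ⟨hom.source ∩ θ ⁻¹' Metric.ball (θ z) δ, Filter.inter_mem (hom.open_source.mem_nhds hz)
    (hθ.continuousAt (Metric.ball_mem_nhds _ hδ)), ?_⟩
  have hsub : f '' (hom.source ∩ θ ⁻¹' Metric.ball (θ z) δ) ⊆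
      (fun a : R => fh (a, (θ z).2)) '' Metric.ball (θ z).1 δ := by
    rintro _ ⟨w, ⟨hw, hwδ⟩, rfl⟩
    have h1 := hconst (θ w).1 (θ w).2 hwδ
    have h2 : fh (θ w) = f w := congrArg f (hom.left_inv hw)
    rw [mem_preimage, ← ball_prod_same] at hwδ
    exact ⟨(θ w).1, hwδ.1, by rw [← h2]; exact h1.symm⟩
  calc dimH (f '' (hom.source ∩ θ ⁻¹' Metric.ball (θ z) δ))
      ≤ dimH ((fun a : R => fh (a, (θ z).2)) '' Metric.ball (θ z).1 δ) := dimH_mono hsub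
    _ ≤ dimH (Metric.ball (θ z).1 δ) := by
        refine ContDiffOn.dimH_image_le (s := Metric.ball (θ z).1 δ) ?_ (convex_ball _ _) le_rfl
        intro a ha
        refine ContDiffAt.contDiffWithinAt ?_
        have hmem : (a, (θ z).2) ∈ Metric.ball (θ z) δ := by
          rw [← ball_prod_same]; exact ⟨ha, Metric.mem_ball_self hδ⟩
        exact ContDiffAt.comp (g := fh) (f := fun a => (a, (θ z).2)) a (hfh _ hmem)
          (contDiffAt_id.prodMk contDiffAt_const)
    _ ≤ dimH (univ : Set R) := dimH_mono (subset_univ _)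
    _ = r := by rw [Real.dimH_univ_eq_finrank, hRr]

/-- A set containing the part of a level set of a submersion to `ℝ` near a point of it has
codimension at most one. -/
theorem finrank_ker_le_of_dimH_levelSet_le {p : E → ℝ} {z : E} (hp : ContDiffAt ℝ 1 p z)
    (hpz : Function.Surjective (fderiv ℝ p z)) {U : Set E} (hU : U ∈ nhds z) {r : ℕ}
    (hr : dimH {w ∈ U | p w = p z} ≤ r) :
    Module.finrank ℝ (LinearMap.ker (fderiv ℝ p z).toLinearMap) ≤ r := by
  have hE : CompleteSpace E := FiniteDimensional.complete ℝ E
  obtain ⟨Q, e, he⟩ := exists_isInvertible_prod_ker (fderiv ℝ p z) hpz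
  have hθ : HasStrictFDerivAt (fun w => (p w, Q w)) (e : E →L[ℝ] _) z := by
    rw [he]
    exact (hp.hasStrictFDerivAt one_ne_zero).prodMk Q.hasStrictFDerivAt
  have hmem : (fun w => (p w, Q w)) '' U ∈ nhds (p z, Q z) := by
    rw [← hθ.map_nhds_eq_of_equiv]; exact Filter.image_mem_map hU
  -- As `(p, Q)` is a local diffeomorphism, the slice of the image of `U` over `p z` is a
  -- neighbourhood in the kernel. A Lipschitz image cannot raise Hausdorff dimension.
  have hQ : Q '' {w ∈ U | p w = p z} ∈ nhds (Q z) := by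
    have hc : Filter.Tendsto (fun b => (p z, b)) (nhds (Q z)) (nhds (p z, Q z)) :=
      (Continuous.prodMk_right (p z)).continuousAt
    filter_upwards [hc hmem] with b hb
    obtain ⟨w, hw, hwb⟩ := hb
    exact ⟨w, ⟨hw, congrArg Prod.fst hwb⟩, congrArg Prod.snd hwb⟩
  have h1 : dimH (Q '' {w ∈ U | p w = p z}) ≤ r := (Q.lipschitz.dimH_image_le _).trans hr
  rw [Real.dimH_of_mem_nhds hQ] at h1
  exact_mod_cast h1

end ConstantRank

/-! ### Orbits of a Lie group action that are level sets of a submersion -/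

/-- Used to compare ranks after changing coordinates or translating by the group on either side. -/
theorem finrank_range_comp_comp {V₁ V₂ V₃ V₄ : Type*} [AddCommGroup V₁] [Module ℝ V₁]
    [AddCommGroup V₂] [Module ℝ V₂] [AddCommGroup V₃] [Module ℝ V₃] [AddCommGroup V₄] [Module ℝ V₄]
    (A : V₃ →ₗ[ℝ] V₄) (B : V₂ →ₗ[ℝ] V₃) (C : V₁ →ₗ[ℝ] V₂) (hA : Function.Injective A)
    (hC : Function.Surjective C) :
    Module.finrank ℝ (LinearMap.range (A ∘ₗ B ∘ₗ C)) = Module.finrank ℝ (LinearMap.range B) := by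
  rw [LinearMap.range_comp, LinearMap.range_comp_of_range_eq_top _ (LinearMap.range_eq_top.2 hC)]
  exact (Submodule.equivMapOfInjective A hA _).symm.finrank_eq

section Orbits

variable {E : Type*} [NormedAddCommGroup E] [NormedSpace ℝ E]
  {M : Type*} [TopologicalSpace M] [ChartedSpace E M]
  {E' : Type*} [NormedAddCommGroup E'] [NormedSpace ℝ E']
  {S : Type*} [TopologicalSpace S] [ChartedSpace E' S] [Group S]
  [MulAction S M]

/-- The derivative of the translation by a group element, on the model space. -/
def smulDeriv (σ : S) (x : M) : E →L[ℝ] E := mfderiv 𝓘(ℝ, E) 𝓘(ℝ, E) (fun y : M => σ • y) x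

/-- The derivative of the orbit map of a point, on the model spaces. -/
def orbitDeriv (x : M) (σ : S) : E' →L[ℝ] E :=
  mfderiv 𝓘(ℝ, E') 𝓘(ℝ, E) (fun τ : S => τ • x) σ

omit [TopologicalSpace S] in
theorem smulDeriv_one (x : M) (v : E) : smulDeriv (1 : S) x v = v := by
  have h2 : (fun y : M => (1 : S) • y) = id := by ext y; simp
  rw [smulDeriv, h2, mfderiv_id]
  rfl

variable [ContMDiffSMul 𝓘(ℝ, E') 𝓘(ℝ, E) ∞ S M]

section Basic

variable (E')

include E'

theorem contMDiff_const_smul' (σ : S) :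
    ContMDiff 𝓘(ℝ, E) 𝓘(ℝ, E) ∞ (fun y : M => σ • y) :=
  ContMDiffSMul.contMDiff_const_smul (I := 𝓘(ℝ, E')) σ

theorem mdifferentiable_const_smul (σ : S) (x : M) :
    MDifferentiableAt 𝓘(ℝ, E) 𝓘(ℝ, E) (fun y : M => σ • y) x :=
  (contMDiff_const_smul' E' σ x).mdifferentiableAt (by simp)

theorem smulDeriv_mul (σ τ : S) (x : M) (v : E) :
    smulDeriv (σ * τ) x v = smulDeriv σ (τ • x) (smulDeriv τ x v) := by
  have h := mfderiv_comp x (mdifferentiable_const_smul E' (E := E) σ (τ • x))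
    (mdifferentiable_const_smul E' τ x)
  have h2 : (fun y : M => σ • y) ∘ (fun y : M => τ • y) = fun y => (σ * τ) • y := by
    ext y; simp [mul_smul]
  rw [h2] at h
  exact congrArg (fun L : E →L[ℝ] E => L v) h

theorem smulDeriv_inv_smulDeriv (σ : S) (x : M) (v : E) :
    smulDeriv σ⁻¹ (σ • x) (smulDeriv σ x v) = v := by
  rw [← smulDeriv_mul E', inv_mul_cancel, smulDeriv_one]

theorem smulDeriv_smulDeriv_inv (σ : S) (x : M) (v : E) :
    smulDeriv σ x (smulDeriv σ⁻¹ (σ • x) v) = v := by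
  have h := smulDeriv_inv_smulDeriv E' σ⁻¹ (σ • x) v
  rwa [inv_inv, inv_smul_smul] at h

end Basic

include E' in
theorem funDeriv_smulDeriv {f : M → ℝ}
    (hf : ContMDiff 𝓘(ℝ, E) 𝓘(ℝ, ℝ) ∞ f) (hinv : ∀ (σ : S) (x : M), f (σ • x) = f x) (σ : S) (x : M)
    (v : E) : funDeriv f (σ • x) (smulDeriv σ x v) = funDeriv f x v := by
  have h := mfderiv_comp x ((hf (σ • x)).mdifferentiableAt (by simp))
    (mdifferentiable_const_smul E' σ x)
  have h2 : f ∘ (fun y : M => σ • y) = f := by ext y; simp [hinv]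
  rw [h2] at h
  exact (congrArg (fun L : E →L[ℝ] ℝ => L v) h).symm

theorem contMDiff_orbitMap (x : M) :
    ContMDiff 𝓘(ℝ, E') 𝓘(ℝ, E) ∞ (fun τ : S => τ • x) :=
  (contMDiff_id (M := S)).smul contMDiff_const

theorem mdifferentiableAt_orbitMap (x : M) (σ : S) :
    MDifferentiableAt 𝓘(ℝ, E') 𝓘(ℝ, E) (fun τ : S => τ • x) σ :=
  (contMDiff_orbitMap x σ).mdifferentiableAt (by simp)

theorem funDeriv_orbitDeriv {f : M → ℝ}
    (hf : ContMDiff 𝓘(ℝ, E) 𝓘(ℝ, ℝ) ∞ f) (hinv : ∀ (σ : S) (x : M), f (σ • x) = f x) (x : M) (σ : S)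
    (ξ : E') : funDeriv (E := E) f (σ • x) (orbitDeriv x σ ξ) = 0 := by
  have h := mfderiv_comp σ ((hf (σ • x)).mdifferentiableAt (by simp))
    (mdifferentiableAt_orbitMap (E := E) (E' := E') x σ)
  have h2 : f ∘ (fun τ : S => τ • x) = fun _ => f x := by ext y; simp [hinv]
  rw [h2, mfderiv_const] at h
  exact (congrArg (fun L : E' →L[ℝ] ℝ => L ξ) h).symm

variable [LieGroup 𝓘(ℝ, E') ∞ S]

/-- The orbit map has constant rank. -/
theorem finrank_range_orbitDeriv (x : M) (σ τ : S) :
    Module.finrank ℝ (LinearMap.range (orbitDeriv (E := E) (E' := E') x σ).toLinearMap)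
      = Module.finrank ℝ (LinearMap.range (orbitDeriv (E := E) (E' := E') x τ).toLinearMap) := by
  let ρ : S := τ * σ⁻¹
  have hρ : ρ * σ = τ := by simp [ρ]
  have hleft : ∀ a b : S, MDifferentiableAt 𝓘(ℝ, E') 𝓘(ℝ, E') (fun c : S => a * c) b := fun a b =>
    ((contMDiff_mul_left (I := 𝓘(ℝ, E')) (n := ∞) (a := a)) b).mdifferentiableAt (by simp)
  let L : S → S → E' →L[ℝ] E' := fun a b => mfderiv 𝓘(ℝ, E') 𝓘(ℝ, E') (fun c : S => a * c) b
  have hL : ∀ v, L ρ σ (L ρ⁻¹ τ v) = v := by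
    intro v
    have h := mfderiv_comp τ (hleft ρ (ρ⁻¹ * τ)) (hleft ρ⁻¹ τ)
    have h2 : (fun c : S => ρ * c) ∘ (fun c : S => ρ⁻¹ * c) = id := by ext y; simp
    rw [h2, mfderiv_id] at h
    have h3 := congrArg (fun L : E' →L[ℝ] E' => L v) h
    have h4 : ρ⁻¹ * τ = σ := by simp [ρ]
    rw [h4] at h3
    exact h3.symm
  -- Differentiated form of `(ρ c) • x = ρ • (c • x)`: translations on both sides are
  -- diffeomorphisms, so they do not change the rank.
  have hcomp : ∀ v, orbitDeriv (E := E) x τ (L ρ σ v) = smulDeriv ρ (σ • x) (orbitDeriv x σ v) := by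
    intro v
    have h := mfderiv_comp σ (mdifferentiableAt_orbitMap (E' := E') (E := E) x (ρ * σ)) (hleft ρ σ)
    have h' := mfderiv_comp σ (mdifferentiable_const_smul E' (E := E) ρ (σ • x))
      (mdifferentiableAt_orbitMap (E' := E') x σ)
    have h2 : (fun y : M => ρ • y) ∘ (fun τ : S => τ • x)
        = (fun τ : S => τ • x) ∘ (fun c : S => ρ * c) := by ext y; simp [mul_smul]
    rw [h2, h] at h'
    have h3 := congrArg (fun L : E' →L[ℝ] E => L v) h'
    rw [hρ] at h3
    exact h3
  have hA : Function.Injective (smulDeriv (E := E) ρ (σ • x)).toLinearMap :=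
    (Function.LeftInverse.injective (smulDeriv_inv_smulDeriv E' ρ (σ • x)))
  have hC : Function.Surjective (L ρ σ).toLinearMap := fun v => ⟨_, hL v⟩
  have h1 := finrank_range_comp_comp _ (orbitDeriv (E := E) (E' := E') x σ).toLinearMap
    (LinearMap.id) hA Function.surjective_id
  have h2 := finrank_range_comp_comp (LinearMap.id)
    (orbitDeriv (E := E) (E' := E') x τ).toLinearMap _ Function.injective_id hC
  have h3 : (smulDeriv (E := E) ρ (σ • x)).toLinearMap ∘ₗ
      (orbitDeriv (E := E) (E' := E') x σ).toLinearMap ∘ₗ LinearMap.id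
      = LinearMap.id ∘ₗ (orbitDeriv (E := E) (E' := E') x τ).toLinearMap ∘ₗ (L ρ σ).toLinearMap :=
    LinearMap.ext fun v => (hcomp v).symm
  rw [← h1, h3, h2]

variable [IsManifold 𝓘(ℝ, E) ∞ M] [FiniteDimensional ℝ E] [FiniteDimensional ℝ E']
  [SecondCountableTopology S]

/-- If the level sets of an invariant submersion are orbits, then the derivatives of the orbit maps
are onto the kernels of the derivative of the submersion. -/
theorem exists_orbitDeriv_eq {f : M → ℝ}
    (hf : ContMDiff 𝓘(ℝ, E) 𝓘(ℝ, ℝ) ∞ f) (hinv : ∀ (σ : S) (x : M), f (σ • x) = f x)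
    (hsub : ∀ x, Function.Surjective (mfderiv 𝓘(ℝ, E) 𝓘(ℝ, ℝ) f x))
    (horb : ∀ x y : M, f y = f x → y ∈ MulAction.orbit S x) (x : M) (σ : S) (v : E)
    (hv : funDeriv f (σ • x) v = 0) : ∃ ξ : E', orbitDeriv x σ ξ = v := by
  have : IsManifold 𝓘(ℝ, E) 1 M := .of_le (n := ∞) (by simp)
  have : IsManifold 𝓘(ℝ, E') 1 S := .of_le (n := ∞) (by simp)
  set r := Module.finrank ℝ (LinearMap.range (orbitDeriv (E := E) (E' := E') x σ).toLinearMap)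
    with hr
  have hrank : ∀ τ : S,
      Module.finrank ℝ (LinearMap.range (orbitDeriv (E := E) (E' := E') x τ).toLinearMap) = r :=
    fun τ => finrank_range_orbitDeriv x τ σ
  let κ := extChartAt 𝓘(ℝ, E) x
  have hlocal : ∀ τ ∈ (fun τ : S => τ • x) ⁻¹' κ.source, ∃ V ∈ nhds τ,
      dimH ((fun τ : S => κ (τ • x)) '' V) ≤ r := by
    intro τ hτ
    let χ := extChartAt 𝓘(ℝ, E') τ
    let F : E' → E := fun w => κ (χ.symm w • x)
    have hχs : χ.symm (χ τ) = τ := extChartAt_to_inv τ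
    have hopen : IsOpen ((fun τ : S => τ • x) ⁻¹' κ.source) :=
      (isOpen_extChartAt_source x).preimage (contMDiff_orbitMap x (E := E) (E' := E')).continuous
    have hχc : ContinuousAt χ.symm (χ τ) := continuousAt_extChartAt_symm τ
    have hw : ∀ᶠ w in nhds (χ τ), w ∈ χ.target ∧ χ.symm w • x ∈ κ.source := by
      refine Filter.Eventually.and (extChartAt_target_mem_nhds τ) ?_
      have h1 : (fun τ : S => τ • x) ⁻¹' κ.source ∈ nhds (χ.symm (χ τ)) := by
        rw [hχs]; exact hopen.mem_nhds hτ
      exact hχc h1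
    have hFd : ∀ w, w ∈ χ.target → χ.symm w • x ∈ κ.source →
        fderiv ℝ F w = (chartFwdDeriv x (χ.symm w • x)).comp
          ((orbitDeriv x (χ.symm w)).comp (symmDeriv τ w)) := by
      intro w hw1 hw2
      have h1 := mdifferentiableAt_extChartAt_symm hw1
      have h2 := mdifferentiableAt_orbitMap (E := E) (E' := E') x (χ.symm w)
      have h3 : MDifferentiableAt 𝓘(ℝ, E) 𝓘(ℝ, E) κ (χ.symm w • x) :=
        mdifferentiableAt_extChartAt (by simpa [κ] using hw2)
      have h4 := mfderiv_comp w h2 h1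
      have h5 := mfderiv_comp w (f := (fun τ : S => τ • x) ∘ χ.symm) h3 (h2.comp w h1)
      rw [h4] at h5
      rw [← mfderiv_eq_fderiv]
      exact h5
    have hFc : ContDiffAt ℝ 1 F (χ τ) := by
      rw [← contMDiffAt_iff_contDiffAt]
      have h1 : ContMDiffAt 𝓘(ℝ, E') 𝓘(ℝ, E') 1 χ.symm (χ τ) :=
        (contMDiffOn_extChartAt_symm τ).contMDiffAt (extChartAt_target_mem_nhds τ)
      have h2 : ContMDiffAt 𝓘(ℝ, E') 𝓘(ℝ, E) 1 (fun τ : S => τ • x) (χ.symm (χ τ)) :=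
        ((contMDiff_orbitMap x) _).of_le (by simp)
      have h3 : ContMDiffAt 𝓘(ℝ, E) 𝓘(ℝ, E) 1 κ (χ.symm (χ τ) • x) :=
        contMDiffAt_extChartAt' (by rw [hχs]; simpa [κ] using hτ)
      exact h3.comp (f := fun w => χ.symm w • x) (χ τ) (h2.comp (χ τ) h1)
    obtain ⟨U, hU, hdim⟩ := exists_mem_nhds_dimH_image_le_of_finrank_range_eq (r := r) hFc (by
      filter_upwards [hw] with w ⟨hw1, hw2⟩
      rw [hFd w hw1 hw2, ← hrank (χ.symm w)]
      refine finrank_range_comp_comp _ _ _ ?_ ?_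
      · have h1 : Function.LeftInverse
            (symmDeriv (E := E) x (κ (χ.symm w • x))) (chartFwdDeriv x (χ.symm w • x)) := by
          intro u
          have h2 := symmDeriv_chartFwdDeriv (κ.map_source hw2) u
          rwa [κ.left_inv hw2] at h2
        exact h1.injective
      · intro u
        have h1 : ContinuousLinearMap.IsInvertible (symmDeriv (E := E') τ w) := by
          refine isInvertible_of_injective_of_finrank_eq _ ?_ rfl
          exact Function.LeftInverse.injective (chartFwdDeriv_symmDeriv hw1)
        exact h1.surjective u)
    refine ⟨χ.source ∩ χ ⁻¹' U, Filter.inter_mem (extChartAt_source_mem_nhds τ)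
      ((continuousAt_extChartAt τ) hU), (dimH_mono ?_).trans hdim⟩
    rintro _ ⟨τ', ⟨h1, h2⟩, rfl⟩
    refine ⟨χ τ', h2, ?_⟩
    simp only [F]
    rw [χ.left_inv h1]
  choose! V hV hVdim using hlocal
  -- Second countability of the group leaves countably many pieces, and Hausdorff dimension of a
  -- countable union is the supremum.
  obtain ⟨t, ht, htc, htcov⟩ := TopologicalSpace.countable_cover_nhdsWithin
    (s := (fun τ : S => τ • x) ⁻¹' κ.source) (f := V) (fun τ hτ => mem_nhdsWithin_of_mem_nhds (hV τ hτ))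
  have hp : ContDiffOn ℝ ∞ (f ∘ κ.symm) κ.target := contDiffOn_comp_extChartAt_symm hf x
  have hκx : κ.symm (κ x) = x := extChartAt_to_inv x
  have hpd : fderiv ℝ (f ∘ κ.symm) (κ x) = funDeriv f x := by
    ext u
    rw [fderiv_comp_extChartAt_symm (mem_extChartAt_target x)
      ((hf _).mdifferentiableAt (by simp)), symmDeriv_self]
    exact congrArg (fun y => funDeriv f y u) hκx
  have hle := finrank_ker_le_of_dimH_levelSet_le (p := f ∘ κ.symm) (z := κ x) (r := r)
    (U := κ.target) (((hp.contDiffAt (extChartAt_target_mem_nhds x))).of_le (by simp))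
    (by rw [hpd]; exact hsub x) (extChartAt_target_mem_nhds x) (by
      have hsubset : {w ∈ κ.target | (f ∘ κ.symm) w = (f ∘ κ.symm) (κ x)} ⊆
          ⋃ τ ∈ t, (fun τ : S => κ (τ • x)) '' V τ := by
        rintro w ⟨hw, hfw⟩
        simp only [Function.comp_apply, hκx] at hfw
        obtain ⟨τ, hτ⟩ := horb x _ hfw
        have hτ' : τ • x = κ.symm w := hτ
        have hmem : τ ∈ (fun τ : S => τ • x) ⁻¹' κ.source := by
          rw [mem_preimage, hτ']; exact κ.map_target hw
        obtain ⟨τ₀, hτ₀, hin⟩ := mem_iUnion₂.1 (htcov hmem)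
        refine mem_iUnion₂.2 ⟨τ₀, hτ₀, τ, hin, ?_⟩
        simp only [hτ', κ.right_inv hw]
      refine (dimH_mono hsubset).trans ?_
      rw [dimH_bUnion htc]
      exact iSup₂_le fun τ hτ => hVdim τ (ht hτ))
  rw [hpd] at hle
  have hsurj : ∀ y, Function.Surjective (funDeriv (E := E) f y) := hsub
  have hker : ∀ y, Module.finrank ℝ (LinearMap.ker (funDeriv (E := E) f y).toLinearMap) + 1
      = Module.finrank ℝ E := by
    intro y
    have h := LinearMap.finrank_range_add_finrank_ker (funDeriv (E := E) f y).toLinearMap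
    rw [LinearMap.range_eq_top.2 (hsurj y), finrank_top, Module.finrank_self] at h
    omega
  -- Invariance of `f` gives one inclusion. The dimension bound `hle`, obtained at `x`, gives the
  -- other at `σ • x` because all kernels have dimension `dim E - 1`.
  have hrk : LinearMap.range (orbitDeriv (E := E) (E' := E') x σ).toLinearMap
      = LinearMap.ker (funDeriv (E := E) f (σ • x)).toLinearMap := by
    refine Submodule.eq_of_le_of_finrank_le ?_ ?_
    · rintro _ ⟨ξ, rfl⟩
      exact funDeriv_orbitDeriv hf hinv x σ ξ
    · have h1 := hker x
      have h2 := hker (σ • x)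
      omega
  have hv' : v ∈ LinearMap.range (orbitDeriv (E := E) (E' := E') x σ).toLinearMap := by
    rw [hrk]; exact hv
  exact hv'

end Orbits

/-! ### Hypersurfaces of a product that are given by an equation `f x = φ t` -/

section ProductForm

variable {E : Type*} [NormedAddCommGroup E] [NormedSpace ℝ E]

/-- The bilinear form `G + ε dt²` on `E × ℝ`. -/
def prodForm (G : E →L[ℝ] E →L[ℝ] ℝ) (ε : ℝ) : E × ℝ →L[ℝ] E × ℝ →L[ℝ] ℝ :=
  G.bilinearComp (ContinuousLinearMap.fst ℝ E ℝ) (ContinuousLinearMap.fst ℝ E ℝ)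
    + ε • (ContinuousLinearMap.mul ℝ ℝ).bilinearComp (ContinuousLinearMap.snd ℝ E ℝ)
        (ContinuousLinearMap.snd ℝ E ℝ)

theorem prodForm_apply (G : E →L[ℝ] E →L[ℝ] ℝ) (ε : ℝ) (v w : E × ℝ) :
    prodForm G ε v w = G v.1 w.1 + ε * (v.2 * w.2) := by
  simp [prodForm]

theorem prodForm_symm {G : E →L[ℝ] E →L[ℝ] ℝ} (hG : ∀ v w, G v w = G w v) (ε : ℝ)
    (v w : E × ℝ) : prodForm G ε v w = prodForm G ε w v := by
  rw [prodForm_apply, prodForm_apply, hG, mul_comm v.2]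

theorem prodForm_nondegenerate {G : E →L[ℝ] E →L[ℝ] ℝ} (hG : ∀ v, (∀ w, G v w = 0) → v = 0)
    {ε : ℝ} (hε : ε ≠ 0) (v : E × ℝ) (hv : ∀ w, prodForm G ε v w = 0) : v = 0 := by
  refine Prod.ext (hG _ fun w => ?_) ?_
  · simpa [prodForm_apply] using hv (w, 0)
  · simpa [prodForm_apply, hε] using hv (0, 1)

variable [FiniteDimensional ℝ E]

/-- A subspace of dimension `dim E` on which `prodForm G ε N` vanishes is the orthogonal
complement of `N`, if `N` is not null. -/
theorem mem_range_iff_prodForm_eq_zero {V : Type*} [AddCommGroup V] [Module ℝ V]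
    {B : E × ℝ →L[ℝ] E × ℝ →L[ℝ] ℝ} {N : E × ℝ} (hN : B N N ≠ 0)
    (D : V →ₗ[ℝ] E × ℝ) (hD : ∀ X, B N (D X) = 0)
    (hrank : Module.finrank ℝ (LinearMap.range D) = Module.finrank ℝ E) (U : E × ℝ)
    (hU : B N U = 0) : ∃ X, D X = U := by
  have hrk : LinearMap.range D = LinearMap.ker (B N).toLinearMap := by
    refine Submodule.eq_of_le_of_finrank_le ?_ ?_
    · rintro _ ⟨X, rfl⟩
      exact hD X
    · have h1 := LinearMap.finrank_range_add_finrank_ker (B N).toLinearMap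
      have h2 : Function.Surjective (B N).toLinearMap := fun a =>
        ⟨(a / B N N) • N, by
          change B N ((a / B N N) • N) = a
          rw [map_smul, smul_eq_mul, div_mul_cancel₀ _ hN]⟩
      rw [LinearMap.range_eq_top.2 h2, finrank_top, Module.finrank_self, Module.finrank_prod,
        Module.finrank_self] at h1
      omega
  have h : U ∈ LinearMap.range D := by rw [hrk]; exact hU
  exact h

omit [FiniteDimensional ℝ E] in
/-- A vector normal to the orthogonal complement of `N` is a multiple of `N`. -/
theorem eq_smul_of_normal {V : Type*} [AddCommGroup V] [Module ℝ V]
    {B : E × ℝ →L[ℝ] E × ℝ →L[ℝ] ℝ} (hsymm : ∀ v w, B v w = B w v)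
    (hnd : ∀ v, (∀ w, B v w = 0) → v = 0) {N : E × ℝ} (hN : B N N ≠ 0)
    (D : V →ₗ[ℝ] E × ℝ) (hD : ∀ X, B N (D X) = 0)
    (hrange : ∀ U, B N U = 0 → ∃ X, D X = U) (ν : E × ℝ) (hν : ∀ X, B (D X) ν = 0) :
    ν = (B N ν / B N N) • N := by
  rw [← sub_eq_zero]
  refine hnd _ fun U => ?_
  obtain ⟨X, hX⟩ := hrange (U - (B N U / B N N) • N) (by
    rw [map_sub, map_smul, smul_eq_mul, div_mul_cancel₀ _ hN, sub_self])
  have h1 := hν X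
  have h2 := hD X
  have hU : U = D X + (B N U / B N N) • N := by rw [hX]; abel
  rw [hU]
  simp only [map_sub, map_add, map_smul, sub_apply, smul_apply, smul_eq_mul]
  rw [hsymm ν (D X), h1, h2, hsymm ν N]
  field_simp
  ring

end ProductForm

/-! ### Derivatives of the constraint `q(f₁) = φ(f₂)` -/

section SecondDerivative

variable {V : Type*} [NormedAddCommGroup V] [NormedSpace ℝ V]
  {E : Type*} [NormedAddCommGroup E] [NormedSpace ℝ E]

theorem fderiv_of_equation {f : V → E × ℝ} {q : E → ℝ} {φ : ℝ → ℝ} {z : V}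
    (hf : DifferentiableAt ℝ f z) (hq : DifferentiableAt ℝ q (f z).1)
    (hφ : DifferentiableAt ℝ φ (f z).2)
    (h : ∀ᶠ w in nhds z, q (f w).1 = φ (f w).2) (X : V) :
    fderiv ℝ q (f z).1 (fderiv ℝ f z X).1 = deriv φ (f z).2 * (fderiv ℝ f z X).2 := by
  have h1 := hq.hasFDerivAt.comp z (hasFDerivAt_fst.comp z hf.hasFDerivAt)
  have h2 := hφ.hasDerivAt.comp_hasFDerivAt z (hasFDerivAt_snd.comp z hf.hasFDerivAt)
  exact DFunLike.congr_fun (h1.unique (h2.congr_of_eventuallyEq h)) X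

/-- Differentiating the first-order identity once more converts the component of the second
derivative of the map along the normal into second derivatives of `q` and `φ`. This is the
non-Christoffel part of the second fundamental form. -/
theorem fderiv_fderiv_of_equation {f : V → E × ℝ} {q : E → ℝ} {φ : ℝ → ℝ} {z : V}
    (hf : ContDiffAt ℝ 2 f z) (hq : ContDiffAt ℝ 2 q (f z).1) (hφ : ContDiffAt ℝ 2 φ (f z).2)
    (h : ∀ᶠ w in nhds z, q (f w).1 = φ (f w).2) (X Y : V) :
    fderiv ℝ (fderiv ℝ q) (f z).1 (fderiv ℝ f z X).1 (fderiv ℝ f z Y).1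
      + fderiv ℝ q (f z).1 (fderiv ℝ (fderiv ℝ f) z X Y).1
    = deriv (deriv φ) (f z).2 * (fderiv ℝ f z X).2 * (fderiv ℝ f z Y).2
      + deriv φ (f z).2 * (fderiv ℝ (fderiv ℝ f) z X Y).2 := by
  have hf1 : ContinuousAt (fun w => (f w).1) z := continuousAt_fst.comp hf.continuousAt
  have hf2 : ContinuousAt (fun w => (f w).2) z := continuousAt_snd.comp hf.continuousAt
  have hev : ∀ᶠ w in nhds z, fderiv ℝ q (f w).1 (fderiv ℝ f w Y).1
      = deriv φ (f w).2 * (fderiv ℝ f w Y).2 := by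
    filter_upwards [h.eventually_nhds, hf.eventually (by simp), hf1.eventually
      (hq.eventually (by simp)), hf2.eventually (hφ.eventually (by simp))] with w h1 h2 h3 h4
    exact fderiv_of_equation (h2.differentiableAt two_ne_zero) (h3.differentiableAt two_ne_zero)
      (h4.differentiableAt two_ne_zero) h1 Y
  have hfd : HasFDerivAt f (fderiv ℝ f z) z := (hf.differentiableAt two_ne_zero).hasFDerivAt
  have hffd : HasFDerivAt (fderiv ℝ f) (fderiv ℝ (fderiv ℝ f) z) z :=
    ((hf.fderiv_right (m := 1) le_rfl).differentiableAt one_ne_zero).hasFDerivAt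
  have hqd : HasFDerivAt (fderiv ℝ q) (fderiv ℝ (fderiv ℝ q) (f z).1) (f z).1 :=
    ((hq.fderiv_right (m := 1) le_rfl).differentiableAt one_ne_zero).hasFDerivAt
  have hφd : HasDerivAt (deriv φ) (deriv (deriv φ) (f z).2) (f z).2 := by
    have h1 : ContDiffAt ℝ 1 (deriv φ) (f z).2 := by
      have h2 : ContDiffAt ℝ 1 (fun t => fderiv ℝ φ t 1) (f z).2 :=
        (hφ.fderiv_right (m := 1) le_rfl).clm_apply contDiffAt_const
      exact h2
    exact (h1.differentiableAt one_ne_zero).hasDerivAt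
  have hfY := hffd.clm_apply (hasFDerivAt_const Y z)
  have hL := (hqd.comp z (hasFDerivAt_fst.comp z hfd)).clm_apply (hasFDerivAt_fst.comp z hfY)
  have hR := (hφd.comp_hasFDerivAt z (hasFDerivAt_snd.comp z hfd)).mul
    (hasFDerivAt_snd.comp z hfY)
  have hu := DFunLike.congr_fun (hL.unique (hR.congr_of_eventuallyEq hev)) X
  simp at hu
  linarith

end SecondDerivative

/-! ### The product metric and its Christoffel symbols in product charts -/

section ProductMetric

variable {E : Type*} [NormedAddCommGroup E] [NormedSpace ℝ E]
  {M : Type*} [TopologicalSpace M] [ChartedSpace E M] [IsManifold 𝓘(ℝ, E) ∞ M]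
  {g : BilinField 𝓘(ℝ, E) M}

theorem metricInChart_prodMetric (ε : ℝ) (p : M × ℝ) {y : E × ℝ}
    (hy : y.1 ∈ (extChartAt 𝓘(ℝ, E) p.1).target) :
    metricInChart (𝓘(ℝ, E).prod 𝓘(ℝ, ℝ)) (prodMetric 𝓘(ℝ, E) g ε) p y
      = prodForm (metricInChart 𝓘(ℝ, E) g p.1 y.1) ε := by
  have : IsManifold 𝓘(ℝ, E) 1 M := .of_le (n := ∞) (by simp)
  have hsymm : ((extChartAt (𝓘(ℝ, E).prod 𝓘(ℝ, ℝ)) p).symm : E × ℝ → M × ℝ)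
      = fun y => ((extChartAt 𝓘(ℝ, E) p.1).symm y.1, y.2) := by
    rw [extChartAt_prod]; rfl
  have h1 : MDifferentiableAt 𝓘(ℝ, E × ℝ) 𝓘(ℝ, E)
      ((extChartAt 𝓘(ℝ, E) p.1).symm ∘ Prod.fst) y :=
    (mdifferentiableAt_extChartAt_symm hy).comp y
      (differentiableAt_fst (𝕜 := ℝ)).mdifferentiableAt
  have h2 : MDifferentiableAt 𝓘(ℝ, E × ℝ) 𝓘(ℝ, ℝ) (Prod.snd : E × ℝ → ℝ) y :=
    (differentiableAt_snd (𝕜 := ℝ)).mdifferentiableAt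
  have h3 := h1.mfderiv_prod h2
  have h4 := mfderiv_comp y (mdifferentiableAt_extChartAt_symm hy)
    (differentiableAt_fst (𝕜 := ℝ)).mdifferentiableAt
  have hD : ∀ v : E × ℝ, (mfderiv 𝓘(ℝ, E × ℝ) (𝓘(ℝ, E).prod 𝓘(ℝ, ℝ))
      (extChartAt (𝓘(ℝ, E).prod 𝓘(ℝ, ℝ)) p).symm y : E × ℝ →L[ℝ] E × ℝ) v
      = (symmDeriv p.1 y.1 v.1, v.2) := by
    intro v
    rw [hsymm]
    refine (congrArg (fun L : E × ℝ →L[ℝ] E × ℝ => L v) h3).trans ?_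
    refine Prod.ext ?_ ?_
    · refine (congrArg (fun L : E × ℝ →L[ℝ] E => L v) h4).trans ?_
      refine congrArg (symmDeriv p.1 y.1) ?_
      rw [mfderiv_eq_fderiv, fderiv_fst]
      rfl
    · change (mfderiv 𝓘(ℝ, E × ℝ) 𝓘(ℝ, ℝ) Prod.snd y : E × ℝ →L[ℝ] ℝ) v = v.2
      rw [mfderiv_eq_fderiv, fderiv_snd]
      rfl
  refine ContinuousLinearMap.ext fun v => ContinuousLinearMap.ext fun w => ?_
  have hp : ((extChartAt (𝓘(ℝ, E).prod 𝓘(ℝ, ℝ)) p).symm y).1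
      = (extChartAt 𝓘(ℝ, E) p.1).symm y.1 := congrArg (fun F => (F y).1) hsymm
  change prodForm (bilinAt g ((extChartAt (𝓘(ℝ, E).prod 𝓘(ℝ, ℝ)) p).symm y).1) ε
    ((mfderiv 𝓘(ℝ, E × ℝ) (𝓘(ℝ, E).prod 𝓘(ℝ, ℝ))
      (extChartAt (𝓘(ℝ, E).prod 𝓘(ℝ, ℝ)) p).symm y : E × ℝ →L[ℝ] E × ℝ) v)
    ((mfderiv 𝓘(ℝ, E × ℝ) (𝓘(ℝ, E).prod 𝓘(ℝ, ℝ))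
      (extChartAt (𝓘(ℝ, E).prod 𝓘(ℝ, ℝ)) p).symm y : E × ℝ →L[ℝ] E × ℝ) w) = _
  rw [hD, hD, hp, prodForm_apply, prodForm_apply, metricInChart_apply]

variable [FiniteDimensional ℝ E]

set_option maxSynthPendingDepth 3 in
/-- The Christoffel symbols of the first kind of a product metric. -/
theorem christoffelForm_prodMetric (hg : IsSemiRiemannianMetric 𝓘(ℝ, E) g) (ε : ℝ) (p : M × ℝ)
    (U V W : E × ℝ) :
    christoffelForm (𝓘(ℝ, E).prod 𝓘(ℝ, ℝ)) (prodMetric 𝓘(ℝ, E) g ε) p U V W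
      = christoffelBilin (fderiv ℝ (metricInChart 𝓘(ℝ, E) g p.1) (extChartAt 𝓘(ℝ, E) p.1 p.1))
          W.1 U.1 V.1 := by
  let y₀ : E × ℝ := extChartAt (𝓘(ℝ, E).prod 𝓘(ℝ, ℝ)) p p
  have hy₀ : y₀.1 = extChartAt 𝓘(ℝ, E) p.1 p.1 := by
    simp only [y₀, extChartAt_prod]; rfl
  -- `Λ` pulls a form on `E` back to `E × ℝ`. The summand `ε dt²` is constant in the chart, so only
  -- the pullback of the derivative of `g` survives.
  let Λ₀ : (E →L[ℝ] E →L[ℝ] ℝ) →ₗ[ℝ] (E × ℝ →L[ℝ] E × ℝ →L[ℝ] ℝ) :=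
    { toFun := fun B => prodForm B 0
      map_add' := fun B B' => by ext <;> simp [prodForm_apply]
      map_smul' := fun c B => by ext <;> simp [prodForm_apply] }
  let Λ := LinearMap.toContinuousLinearMap Λ₀
  have hΛ : ∀ B, Λ B = prodForm B 0 := fun B => rfl
  have hG : DifferentiableAt ℝ (metricInChart 𝓘(ℝ, E) g p.1) y₀.1 := by
    rw [hy₀]
    exact ((contDiffOn_metricInChart hg p.1).contDiffAt
      (extChartAt_target_mem_nhds p.1)).differentiableAt (by simp)
  have hev : metricInChart (𝓘(ℝ, E).prod 𝓘(ℝ, ℝ)) (prodMetric 𝓘(ℝ, E) g ε) p =ᶠ[nhds y₀]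
      fun y => Λ (metricInChart 𝓘(ℝ, E) g p.1 y.1) + prodForm 0 ε := by
    have h1 : ∀ᶠ y : E × ℝ in nhds y₀, y.1 ∈ (extChartAt 𝓘(ℝ, E) p.1).target := by
      refine continuousAt_fst.eventually (p := fun z => z ∈ (extChartAt 𝓘(ℝ, E) p.1).target) ?_
      rw [hy₀]
      exact extChartAt_target_mem_nhds p.1
    filter_upwards [h1] with y hy
    rw [metricInChart_prodMetric ε p hy, hΛ]
    ext <;> simp [prodForm_apply]
  have hder : HasFDerivAt (fun y : E × ℝ => Λ (metricInChart 𝓘(ℝ, E) g p.1 y.1) + prodForm 0 ε)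
      (Λ.comp ((fderiv ℝ (metricInChart 𝓘(ℝ, E) g p.1) y₀.1).comp
        (ContinuousLinearMap.fst ℝ E ℝ))) y₀ :=
    (Λ.hasFDerivAt.comp y₀ (hG.hasFDerivAt.comp y₀ hasFDerivAt_fst)).add_const _
  have hD : ∀ A B C : E × ℝ,
      fderiv ℝ (metricInChart (𝓘(ℝ, E).prod 𝓘(ℝ, ℝ)) (prodMetric 𝓘(ℝ, E) g ε) p) y₀ A B C
      = fderiv ℝ (metricInChart 𝓘(ℝ, E) g p.1) (extChartAt 𝓘(ℝ, E) p.1 p.1) A.1 B.1 C.1 := by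
    intro A B C
    rw [hev.fderiv_eq (𝕜 := ℝ), hder.fderiv, hy₀]
    simp [hΛ, prodForm_apply]
  rw [christoffelBilin_apply, ← hD, ← hD, ← hD]
  simp only [christoffelForm, smul_apply, add_apply, sub_apply, ContinuousLinearMap.flip_apply,
    smul_eq_mul]
  rfl

end ProductMetric

/-! ### The soliton equation for level hypersurfaces -/

section KeyTheorem

variable {E : Type*} [NormedAddCommGroup E] [NormedSpace ℝ E] [FiniteDimensional ℝ E]
  {M : Type*} [TopologicalSpace M] [ChartedSpace E M] [IsManifold 𝓘(ℝ, E) ∞ M]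
  {g : BilinField 𝓘(ℝ, E) M}
  {E' : Type*} [NormedAddCommGroup E'] [NormedSpace ℝ E']
  {H' : Type*} [TopologicalSpace H'] {J : ModelWithCorners ℝ E' H'} [J.Boundaryless]
  {P : Type*} [TopologicalSpace P] [ChartedSpace H' P]

/-- A hypersurface of `M × ℝ` contained in the level set `f x = φ t`, where `f` has gradient of
constant length, is a translating soliton at a point where `φ` satisfies the soliton equation. -/
theorem translatingSoliton_at_of_equation (hg : IsSemiRiemannianMetric 𝓘(ℝ, E) g)
    {ε ε' : ℝ} (hε : ε = 1 ∨ ε = -1) {f : M → ℝ} (hf : ContMDiff 𝓘(ℝ, E) 𝓘(ℝ, ℝ) ∞ f)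
    (hgrad : ∀ x, g x (semiGradient 𝓘(ℝ, E) g f x) (semiGradient 𝓘(ℝ, E) g f x) = ε')
    (hε' : ε' = 1 ∨ ε' = -1)
    {F : P → M × ℝ} {p : P} (hF : ContMDiffAt J (𝓘(ℝ, E).prod 𝓘(ℝ, ℝ)) 2 F p)
    {φ : ℝ → ℝ} (hφ : ContDiffAt ℝ 2 φ (F p).2)
    (hΦ : ∀ᶠ q in nhds p, f (F q).1 = φ (F q).2)
    (hrank : Module.finrank ℝ (LinearMap.range
      (mfderiv J (𝓘(ℝ, E).prod 𝓘(ℝ, ℝ)) F p : E' →L[ℝ] E × ℝ).toLinearMap) = Module.finrank ℝ E)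
    (hc : ε' + ε * deriv φ (F p).2 ^ 2 ≠ 0)
    (hode : deriv (deriv φ) (F p).2 = ε * ε' * (ε' + ε * deriv φ (F p).2 ^ 2) *
      (divergence 𝓘(ℝ, E) g (semiGradient 𝓘(ℝ, E) g f) (F p).1 - deriv φ (F p).2)) :
    (∀ X : TangentSpace J p,
      IsNormalAt J (𝓘(ℝ, E).prod 𝓘(ℝ, ℝ)) (prodMetric 𝓘(ℝ, E) g ε) F p
        (mfderiv J (𝓘(ℝ, E).prod 𝓘(ℝ, ℝ)) F p X) →
          mfderiv J (𝓘(ℝ, E).prod 𝓘(ℝ, ℝ)) F p X = 0) ∧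
    ∃ v : TangentSpace (𝓘(ℝ, E).prod 𝓘(ℝ, ℝ)) (F p),
      IsMeanCurvatureVectorAt J (𝓘(ℝ, E).prod 𝓘(ℝ, ℝ)) (prodMetric 𝓘(ℝ, E) g ε)
        (Module.finrank ℝ E) F p v ∧
      ∃ X : TangentSpace J p,
        verticalField 𝓘(ℝ, E) (F p) - v = mfderiv J (𝓘(ℝ, E).prod 𝓘(ℝ, ℝ)) F p X := by
  have hE : CompleteSpace E := FiniteDimensional.complete ℝ E
  set x := (F p).1 with hx
  set t := (F p).2 with ht
  set κ := extChartAt 𝓘(ℝ, E) x with hκ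
  set q : E → ℝ := f ∘ κ.symm with hq
  set G := metricInChart 𝓘(ℝ, E) g x with hGdef
  set z₀ := extChartAt J p p with hz₀
  set w : E' → E × ℝ := writtenInExtChartAt J (𝓘(ℝ, E).prod 𝓘(ℝ, ℝ)) p F with hw
  have hεε : ε * ε = 1 := by rcases hε with h | h <;> simp [h]
  have hε'ε' : ε' * ε' = 1 := by rcases hε' with h | h <;> simp [h]
  have hε0 : ε ≠ 0 := by rintro rfl; simp at hεε
  have hκt : κ x ∈ κ.target := mem_extChartAt_target x
  have hκn : κ.target ∈ nhds (κ x) := extChartAt_target_mem_nhds x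
  -- the map in charts
  have hw_apply : ∀ y, w y = (κ (F ((extChartAt J p).symm y)).1, (F ((extChartAt J p).symm y)).2) := by
    intro y
    simp only [w, writtenInExtChartAt, extChartAt_prod, Function.comp_apply]
    rfl
  have hwz : w z₀ = (κ x, t) := by
    rw [hw_apply, hz₀, extChartAt_to_inv]
  have hwC : ContDiffAt ℝ 2 w z₀ := by
    have h := (contMDiffAt_iff.1 hF).2
    rw [J.range_eq_univ, contDiffWithinAt_univ] at h
    exact h
  have hmfd : (mfderiv J (𝓘(ℝ, E).prod 𝓘(ℝ, ℝ)) F p : E' →L[ℝ] E × ℝ) = fderiv ℝ w z₀ := by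
    rw [(hF.mdifferentiableAt (by simp)).mfderiv, J.range_eq_univ, fderivWithin_univ]
  have hqC : ContDiffAt ℝ ∞ q (κ x) := (contDiffOn_comp_extChartAt_symm hf x).contDiffAt hκn
  have hq1 : fderiv ℝ q (κ x) = funDeriv f x := by
    ext u
    rw [fderiv_comp_extChartAt_symm hκt ((hf _).mdifferentiableAt (by simp)), symmDeriv_self]
    exact congrArg (fun y => funDeriv f y u) (extChartAt_to_inv x)
  have hχc : Filter.Tendsto (extChartAt J p).symm (nhds z₀) (nhds p) := by
    have := (continuousAt_extChartAt_symm (I := J) p).tendsto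
    rwa [extChartAt_to_inv] at this
  have heq : ∀ᶠ y in nhds z₀, q (w y).1 = φ (w y).2 := by
    have h1 : ∀ᶠ r in nhds p, (F r).1 ∈ κ.source :=
      (continuousAt_fst.comp hF.continuousAt).eventually
        (extChartAt_source_mem_nhds (I := 𝓘(ℝ, E)) x)
    filter_upwards [hχc.eventually hΦ, hχc.eventually h1] with y h2 h3
    rw [hw_apply, ← h2]
    exact congrArg f (κ.left_inv h3)
  have hwz1 : (w z₀).1 = κ x := by rw [hwz]
  have hwz2 : (w z₀).2 = t := by rw [hwz]
  have hqC' : ContDiffAt ℝ 2 q (w z₀).1 := by rw [hwz1]; exact hqC.of_le ENat.LEInfty.out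
  have hφ' : ContDiffAt ℝ 2 φ (w z₀).2 := by rw [hwz2]; exact hφ
  have hfirst := fderiv_of_equation (hwC.differentiableAt two_ne_zero)
    (hqC'.differentiableAt two_ne_zero) (hφ'.differentiableAt two_ne_zero) heq
  have hsecond := fderiv_fderiv_of_equation hwC hqC' hφ' heq
  rw [hwz1, hwz2] at hfirst hsecond
  rw [hq1] at hfirst
  set D := fderiv ℝ w z₀ with hDdef
  set D2 := fderiv ℝ (fderiv ℝ w) z₀ with hD2def
  set a := deriv φ t with ha
  set b := deriv (deriv φ) t with hb
  -- the metric and the normal vector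
  have hGx : G (κ x) = bilinAt g x := by
    ext u v
    exact metricInChart_self x u v
  set V := gradAt g f x with hV
  have hVc : V = chartGrad G q (κ x) := gradAt_eq_chartGrad hg x ((hf x).mdifferentiableAt (by simp))
  set B := prodForm (bilinAt g x) ε with hB
  have hBsymm : ∀ u v, B u v = B v u := prodForm_symm (bilinAt_symm hg x) ε
  have hBnd : ∀ v, (∀ u, B v u = 0) → v = 0 := prodForm_nondegenerate (E := E) (G := bilinAt g x) (hg.nondegenerate x) hε0
  -- `N` is the gradient of `f - φ(t)`: raising the index of `-a dt` divides by `ε`, which equals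
  -- multiplying by `ε`.
  set N : E × ℝ := (V, -ε * a) with hN
  have hBN : ∀ U, B N U = funDeriv f x U.1 - a * U.2 := by
    intro U
    rw [hB, prodForm_apply, hN, bilinAt_gradAt hg]
    linear_combination (-a * U.2) * hεε
  have hVV : funDeriv f x V = ε' := by
    rw [← bilinAt_gradAt hg]; exact hgrad x
  have hBNN : B N N = ε' + ε * a ^ 2 := by
    rw [hBN, hN, hVV]; ring
  have hBNN0 : B N N ≠ 0 := by rw [hBNN]; exact hc
  have hBD : ∀ X, B N (D X) = 0 := fun X => by rw [hBN, hfirst, sub_self]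
  rw [hmfd] at hrank
  have hrange : ∀ U, B N U = 0 → ∃ X, D X = U :=
    mem_range_iff_prodForm_eq_zero hBNN0 D.toLinearMap hBD hrank
  have hnormal : ∀ ν, (∀ X, B (D X) ν = 0) → ν = (B N ν / B N N) • N :=
    eq_smul_of_normal hBsymm hBnd hBNN0 D.toLinearMap hBD hrange
  -- the Hessian
  set Hs := chartHess G q (κ x) with hHs
  have hinv : (G (κ x)).IsInvertible := isInvertible_metricInChart hg hκt
  have hGC : ContDiffAt ℝ ∞ G (κ x) := (contDiffOn_metricInChart hg x).contDiffAt hκn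
  have hHVV : Hs V V = 0 := by
    rw [hVc]
    refine chartHess_grad_grad (c := ε') (.of_forall fun z => metricInChart_symm hg x z)
      (hGC.of_le (by simp)) (hqC.of_le ENat.LEInfty.out) hinv ?_
    filter_upwards [hκn] with z hz
    have h1 := vectorInChart_semiGradient hg hz ((hf (κ.symm z)).mdifferentiableAt (by simp))
    rw [← h1, hGdef, metricInChart_apply]
    change bilinAt g _ (symmDeriv x z (chartFwdDeriv x (κ.symm z) (gradAt g f (κ.symm z))))
      (symmDeriv x z (chartFwdDeriv x (κ.symm z) (gradAt g f (κ.symm z)))) = ε'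
    have : IsManifold 𝓘(ℝ, E) 1 M := .of_le (n := ∞) (by simp)
    rw [symmDeriv_chartFwdDeriv hz]
    exact hgrad _
  let AM : E →L[ℝ] E := (G (κ x)).inverse.comp Hs
  have hAM : ∀ u v, bilinAt g x (AM u) v = Hs u v := by
    intro u v
    rw [← hGx]
    exact congrArg (fun L : E →L[ℝ] ℝ => L v) (hinv.self_apply_inverse (Hs u))
  set δ := divergence 𝓘(ℝ, E) g (semiGradient 𝓘(ℝ, E) g f) x with hδ
  have htrM : LinearMap.trace ℝ E AM.toLinearMap = δ := (divergence_semiGradient hg hf x).symm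
  -- `A` is dual to the Hessian of `f - φ(t)`; its second block again carries `ε` in place of `ε⁻¹`.
  let A : E × ℝ →ₗ[ℝ] E × ℝ := LinearMap.prodMap AM.toLinearMap ((-ε * b) • LinearMap.id)
  have hA : ∀ U, B (A U) U = Hs U.1 U.1 - b * U.2 ^ 2 := by
    intro U
    rw [hB, prodForm_apply]
    change bilinAt g x (AM U.1) U.1 + ε * ((-ε * b * U.2) * U.2) = _
    rw [hAM]
    linear_combination (-b * U.2 ^ 2) * hεε
  have htr : LinearMap.trace ℝ (E × ℝ) A = δ - ε * b := by
    rw [LinearMap.trace_prodMap', htrM, map_smul, LinearMap.trace_id]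
    simp
    ring
  -- the second fundamental form
  obtain ⟨cov, hcovdef⟩ : ∃ cov : E' → E × ℝ, ∀ X : E', cov X =
      covDerivAlong J (𝓘(ℝ, E).prod 𝓘(ℝ, ℝ)) (prodMetric 𝓘(ℝ, E) g ε) F p X X :=
    ⟨_, fun X => rfl⟩
  -- The twice differentiated constraint supplies the second derivative part of the Hessian, and the
  -- Christoffel symbols of the product supply the rest.
  have hcov : ∀ X : E', B (cov X) N = -(Hs (D X).1 (D X).1 - b * (D X).2 ^ 2) := by
    intro X
    have hBinv : B.IsInvertible := isInvertible_of_nondegenerate B hBnd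
    have h1 : B (cov X) N = B (D2 X X + B.inverse (christoffelForm (𝓘(ℝ, E).prod 𝓘(ℝ, ℝ))
            (prodMetric 𝓘(ℝ, E) g ε) (F p) (D X) (D X))) N := by
      rw [← hmfd, hcovdef]
      rfl
    rw [h1, map_add, add_apply, hBinv.self_apply_inverse, christoffelForm_prodMetric hg, hBsymm, hBN]
    have h2 := hsecond X X
    rw [hq1] at h2
    have h3 : Hs (D X).1 (D X).1 = fderiv ℝ (fderiv ℝ q) (κ x) (D X).1 (D X).1
        - christoffelBilin (fderiv ℝ G (κ x)) V (D X).1 (D X).1 := by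
      rw [hHs, hVc]; rfl
    rw [h3]
    change _ + christoffelBilin (fderiv ℝ G (κ x)) V (D X).1 (D X).1 = _
    linear_combination h2
  have hnorm_iff : ∀ ν : TangentSpace (𝓘(ℝ, E).prod 𝓘(ℝ, ℝ)) (F p),
      IsNormalAt J (𝓘(ℝ, E).prod 𝓘(ℝ, ℝ)) (prodMetric 𝓘(ℝ, E) g ε) F p ν →
        ∀ X, B (D X) ν = 0 := by
    intro ν hν X
    rw [← hmfd]
    exact hν X
  have hvn : ∀ X : E', B (D X) ((-a / B N N) • N) = 0 := by
    intro X
    rw [map_smul, hBsymm (D X), hBD, smul_zero]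
  have hsum : ∀ (X : Fin (Module.finrank ℝ E) → E') (η : Fin (Module.finrank ℝ E) → ℝ),
      (∀ i, η i = 1 ∨ η i = -1) →
      (∀ i j, B (D (X i)) (D (X j)) = if i = j then η i else 0) →
      ∀ μ : ℝ, ∑ i, η i * B (cov (X i)) (μ • N : E × ℝ) = - a * μ := by
    intro X η hη he μ
    have htrace := trace_eq_sum_orthonormal_add_normal
      ((ContinuousLinearMap.coeLM ℝ).comp B.toLinearMap) hBsymm
      (by rw [Module.finrank_prod, Module.finrank_self]) (fun i => D (X i)) η hη he N hBNN0
      (fun i => (hBsymm _ _).trans (hBD _)) A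
    have hBA : ∀ u v, ((ContinuousLinearMap.coeLM ℝ).comp B.toLinearMap) u v = B u v :=
      fun u v => rfl
    simp only [hBA, hA, htr, hBNN] at htrace
    -- `Hs V V = 0` leaves only the vertical term.
    have hNA : Hs N.1 N.1 - b * N.2 ^ 2 = - b * a ^ 2 := by
      simp only [hN]
      rw [hHVV]
      linear_combination (-b * a ^ 2) * hεε
    rw [hNA] at htrace
    have h2 : ∑ i, η i * B (cov (X i)) (μ • N : E × ℝ) = -μ * ∑ i, η i * (Hs (D (X i)).1 (D (X i)).1 - b * (D (X i)).2 ^ 2) := by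
      rw [Finset.mul_sum]
      refine Finset.sum_congr rfl fun i _ => ?_
      rw [map_smul, smul_eq_mul, hcov]
      ring
    rw [h2]
    -- Here the differential equation is used: the tangential trace of the Hessian collapses to
    -- `φ'`.
    have h3 : ∑ i, η i * (Hs (D (X i)).1 (D (X i)).1 - b * (D (X i)).2 ^ 2) = a := by
      have h4 : ∑ i, η i * (Hs (D (X i)).1 (D (X i)).1 - b * (D (X i)).2 ^ 2)
          = δ - ε * b + b * a ^ 2 / (ε' + ε * a ^ 2) := by
        rw [htrace]; ring
      have h5 : b * a ^ 2 / (ε' + ε * a ^ 2) = ε * ε' * (δ - a) * a ^ 2 := by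
        rw [hode]
        field_simp
      rw [h4, h5, hode]
      linear_combination (-(δ - a) * ε' ^ 2 - (δ - a) * ε * ε' * a ^ 2) * hεε
        - (δ - a) * hε'ε'
    rw [h3]
    ring
  -- The witness is the normal component of `∂_t`, since `⟨∂_t, N⟩ = -a`.
  refine ⟨fun X hX => ?_, ((-a / B N N) • N : E × ℝ), ⟨fun X => ?_, ?_⟩, ?_⟩
  · have h1 := hnorm_iff _ hX
    have h2 := hnormal _ h1
    have h3 : B N (mfderiv J (𝓘(ℝ, E).prod 𝓘(ℝ, ℝ)) F p X : E × ℝ) = 0 := by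
      have := hBD X
      rwa [← hmfd] at this
    rw [h3, zero_div, zero_smul] at h2
    exact h2
  · have h1 := hvn X
    rw [← hmfd] at h1
    exact h1
  · intro X η hframe ν hν
    have h1 := hnormal _ (hnorm_iff ν hν)
    have hη := hframe.1
    have he : ∀ i j, B (D (X i)) (D (X j)) = if i = j then η i else 0 := by
      intro i j
      rw [← hmfd]
      exact hframe.2 i j
    set μ := B N ν / B N N with hμ
    have hlhs : B ((-a / B N N) • N) (μ • N) = - a * μ := by
      rw [map_smul, map_smul, smul_apply, smul_eq_mul, smul_eq_mul]
      field_simp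
    have h2 := hsum X η hη he μ
    rw [h1]
    refine hlhs.trans (h2.symm.trans ?_)
    refine Finset.sum_congr rfl fun i _ => ?_
    exact congrArg (fun c : E × ℝ => η i * B c (μ • N)) (hcovdef (X i))
  · obtain ⟨X, hX⟩ := hrange ((0, 1) - (-a / B N N) • N) (by
      rw [map_sub, map_smul, hBN (0, 1), smul_eq_mul, div_mul_cancel₀ _ hBNN0]
      simp)
    refine ⟨X, ?_⟩
    change (0, 1) - (-a / B N N) • N = (mfderiv J (𝓘(ℝ, E).prod 𝓘(ℝ, ℝ)) F p : E' →L[ℝ] E × ℝ) X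
    rw [hmfd]
    exact hX.symm

end KeyTheorem

/-! ### Integral curves of the gradient -/

/-- Solutions of a smooth autonomous differential equation are smooth. -/
theorem contDiffOn_of_hasDerivAt_comp {V : Type*} [NormedAddCommGroup V] [NormedSpace ℝ V]
    {X : V → V} {U : Set V} (hX : ContDiffOn ℝ ∞ X U) {γ : ℝ → V} {s : Set ℝ} (hs : IsOpen s)
    (hm : MapsTo γ s U) (hγ : ∀ t ∈ s, HasDerivAt γ (X (γ t)) t) : ContDiffOn ℝ ∞ γ s := by
  rw [contDiffOn_infty]
  intro n
  induction n with
  | zero =>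
    exact contDiffOn_zero.2 fun t ht => (hγ t ht).continuousAt.continuousWithinAt
  | succ n ih =>
    rw [Nat.cast_add, Nat.cast_one, contDiffOn_succ_iff_deriv_of_isOpen hs]
    refine ⟨fun t ht => (hγ t ht).differentiableAt.differentiableWithinAt, by simp, ?_⟩
    -- Bootstrapping: `γ' = X ∘ γ` is as regular as `γ`, so `γ` gains one derivative.
    exact ((hX.of_le (by exact_mod_cast le_top)).comp ih hm).congr fun t ht => (hγ t ht).deriv

section GradientCurves

variable {E : Type*} [NormedAddCommGroup E] [NormedSpace ℝ E] [FiniteDimensional ℝ E]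
  {M : Type*} [TopologicalSpace M] [ChartedSpace E M] [IsManifold 𝓘(ℝ, E) ∞ M]
  {g : BilinField 𝓘(ℝ, E) M}

theorem contDiffOn_vectorInChart_semiGradient (hg : IsSemiRiemannianMetric 𝓘(ℝ, E) g) {f : M → ℝ}
    (hf : ContMDiff 𝓘(ℝ, E) 𝓘(ℝ, ℝ) ∞ f) (x₀ : M) :
    ContDiffOn ℝ ∞ (vectorInChart 𝓘(ℝ, E) (semiGradient 𝓘(ℝ, E) g f) x₀)
      (extChartAt 𝓘(ℝ, E) x₀).target := by
  have hE : CompleteSpace E := FiniteDimensional.complete ℝ E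
  have h : ContDiffOn ℝ ∞ (chartGrad (metricInChart 𝓘(ℝ, E) g x₀)
      (f ∘ (extChartAt 𝓘(ℝ, E) x₀).symm)) (extChartAt 𝓘(ℝ, E) x₀).target := by
    intro z hz
    have hn := extChartAt_target_mem_nhds_of_mem hz
    exact (contDiffAt_chartGrad ((contDiffOn_metricInChart hg x₀).contDiffAt hn)
      ((contDiffOn_comp_extChartAt_symm hf x₀).contDiffAt hn)
      (isInvertible_metricInChart hg hz)).contDiffWithinAt
  exact h.congr fun z hz =>
    vectorInChart_semiGradient hg hz ((hf _).mdifferentiableAt (by simp))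

theorem contMDiff_smul_semiGradient (hg : IsSemiRiemannianMetric 𝓘(ℝ, E) g) {f : M → ℝ}
    (hf : ContMDiff 𝓘(ℝ, E) 𝓘(ℝ, ℝ) ∞ f) (c : ℝ) :
    ContMDiff 𝓘(ℝ, E) (𝓘(ℝ, E).prod 𝓘(ℝ, E)) ∞
      (fun x => (⟨x, c • semiGradient 𝓘(ℝ, E) g f x⟩ : TangentBundle 𝓘(ℝ, E) M)) := by
  intro x₀
  rw [Bundle.contMDiffAt_section]
  have h1 : ContMDiffAt 𝓘(ℝ, E) 𝓘(ℝ, E) ∞ (fun x => c •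
      vectorInChart 𝓘(ℝ, E) (semiGradient 𝓘(ℝ, E) g f) x₀ (extChartAt 𝓘(ℝ, E) x₀ x)) x₀ := by
    have h2 := (contDiffOn_vectorInChart_semiGradient hg hf x₀).contDiffAt
      (extChartAt_target_mem_nhds x₀)
    exact ((contDiffAt_const.smul h2).contMDiffAt).comp x₀ (contMDiffAt_extChartAt (n := ∞))
  refine h1.congr_of_eventuallyEq ?_
  filter_upwards [(chartAt E x₀).open_source.mem_nhds (mem_chart_source E x₀)] with x hx
  have h3 := TangentBundle.continuousLinearMapAt_trivializationAt (I := 𝓘(ℝ, E)) hx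
  have h4 := congrArg (fun L : E →L[ℝ] E => L (c • gradAt g f x)) h3
  have h5 : (trivializationAt E (TangentSpace 𝓘(ℝ, E) : M → Type _) x₀).continuousLinearMapAt ℝ x
      (c • semiGradient 𝓘(ℝ, E) g f x) = c • chartFwdDeriv x₀ x (gradAt g f x) :=
    h4.trans (map_smul (chartFwdDeriv x₀ x) c _)
  rw [Bundle.Trivialization.continuousLinearMapAt_apply,
    Bundle.Trivialization.coe_linearMapAt_of_mem _ (by simpa using hx)] at h5
  refine h5.trans ?_
  rw [vectorInChart, (extChartAt 𝓘(ℝ, E) x₀).left_inv (by simpa using hx)]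
  rfl

/-- An integral curve is a priori only differentiable. In the chart at `α t` it solves an autonomous
equation with smooth right-hand side, so the bootstrap applies. -/
theorem contMDiffAt_of_eventually_hasMFDerivAt_smul_semiGradient
    (hg : IsSemiRiemannianMetric 𝓘(ℝ, E) g) {f : M → ℝ}
    (hf : ContMDiff 𝓘(ℝ, E) 𝓘(ℝ, ℝ) ∞ f) {c : ℝ} {α : ℝ → M} {t : ℝ}
    (hα : IsMIntegralCurveAt (I := 𝓘(ℝ, E)) α (fun x => c • semiGradient 𝓘(ℝ, E) g f x) t) :
    ContMDiffAt 𝓘(ℝ, ℝ) 𝓘(ℝ, E) ∞ α t := by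
  have hM : IsManifold 𝓘(ℝ, E) 1 M := .of_le (n := ∞) (by simp)
  rw [contMDiffAt_iff_target]
  refine ⟨hα.continuousAt, ?_⟩
  rw [contMDiffAt_iff_contDiffAt]
  set κ := extChartAt 𝓘(ℝ, E) (α t)
  have h1 : ∀ᶠ s in nhds t, α s ∈ κ.source :=
    hα.continuousAt.eventually (extChartAt_source_mem_nhds (I := 𝓘(ℝ, E)) (α t))
  obtain ⟨s, hs, hso, hts⟩ := eventually_nhds_iff.1 (h1.and hα)
  refine (contDiffOn_of_hasDerivAt_comp (X := fun z => c •
    vectorInChart 𝓘(ℝ, E) (semiGradient 𝓘(ℝ, E) g f) (α t) z) (U := κ.target)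
    (contDiffOn_const.smul (contDiffOn_vectorInChart_semiGradient hg hf (α t))) hso
    (fun r hr => κ.map_source (hs r hr).1) fun r hr => ?_).contDiffAt (hso.mem_nhds hts)
  have h2 := (hs r hr).1
  have h3 : HasMFDerivAt 𝓘(ℝ, E) 𝓘(ℝ, E) κ (α r) (chartFwdDeriv (E := E) (α t) (α r)) :=
    (mdifferentiableAt_extChartAt (by simpa [κ] using h2)).hasMFDerivAt
  have h5 : HasFDerivAt (κ ∘ α) ((chartFwdDeriv (α t) (α r)).comp
      ((1 : ℝ →L[ℝ] ℝ).smulRight (c • gradAt g f (α r))) : ℝ →L[ℝ] E) r :=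
    hasMFDerivAt_iff_hasFDerivAt.1 (h3.comp r (hs r hr).2)
  have h4 : vectorInChart 𝓘(ℝ, E) (semiGradient 𝓘(ℝ, E) g f) (α t) (κ (α r))
      = chartFwdDeriv (α t) (α r) (gradAt g f (α r)) := by
    rw [vectorInChart, κ.left_inv h2]
    rfl
  refine h5.hasDerivAt.congr_deriv ?_
  simp [h4]

variable {E' : Type*} [NormedAddCommGroup E'] [NormedSpace ℝ E']
  {S : Type*} [TopologicalSpace S] [ChartedSpace E' S] [Group S] [MulAction S M]
  [ContMDiffSMul 𝓘(ℝ, E') 𝓘(ℝ, E) ∞ S M]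

variable (E')

include E'

/-- The gradient of an invariant function is invariant under isometries. -/
theorem smulDeriv_gradAt (hg : IsSemiRiemannianMetric 𝓘(ℝ, E) g)
    (hisom : ∀ (σ : S) (x : M) (v w : E),
      bilinAt g (σ • x) (smulDeriv σ x v) (smulDeriv σ x w) = bilinAt g x v w)
    {f : M → ℝ} (hf : ContMDiff 𝓘(ℝ, E) 𝓘(ℝ, ℝ) ∞ f) (hinv : ∀ (σ : S) (x : M), f (σ • x) = f x)
    (σ : S) (x : M) : smulDeriv σ x (gradAt g f x) = gradAt g f (σ • x) := by
  rw [← sub_eq_zero]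
  refine hg.nondegenerate (σ • x) _ fun w => ?_
  change bilinAt g (σ • x) (smulDeriv σ x (gradAt g f x) - gradAt g f (σ • x)) w = 0
  obtain ⟨w, rfl⟩ : ∃ w' : E, w = smulDeriv (E := E) σ x w' :=
    ⟨_, (smulDeriv_smulDeriv_inv (E := E) E' σ x w).symm⟩
  rw [map_sub, sub_apply, hisom, bilinAt_gradAt hg, bilinAt_gradAt hg,
    funDeriv_smulDeriv (E' := E') hf hinv, sub_self]

/-- The stabilizers along an integral curve of the gradient of an invariant function are
constant. -/
theorem stabilizer_eq_of_isMIntegralCurveOn [T2Space M] (hg : IsSemiRiemannianMetric 𝓘(ℝ, E) g)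
    (hisom : ∀ (σ : S) (x : M) (v w : E),
      bilinAt g (σ • x) (smulDeriv σ x v) (smulDeriv σ x w) = bilinAt g x v w)
    {f : M → ℝ} (hf : ContMDiff 𝓘(ℝ, E) 𝓘(ℝ, ℝ) ∞ f) (hinv : ∀ (σ : S) (x : M), f (σ • x) = f x)
    {c a b : ℝ} {α : ℝ → M} (hα : IsMIntegralCurveOn (I := 𝓘(ℝ, E)) α
      (fun x => c • semiGradient 𝓘(ℝ, E) g f x) (Ioo a b)) {s t : ℝ} (hs : s ∈ Ioo a b)
    (ht : t ∈ Ioo a b) :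
    MulAction.stabilizer S (α s) = MulAction.stabilizer S (α t) := by
  have hM : IsManifold 𝓘(ℝ, E) 1 M := .of_le (n := ∞) (by simp)
  have hE : CompleteSpace E := FiniteDimensional.complete ℝ E
  have key : ∀ s ∈ Ioo a b, ∀ t ∈ Ioo a b, ∀ σ : S, σ • α s = α s → σ • α t = α t := by
    intro s hs t ht σ hσ
    -- A translate of an integral curve is an integral curve because the gradient is invariant; if
    -- `σ` fixes one point of `α`, uniqueness makes it fix all of them.
    have h1 : IsMIntegralCurveOn (I := 𝓘(ℝ, E)) (fun r => σ • α r)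
        (fun x => c • semiGradient 𝓘(ℝ, E) g f x) (Ioo a b) := by
      intro r hr
      have h2 : HasMFDerivAt 𝓘(ℝ, E) 𝓘(ℝ, E) (fun y : M => σ • y) (α r) (smulDeriv (E := E) σ (α r)) :=
        (mdifferentiable_const_smul E' σ (α r)).hasMFDerivAt
      refine (h2.comp_hasMFDerivWithinAt r (hα r hr)).congr_mfderiv ?_
      change ((smulDeriv σ (α r)).comp
        ((1 : ℝ →L[ℝ] ℝ).smulRight (c • gradAt g f (α r))) : ℝ →L[ℝ] E) =
          (1 : ℝ →L[ℝ] ℝ).smulRight (c • gradAt g f (σ • α r))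
      ext
      simp [smulDeriv_gradAt E' hg hisom hf hinv]
    exact isMIntegralCurveOn_Ioo_eqOn_of_contMDiff_boundaryless hs
      ((contMDiff_smul_semiGradient hg hf c).of_le (by simp)) h1 hα hσ ht
  ext σ
  exact ⟨key s hs t ht σ, key t ht s hs σ⟩

/-- Through each point there is an integral curve of the normalized gradient, along which the
function is the curve parameter. -/
theorem exists_curve_of_gradient_unit [T2Space M] (hg : IsSemiRiemannianMetric 𝓘(ℝ, E) g)
    (hisom : ∀ (σ : S) (x : M) (v w : E),
      bilinAt g (σ • x) (smulDeriv σ x v) (smulDeriv σ x w) = bilinAt g x v w)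
    {f : M → ℝ} (hf : ContMDiff 𝓘(ℝ, E) 𝓘(ℝ, ℝ) ∞ f) (hinv : ∀ (σ : S) (x : M), f (σ • x) = f x)
    {ε' : ℝ} (hε' : ε' = 1 ∨ ε' = -1)
    (hgrad : ∀ x, g x (semiGradient 𝓘(ℝ, E) g f x) (semiGradient 𝓘(ℝ, E) g f x) = ε') (x₀ : M) :
    ∃ δ > 0, ∃ α : ℝ → M,
      (∀ s ∈ Ioo (f x₀ - δ) (f x₀ + δ), ContMDiffAt 𝓘(ℝ, ℝ) 𝓘(ℝ, E) ∞ α s ∧ f (α s) = s ∧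
        MulAction.stabilizer S (α s) = MulAction.stabilizer S (α (f x₀))) := by
  have hM : IsManifold 𝓘(ℝ, E) 1 M := .of_le (n := ∞) (by simp)
  have hE : CompleteSpace E := FiniteDimensional.complete ℝ E
  -- The factor `ε'` normalizes the speed: `df(ε' ∇f) = ε'² = 1`. Starting at time `f x₀` then makes
  -- `f ∘ α` the identity.
  obtain ⟨α, hα0, hα⟩ := exists_isMIntegralCurveAt_of_contMDiffAt_boundaryless (I := 𝓘(ℝ, E))
    (v := fun x => ε' • semiGradient 𝓘(ℝ, E) g f x) (x₀ := x₀) (f x₀)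
    (((contMDiff_smul_semiGradient hg hf ε') x₀).of_le (by simp))
  obtain ⟨δ, hδ, hα⟩ := isMIntegralCurveAt_iff'.1 hα
  rw [Real.ball_eq_Ioo] at hα
  have hmem : f x₀ ∈ Ioo (f x₀ - δ) (f x₀ + δ) := ⟨by linarith, by linarith⟩
  have hder : ∀ s ∈ Ioo (f x₀ - δ) (f x₀ + δ), HasDerivAt (f ∘ α) 1 s := by
    intro s hs
    have h1 := (hα s hs).hasMFDerivAt (isOpen_Ioo.mem_nhds hs)
    have h2 : HasMFDerivAt 𝓘(ℝ, E) 𝓘(ℝ, ℝ) f (α s) (funDeriv (E := E) f (α s)) :=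
      ((hf (α s)).mdifferentiableAt (by simp)).hasMFDerivAt
    have h4 : HasFDerivAt (f ∘ α) ((funDeriv f (α s)).comp
        ((1 : ℝ →L[ℝ] ℝ).smulRight (ε' • gradAt g f (α s))) : ℝ →L[ℝ] ℝ) s :=
      hasMFDerivAt_iff_hasFDerivAt.1 (h2.comp s h1)
    have h3 : funDeriv f (α s) (gradAt g f (α s)) = ε' := by
      rw [← bilinAt_gradAt hg]; exact hgrad (α s)
    refine h4.hasDerivAt.congr_deriv ?_
    rcases hε' with h | h <;> simp [h3, h]
  refine ⟨δ, hδ, α, fun s hs => ⟨?_, ?_, ?_⟩⟩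
  · exact contMDiffAt_of_eventually_hasMFDerivAt_smul_semiGradient hg hf
      (hα.isMIntegralCurveAt (isOpen_Ioo.mem_nhds hs))
  · refine isOpen_Ioo.eqOn_of_deriv_eq (f := f ∘ α) (g := id) isPreconnected_Ioo
      (fun r hr => (hder r hr).differentiableAt.differentiableWithinAt)
      differentiableOn_id (fun r hr => ?_) hmem ?_ hs
    · rw [(hder r hr).deriv, deriv_id]
    · simp [hα0]
  · exact stabilizer_eq_of_isMIntegralCurveOn E' hg hisom hf hinv hα hs hmem

end GradientCurves

/-! ### The profile curve -/

/-- `ψ` inverts `φ` on the half-open interval from `a` (included) to `b` (excluded), and is smooth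
in the open interval. -/
structure IsSmoothInverseOn (φ ψ : ℝ → ℝ) (a b : ℝ) : Prop where
  map_left : ψ (φ a) = a
  continuousOn : ContinuousOn ψ (insert (φ a) (uIoo (φ a) (φ b)))
  mapsTo_uIoo : ∀ s ∈ uIoo (φ a) (φ b), ψ s ∈ uIoo a b
  apply_apply : ∀ s ∈ uIoo (φ a) (φ b), φ (ψ s) = s
  contDiffAt : ∀ s ∈ uIoo (φ a) (φ b), ContDiffAt ℝ ∞ ψ s
  mem_uIoo : ∀ y ∈ uIoo a b, φ y ∈ uIoo (φ a) (φ b)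
  left_inv : ∀ y ∈ uIoo a b, ψ (φ y) = y

/-- Rolle's theorem gives injectivity, compactness gives continuity of the inverse up to the ends,
and the inverse function theorem gives smoothness inside. The derivative of `φ` may vanish at `a`,
as it does at the neck, so no more than continuity can be asked there. -/
theorem exists_isSmoothInverseOn {φ : ℝ → ℝ} {a b : ℝ}
    (hφ : ∀ y ∈ uIcc a b, ContDiffAt ℝ ∞ φ y) (hφ' : ∀ y ∈ uIoo a b, deriv φ y ≠ 0) :
    ∃ ψ, IsSmoothInverseOn φ ψ a b := by
  have hcont : ContinuousOn φ (uIcc a b) := fun y hy => (hφ y hy).continuousAt.continuousWithinAt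
  have haux : ∀ x ∈ uIcc a b, ∀ y ∈ uIcc a b, x < y → φ x ≠ φ y := by
    intro x hx y hy hxy heq
    obtain ⟨c, hc, hc0⟩ := exists_deriv_eq_zero hxy
      (hcont.mono ((uIcc_of_le hxy.le).symm.subset.trans (uIcc_subset_uIcc hx hy))) heq
    exact hφ' c ⟨hx.1.trans_lt hc.1, hc.2.trans_le hy.2⟩ hc0
  have hinj : InjOn φ (uIcc a b) := by
    intro x hx y hy hxy
    by_contra hne
    rcases lt_or_gt_of_ne hne with h | h
    · exact haux x hx y hy h hxy
    · exact haux y hy x hx h hxy.symm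
  have hmono := hcont.strictMonoOn_of_injOn_Icc' inf_le_sup hinj
  have ha : a ∈ uIcc a b := left_mem_uIcc
  have hb : b ∈ uIcc a b := right_mem_uIcc
  have hmem : ∀ y ∈ uIoo a b, φ y ∈ uIoo (φ a) (φ b) := by
    intro y hy
    have hy' : y ∈ uIcc a b := uIoo_subset_uIcc_self hy
    rw [uIoo_eq_union] at hy
    rcases hmono with h | h <;> rcases hy with hy | hy
    · exact mem_uIoo_of_lt (h ha hy' hy.1) (h hy' hb hy.2)
    · exact mem_uIoo_of_gt (h hb hy' hy.1) (h hy' ha hy.2)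
    · exact mem_uIoo_of_gt (h hy' hb hy.2) (h ha hy' hy.1)
    · exact mem_uIoo_of_lt (h hy' ha hy.2) (h hb hy' hy.1)
  have hsurj : uIcc (φ a) (φ b) ⊆ φ '' uIcc a b := intermediate_value_uIcc hcont
  let ψ := Function.invFunOn φ (uIcc a b)
  have hψmem : ∀ s ∈ uIcc (φ a) (φ b), ψ s ∈ uIcc a b := fun s hs =>
    Function.invFunOn_mem (hsurj hs)
  have hψ : ∀ s ∈ uIcc (φ a) (φ b), φ (ψ s) = s := fun s hs =>
    Function.invFunOn_eq (hsurj hs)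
  have hleft : ∀ y ∈ uIcc a b, ψ (φ y) = y := fun y hy => hinj.leftInvOn_invFunOn hy
  have hψ' : ∀ s ∈ uIoo (φ a) (φ b), ψ s ∈ uIoo a b := by
    intro s hs
    have hs' := uIoo_subset_uIcc_self hs
    have h1 := hψmem s hs'
    have h2 : ψ s ≠ a := by
      intro h
      have h3 := hψ s hs'
      rw [h] at h3
      rw [← h3] at hs
      exact left_notMem_uIoo hs
    have h2' : ψ s ≠ b := by
      intro h
      have h3 := hψ s hs'
      rw [h] at h3
      rw [← h3] at hs
      exact right_notMem_uIoo hs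
    rcases le_total a b with hab | hab
    · rw [uIcc_of_le hab] at h1
      rw [uIoo_of_le hab]
      exact ⟨lt_of_le_of_ne h1.1 h2.symm, lt_of_le_of_ne h1.2 h2'⟩
    · rw [uIcc_of_ge hab] at h1
      rw [uIoo_of_ge hab]
      exact ⟨lt_of_le_of_ne h1.1 h2'.symm, lt_of_le_of_ne h1.2 h2⟩
  have hψcont : ContinuousOn ψ (uIcc (φ a) (φ b)) := by
    have hK : CompactSpace (uIcc a b) := isCompact_iff_compactSpace.1 isCompact_uIcc
    -- A continuous injection from a compact interval is an embedding, so its inverse is continuous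
    -- at the endpoints too.
    have he : Topology.IsClosedEmbedding ((uIcc a b).domRestrict φ) :=
      (continuousOn_iff_continuous_domRestrict.1 hcont).isClosedEmbedding hinj.injective
    have h1 : Continuous fun s : uIcc (φ a) (φ b) => (⟨ψ s, hψmem s s.2⟩ : uIcc a b) := by
      rw [he.isInducing.continuous_iff]
      refine continuous_subtype_val.congr fun s => ?_
      exact (hψ s s.2).symm
    exact continuousOn_iff_continuous_domRestrict.2 (continuous_subtype_val.comp h1)
  have hsub : insert (φ a) (uIoo (φ a) (φ b)) ⊆ uIcc (φ a) (φ b) :=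
    insert_subset left_mem_uIcc uIoo_subset_uIcc_self
  refine ⟨ψ, hleft a ha, hψcont.mono hsub, hψ', fun s hs => hψ s (uIoo_subset_uIcc_self hs),
    fun s hs => ?_, hmem, fun y hy => hleft y (uIoo_subset_uIcc_self hy)⟩
  have hy := hψ' s hs
  have hys := hψ s (uIoo_subset_uIcc_self hs)
  set y := ψ s with hydef
  have hsm := hφ y (uIoo_subset_uIcc_self hy)
  have hd := (hsm.differentiableAt (by simp)).hasDerivAt.hasFDerivAt_equiv (hφ' y hy)
  have hinvC := hsm.to_localInverse hd (by simp)
  have hr := (hsm.hasStrictFDerivAt' hd (by simp)).eventually_right_inverse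
  rw [hys] at hinvC hr
  refine hinvC.congr_of_eventuallyEq ?_
  have h3 : hsm.localInverse hd (by simp) s ∈ uIoo a b := by
    have := hsm.localInverse_apply_image hd (by simp)
    rw [hys] at this
    rwa [this]
  filter_upwards [hr, hinvC.continuousAt.eventually (isOpen_Ioo.mem_nhds h3)] with r hr1 hr2
  have h4 := hleft _ (uIoo_subset_uIcc_self hr2)
  rw [← h4]
  exact congrArg ψ hr1.symm

/-- The local solution of the soliton equation starting horizontally at the neck. -/
theorem exists_soliton_profile {ε ε' : ℝ} (hε : ε = 1 ∨ ε = -1) (hε' : ε' = 1 ∨ ε' = -1)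
    {h : ℝ → ℝ} {s₀ δ : ℝ} (hδ : 0 < δ) (hh : ContDiffOn ℝ ∞ h (Ioo (s₀ - δ) (s₀ + δ)))
    (hh0 : h s₀ ≠ 0) (y₀ : ℝ) :
    ∃ r > 0, ∃ φ : ℝ → ℝ, φ y₀ = s₀ ∧ deriv φ y₀ = 0 ∧ ContDiffOn ℝ ∞ φ (Ioo (y₀ - r) (y₀ + r)) ∧
      ∀ y ∈ Ioo (y₀ - r) (y₀ + r), φ y ∈ Ioo (s₀ - δ) (s₀ + δ) ∧ ε' + ε * deriv φ y ^ 2 ≠ 0 ∧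
        deriv (deriv φ) y = ε * ε' * (ε' + ε * deriv φ y ^ 2) * (h (φ y) - deriv φ y) ∧
        0 < ε * h s₀ * deriv (deriv φ) y := by
  have hεε : ε * ε = 1 := by rcases hε with h | h <;> simp [h]
  have hε'ε' : ε' * ε' = 1 := by rcases hε' with h | h <;> simp [h]
  -- `W` is the acceleration, and `X` below is the equivalent first-order system for position and
  -- velocity.
  let W : ℝ × ℝ → ℝ := fun p => ε * ε' * (ε' + ε * p.2 ^ 2) * (h p.1 - p.2)
  let X : ℝ × ℝ → ℝ × ℝ := fun p => (p.2, W p)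
  let U : Set (ℝ × ℝ) := Ioo (s₀ - δ) (s₀ + δ) ×ˢ univ
  have hU : IsOpen U := isOpen_Ioo.prod isOpen_univ
  have hmem : ((s₀, 0) : ℝ × ℝ) ∈ U := ⟨⟨by simpa using hδ, by simpa using hδ⟩, mem_univ _⟩
  have hW : ContDiffOn ℝ ∞ W U := by
    have h1 : ContDiffOn ℝ ∞ (fun p : ℝ × ℝ => h p.1) U :=
      hh.comp contDiff_fst.contDiffOn fun p hp => hp.1
    have h2 : ContDiff ℝ ∞ (fun p : ℝ × ℝ => ε * ε' * (ε' + ε * p.2 ^ 2)) := by fun_prop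
    exact h2.contDiffOn.mul (h1.sub contDiff_snd.contDiffOn)
  have hX : ContDiffOn ℝ ∞ X U := contDiff_snd.contDiffOn.prodMk hW
  obtain ⟨γ, hγ0, r₀, hr₀, hγ⟩ :=
    (((hX.contDiffAt (hU.mem_nhds hmem)).of_le
      (by simp)).exists_forall_mem_closedBall_exists_eq_forall_mem_Ioo_hasDerivAt₀ y₀)
  have hγc : ContinuousAt γ y₀ := (hγ y₀ ⟨by linarith, by linarith⟩).continuousAt
  have hWc : ContinuousAt W (s₀, 0) := (hW.contDiffAt (hU.mem_nhds hmem)).continuousAt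
  have hW0 : W (s₀, 0) = ε * h s₀ := by
    simp only [W]
    linear_combination ε * h s₀ * hε'ε'
  -- All three are open conditions valid at `(s₀, 0)`: there the length of the normal is `ε'` and `ε
  -- h(s₀) W = (ε h(s₀))² > 0`. They persist on a short time interval.
  have hev : ∀ᶠ p in nhds ((s₀, 0) : ℝ × ℝ),
      p ∈ U ∧ ε' + ε * p.2 ^ 2 ≠ 0 ∧ 0 < ε * h s₀ * W p := by
    refine Filter.Eventually.and (hU.mem_nhds hmem) (Filter.Eventually.and ?_ ?_)
    · have : ContinuousAt (fun p : ℝ × ℝ => ε' + ε * p.2 ^ 2) (s₀, 0) := by fun_prop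
      refine this.eventually_ne ?_
      rcases hε' with h | h <;> simp [h]
    · have : ContinuousAt (fun p : ℝ × ℝ => ε * h s₀ * W p) (s₀, 0) := continuousAt_const.mul hWc
      refine this.eventually (isOpen_Ioi.mem_nhds ?_)
      change 0 < ε * h s₀ * W (s₀, 0)
      rw [hW0]
      have : ε * h s₀ ≠ 0 := mul_ne_zero (by rintro rfl; simp at hεε) hh0
      exact mul_self_pos.2 this
  rw [← hγ0] at hev
  obtain ⟨r₁, hr₁, hball⟩ := Metric.eventually_nhds_iff_ball.1 (hγc.eventually hev)
  rw [Real.ball_eq_Ioo] at hball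
  set r := min r₀ r₁ with hr
  have hrpos : 0 < r := lt_min hr₀ hr₁
  have hsub₀ : Ioo (y₀ - r) (y₀ + r) ⊆ Ioo (y₀ - r₀) (y₀ + r₀) :=
    Ioo_subset_Ioo (by linarith [min_le_left r₀ r₁]) (by linarith [min_le_left r₀ r₁])
  have hsub₁ : Ioo (y₀ - r) (y₀ + r) ⊆ Ioo (y₀ - r₁) (y₀ + r₁) :=
    Ioo_subset_Ioo (by linarith [min_le_right r₀ r₁]) (by linarith [min_le_right r₀ r₁])
  have hφ1 : ∀ y ∈ Ioo (y₀ - r) (y₀ + r), HasDerivAt (fun y => (γ y).1) (γ y).2 y := fun y hy =>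
    (hasFDerivAt_fst (𝕜 := ℝ) (p := γ y)).comp_hasDerivAt y (hγ y (hsub₀ hy))
  have hφ2 : ∀ y ∈ Ioo (y₀ - r) (y₀ + r), HasDerivAt (fun y => (γ y).2) (W (γ y)) y := fun y hy =>
    (hasFDerivAt_snd (𝕜 := ℝ) (p := γ y)).comp_hasDerivAt y (hγ y (hsub₀ hy))
  have hd1 : ∀ y ∈ Ioo (y₀ - r) (y₀ + r), deriv (fun y => (γ y).1) y = (γ y).2 := fun y hy =>
    (hφ1 y hy).deriv
  have hd2 : ∀ y ∈ Ioo (y₀ - r) (y₀ + r), deriv (deriv fun y => (γ y).1) y = W (γ y) := by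
    intro y hy
    have : deriv (fun y => (γ y).1) =ᶠ[nhds y] fun y => (γ y).2 :=
      Filter.eventuallyEq_of_mem (isOpen_Ioo.mem_nhds hy) hd1
    rw [this.deriv_eq, (hφ2 y hy).deriv]
  refine ⟨r, hrpos, fun y => (γ y).1, by simp [hγ0], ?_, ?_, fun y hy => ?_⟩
  · rw [hd1 y₀ ⟨by linarith, by linarith⟩, hγ0]
  · exact contDiff_fst.comp_contDiffOn (contDiffOn_of_hasDerivAt_comp hX isOpen_Ioo
      (fun y hy => (hball y (hsub₁ hy)).1) fun y hy => hγ y (hsub₀ hy))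
  · obtain ⟨h1, h2, h3⟩ := hball y (hsub₁ hy)
    rw [hd2 y hy, hd1 y hy]
    exact ⟨h1.1, h2, rfl, h3⟩

/-- The two inverses of a function with a nondegenerate critical point. -/
theorem exists_isSmoothInverseOn_pair {φ : ℝ → ℝ} {y₀ r ρ k : ℝ} (hρ : 0 < ρ) (hρr : ρ < r)
    (hφ : ContDiffOn ℝ ∞ φ (Ioo (y₀ - r) (y₀ + r))) (hφ0 : deriv φ y₀ = 0)
    (hφ2 : ∀ y ∈ Ioo (y₀ - r) (y₀ + r), 0 < k * deriv (deriv φ) y) :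
    (∃ ψ, IsSmoothInverseOn φ ψ y₀ (y₀ - ρ)) ∧ (∃ ψ, IsSmoothInverseOn φ ψ y₀ (y₀ + ρ)) ∧
      0 < (φ (y₀ - ρ) - φ y₀) * (φ (y₀ + ρ) - φ y₀) := by
  set J := Ioo (y₀ - r) (y₀ + r) with hJ
  have hC : ∀ y ∈ J, ContDiffAt ℝ ∞ φ y := fun y hy => hφ.contDiffAt (isOpen_Ioo.mem_nhds hy)
  have hC' : ∀ y ∈ J, ContDiffAt ℝ ∞ (deriv φ) y := fun y hy =>
    ((contDiffOn_infty_iff_deriv_of_isOpen isOpen_Ioo).1 hφ).2.contDiffAt (isOpen_Ioo.mem_nhds hy)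
  have hy₀ : y₀ ∈ J := ⟨by linarith, by linarith⟩
  -- `k φ'` increases through zero at `y₀`, whatever the sign of `k`. Thus `φ'` is nonzero off `y₀`
  -- and `φ` moves to the same side of `φ y₀` in both directions.
  have hmono : StrictMonoOn (fun y => k * deriv φ y) J := by
    refine strictMonoOn_of_deriv_pos (convex_Ioo _ _)
      (fun y hy => ((hC' y hy).continuousAt.const_mul k).continuousWithinAt) fun y hy => ?_
    rw [interior_Ioo] at hy
    rw [deriv_const_mul _ ((hC' y hy).differentiableAt (by simp))]
    exact hφ2 y hy
  have hpos : ∀ y ∈ J, y₀ < y → 0 < k * deriv φ y := by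
    intro y hy h
    simpa [hφ0] using hmono hy₀ hy h
  have hneg : ∀ y ∈ J, y < y₀ → k * deriv φ y < 0 := by
    intro y hy h
    simpa [hφ0] using hmono hy hy₀ h
  have hsubR : Icc y₀ (y₀ + ρ) ⊆ J := fun y hy => ⟨by linarith [hy.1], by linarith [hy.2]⟩
  have hsubL : Icc (y₀ - ρ) y₀ ⊆ J := fun y hy => ⟨by linarith [hy.1], by linarith [hy.2]⟩
  refine ⟨exists_isSmoothInverseOn ?_ ?_, exists_isSmoothInverseOn ?_ ?_, ?_⟩
  · intro y hy
    rw [uIcc_of_ge (by linarith)] at hy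
    exact hC y (hsubL hy)
  · intro y hy h0
    rw [uIoo_of_ge (by linarith)] at hy
    simpa [h0] using hneg y (hsubL (Ioo_subset_Icc_self hy)) hy.2
  · intro y hy
    rw [uIcc_of_le (by linarith)] at hy
    exact hC y (hsubR hy)
  · intro y hy h0
    rw [uIoo_of_le (by linarith)] at hy
    simpa [h0] using hpos y (hsubR (Ioo_subset_Icc_self hy)) hy.1
  · have hR : StrictMonoOn (fun y => k * φ y) (Icc y₀ (y₀ + ρ)) := by
      refine strictMonoOn_of_deriv_pos (convex_Icc _ _)
        (fun y hy => ((hC y (hsubR hy)).continuousAt.const_mul k).continuousWithinAt) fun y hy => ?_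
      rw [interior_Icc] at hy
      have hyJ := hsubR (Ioo_subset_Icc_self hy)
      rw [deriv_const_mul _ ((hC y hyJ).differentiableAt (by simp))]
      exact hpos y hyJ hy.1
    have hL : StrictAntiOn (fun y => k * φ y) (Icc (y₀ - ρ) y₀) := by
      refine strictAntiOn_of_deriv_neg (convex_Icc _ _)
        (fun y hy => ((hC y (hsubL hy)).continuousAt.const_mul k).continuousWithinAt) fun y hy => ?_
      rw [interior_Icc] at hy
      have hyJ := hsubL (Ioo_subset_Icc_self hy)
      rw [deriv_const_mul _ ((hC y hyJ).differentiableAt (by simp))]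
      exact hneg y hyJ hy.2
    have h1 : k * φ y₀ < k * φ (y₀ + ρ) :=
      hR ⟨le_rfl, by linarith⟩ ⟨by linarith, le_rfl⟩ (by linarith)
    have h2 : k * φ y₀ < k * φ (y₀ - ρ) :=
      hL ⟨le_rfl, by linarith⟩ ⟨by linarith, le_rfl⟩ (by linarith)
    have h3 : 0 < k ^ 2 * ((φ (y₀ - ρ) - φ y₀) * (φ (y₀ + ρ) - φ y₀)) := by
      have := mul_pos (sub_pos.2 h2) (sub_pos.2 h1)
      linarith [this]
    exact pos_of_mul_pos_right h3 (sq_nonneg k)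

/-! ### Solitons over and along the orbits -/

section Solitons

variable {E : Type*} [NormedAddCommGroup E] [NormedSpace ℝ E] [FiniteDimensional ℝ E]
  {M : Type*} [TopologicalSpace M] [ChartedSpace E M] [IsManifold 𝓘(ℝ, E) ∞ M]
  {g : BilinField 𝓘(ℝ, E) M}

/-- If the Laplacian of `f` is a function of `f`, then this function is smooth at the parameters of
a smooth curve along which `f` is the parameter. -/
theorem contDiffAt_of_divergence_eq (hg : IsSemiRiemannianMetric 𝓘(ℝ, E) g) {f : M → ℝ}
    (hf : ContMDiff 𝓘(ℝ, E) 𝓘(ℝ, ℝ) ∞ f) {h : ℝ → ℝ}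
    (hdiv : ∀ x, divergence 𝓘(ℝ, E) g (semiGradient 𝓘(ℝ, E) g f) x = h (f x))
    {α : ℝ → M} {s : ℝ} (hα : ContMDiffAt 𝓘(ℝ, ℝ) 𝓘(ℝ, E) ∞ α s)
    (hfα : ∀ᶠ r in nhds s, f (α r) = r) : ContDiffAt ℝ ∞ h s := by
  have hE : CompleteSpace E := FiniteDimensional.complete ℝ E
  set κ := extChartAt 𝓘(ℝ, E) (α s) with hκ
  have hκn : κ.target ∈ nhds (κ (α s)) := extChartAt_target_mem_nhds (α s)
  have hL : ContDiffAt ℝ ∞ (chartLapl (metricInChart 𝓘(ℝ, E) g (α s)) (f ∘ κ.symm)) (κ (α s)) :=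
    contDiffAt_chartLapl ((contDiffOn_metricInChart hg (α s)).contDiffAt hκn)
      ((contDiffOn_comp_extChartAt_symm hf (α s)).contDiffAt hκn)
      (isInvertible_metricInChart hg (mem_extChartAt_target (α s)))
  have hγ : ContDiffAt ℝ ∞ (κ ∘ α) s := (contMDiffAt_iff_target.1 hα).2.contDiffAt
  -- Near `s`, `h` coincides with the chart Laplacian along `α`, because `f (α r) = r`. This needs
  -- the Laplacian in one chart for all nearby `r`.
  refine (ContDiffAt.comp s hL hγ).congr_of_eventuallyEq ?_
  filter_upwards [hfα, hα.continuousAt.eventually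
    (extChartAt_source_mem_nhds (I := 𝓘(ℝ, E)) (α s))] with r h1 h2
  have h3 := divergence_semiGradient_eq_chartLapl hg hf (α s) (κ.map_source h2)
  rw [κ.left_inv h2, hdiv, h1] at h3
  exact h3

/-- The inverses of solutions of the soliton equation yield graphical solitons. -/
theorem isGraphicalTranslatingSolitonOn_comp (hg : IsSemiRiemannianMetric 𝓘(ℝ, E) g)
    {ε ε' : ℝ} (hε : ε = 1 ∨ ε = -1) {f : M → ℝ} (hf : ContMDiff 𝓘(ℝ, E) 𝓘(ℝ, ℝ) ∞ f)
    (hgrad : ∀ x, g x (semiGradient 𝓘(ℝ, E) g f x) (semiGradient 𝓘(ℝ, E) g f x) = ε')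
    (hε' : ε' = 1 ∨ ε' = -1) {h : ℝ → ℝ}
    (hdiv : ∀ x, divergence 𝓘(ℝ, E) g (semiGradient 𝓘(ℝ, E) g f) x = h (f x))
    {φ ψ : ℝ → ℝ} {V : Set ℝ} (hV : IsOpen V) (hψ : ∀ s ∈ V, ContDiffAt ℝ ∞ ψ s)
    (hφψ : ∀ s ∈ V, φ (ψ s) = s) (hφ : ∀ s ∈ V, ContDiffAt ℝ ∞ φ (ψ s))
    (hc : ∀ s ∈ V, ε' + ε * deriv φ (ψ s) ^ 2 ≠ 0)
    (hode : ∀ s ∈ V, deriv (deriv φ) (ψ s) = ε * ε' * (ε' + ε * deriv φ (ψ s) ^ 2) *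
      (h (φ (ψ s)) - deriv φ (ψ s))) :
    IsGraphicalTranslatingSolitonOn 𝓘(ℝ, E) g ε (fun x => ψ (f x)) (f ⁻¹' V) := by
  have hu : ∀ x ∈ f ⁻¹' V, ContMDiffAt 𝓘(ℝ, E) 𝓘(ℝ, ℝ) ∞ (fun x => ψ (f x)) x := fun x hx =>
    (hψ (f x) hx).contMDiffAt.comp x (hf x)
  have hF : ∀ x ∈ f ⁻¹' V, ContMDiffAt 𝓘(ℝ, E) (𝓘(ℝ, E).prod 𝓘(ℝ, ℝ)) ∞
      (fun x => (x, ψ (f x))) x := fun x hx => contMDiffAt_id.prodMk (hu x hx)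
  refine ⟨fun x hx => (hF x hx).contMDiffWithinAt, fun x hx => ?_⟩
  have hrank : Module.finrank ℝ (LinearMap.range (mfderiv 𝓘(ℝ, E) (𝓘(ℝ, E).prod 𝓘(ℝ, ℝ))
      (fun x => (x, ψ (f x))) x : E →L[ℝ] E × ℝ).toLinearMap) = Module.finrank ℝ E := by
    refine LinearMap.finrank_range_of_inj fun v w hvw => ?_
    have h1 := mfderiv_prodMk (I := 𝓘(ℝ, E)) (mdifferentiableAt_id (x := x) (I := 𝓘(ℝ, E)))
      ((hu x hx).mdifferentiableAt (by simp))
    rw [mfderiv_id] at h1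
    have h2 : ∀ v : E, ((mfderiv 𝓘(ℝ, E) (𝓘(ℝ, E).prod 𝓘(ℝ, ℝ))
      (fun x => (x, ψ (f x))) x : E →L[ℝ] E × ℝ) v).1 = v := fun v =>
        congrArg (fun L : E →L[ℝ] E × ℝ => (L v).1) h1
    rw [← h2 v, ← h2 w]
    exact congrArg Prod.fst hvw
  refine ⟨hrank, translatingSoliton_at_of_equation hg hε hf hgrad hε'
    ((hF x hx).of_le ENat.LEInfty.out) ((hφ (f x) hx).of_le ENat.LEInfty.out) ?_ hrank
    (hc (f x) hx) ?_⟩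
  · filter_upwards [(hV.preimage hf.continuous).mem_nhds hx] with z hz
    exact (hφψ (f z) hz).symm
  · have := hode (f x) hx
    rw [hφψ (f x) hx, ← hdiv] at this
    exact this

variable {E' : Type*} [NormedAddCommGroup E'] [NormedSpace ℝ E'] [FiniteDimensional ℝ E']
  {S : Type*} [TopologicalSpace S] [SecondCountableTopology S]
  [ChartedSpace E' S] [Group S] [LieGroup 𝓘(ℝ, E') ∞ S] [MulAction S M]
  [ContMDiffSMul 𝓘(ℝ, E') 𝓘(ℝ, E) ∞ S M]

omit [FiniteDimensional ℝ E] [IsManifold 𝓘(ℝ, E) ∞ M] [FiniteDimensional ℝ E']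
  [SecondCountableTopology S] [LieGroup 𝓘(ℝ, E') ∞ S] in
theorem contMDiffAt_smul_curve {c : ℝ → M} {p : ℝ × S}
    (hc : ContMDiffAt 𝓘(ℝ, ℝ) 𝓘(ℝ, E) ∞ c p.1) :
    ContMDiffAt (𝓘(ℝ, ℝ).prod 𝓘(ℝ, E')) 𝓘(ℝ, E) ∞ (fun q : ℝ × S => q.2 • c q.1) p :=
  ContMDiffAt.smul contMDiffAt_snd (hc.comp p contMDiffAt_fst)

omit [FiniteDimensional ℝ E] [IsManifold 𝓘(ℝ, E) ∞ M] [FiniteDimensional ℝ E']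
  [SecondCountableTopology S] [LieGroup 𝓘(ℝ, E') ∞ S] in
theorem contMDiffAt_orbit_hypersurface {c : ℝ → M} {p : ℝ × S}
    (hc : ContMDiffAt 𝓘(ℝ, ℝ) 𝓘(ℝ, E) ∞ c p.1) :
    ContMDiffAt (𝓘(ℝ, ℝ).prod 𝓘(ℝ, E')) (𝓘(ℝ, E).prod 𝓘(ℝ, ℝ)) ∞
      (fun q : ℝ × S => (q.2 • c q.1, q.1)) p :=
  (contMDiffAt_smul_curve hc).prodMk contMDiffAt_fst

/-- The range of the differential is the kernel of the nonzero form `df - φ' dt`: moving the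
parameter `y` accounts for the vertical component, and the orbit directions fill what remains,
namely `ker df`. -/
theorem finrank_range_orbit_hypersurface {f : M → ℝ}
    (hf : ContMDiff 𝓘(ℝ, E) 𝓘(ℝ, ℝ) ∞ f) (hinv : ∀ (σ : S) (x : M), f (σ • x) = f x)
    (hsub : ∀ x, Function.Surjective (mfderiv 𝓘(ℝ, E) 𝓘(ℝ, ℝ) f x))
    (horb : ∀ x y : M, f y = f x → y ∈ MulAction.orbit S x)
    {φ : ℝ → ℝ} {c : ℝ → M} {p : ℝ × S} (hc : ContMDiffAt 𝓘(ℝ, ℝ) 𝓘(ℝ, E) ∞ c p.1)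
    (hφ : DifferentiableAt ℝ φ p.1) (hfc : ∀ᶠ y in nhds p.1, f (c y) = φ y) :
    Module.finrank ℝ (LinearMap.range
      (mfderiv (𝓘(ℝ, ℝ).prod 𝓘(ℝ, E')) (𝓘(ℝ, E).prod 𝓘(ℝ, ℝ))
        (fun q : ℝ × S => (q.2 • c q.1, q.1)) p : ℝ × E' →L[ℝ] E × ℝ).toLinearMap)
      = Module.finrank ℝ E := by
  obtain ⟨y, σ⟩ := p
  have hA := (contMDiffAt_smul_curve (E := E) (E' := E') hc).mdifferentiableAt (by simp)
  let A : ℝ × E' →L[ℝ] E := mfderiv (𝓘(ℝ, ℝ).prod 𝓘(ℝ, E')) 𝓘(ℝ, E)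
    (fun q : ℝ × S => q.2 • c q.1) (y, σ)
  let D : ℝ × E' →L[ℝ] E × ℝ := mfderiv (𝓘(ℝ, ℝ).prod 𝓘(ℝ, E')) (𝓘(ℝ, E).prod 𝓘(ℝ, ℝ))
    (fun q : ℝ × S => (q.2 • c q.1, q.1)) (y, σ)
  have hD : ∀ X, D X = (A X, X.1) := by
    intro X
    have h1 := mfderiv_prodMk hA (mdifferentiableAt_fst (I := 𝓘(ℝ, ℝ)) (I' := 𝓘(ℝ, E'))
      (x := (y, σ)))
    rw [mfderiv_fst] at h1
    exact congrArg (fun L : ℝ × E' →L[ℝ] E × ℝ => L X) h1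
  have hAr : ∀ ξ, A (0, ξ) = orbitDeriv (c y) σ ξ := by
    intro ξ
    have h1 : MDifferentiableAt 𝓘(ℝ, E') (𝓘(ℝ, ℝ).prod 𝓘(ℝ, E')) (fun τ : S => (y, τ)) σ :=
      mdifferentiableAt_const.prodMk mdifferentiableAt_id
    have h2 := mfderiv_comp σ hA h1
    rw [mfderiv_prod_right] at h2
    exact (congrArg (fun L : E' →L[ℝ] E => L ξ) h2).symm
  have hfA : ∀ X, funDeriv f (σ • c y) (A X) = deriv φ y * X.1 := by
    intro X
    have h1 := mfderiv_comp ((y, σ) : ℝ × S) ((hf (σ • c y)).mdifferentiableAt (by simp)) hA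
    have h2 : f ∘ (fun q : ℝ × S => q.2 • c q.1) =ᶠ[nhds (y, σ)] φ ∘ Prod.fst := by
      filter_upwards [continuousAt_fst.eventually hfc] with q hq
      simp [hinv, hq]
    have h3 := mfderiv_comp ((y, σ) : ℝ × S) (I := 𝓘(ℝ, ℝ).prod 𝓘(ℝ, E'))
      (I' := 𝓘(ℝ, ℝ)) hφ.mdifferentiableAt mdifferentiableAt_fst
    rw [h2.mfderiv_eq, h3, mfderiv_fst, mfderiv_eq_fderiv] at h1
    have h4 : fderiv ℝ φ y X.1 = funDeriv f (σ • c y) (A X) :=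
      congrArg (fun L : ℝ × E' →L[ℝ] ℝ => L X) h1
    rw [← h4, fderiv_eq_smul_deriv]
    simp [mul_comm]
  let ℓ : E × ℝ →ₗ[ℝ] ℝ := ((funDeriv f (σ • c y)).comp (ContinuousLinearMap.fst ℝ E ℝ)
    - deriv φ y • ContinuousLinearMap.snd ℝ E ℝ).toLinearMap
  have hℓ : ∀ U, ℓ U = funDeriv f (σ • c y) U.1 - deriv φ y * U.2 := fun U => rfl
  have hℓsurj : LinearMap.range ℓ = ⊤ := by
    rw [LinearMap.range_eq_top]
    intro t
    obtain ⟨v, hv⟩ := hsub (σ • c y) t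
    refine ⟨((v : E), 0), ?_⟩
    rw [hℓ, mul_zero, sub_zero]
    exact hv
  have hrange : LinearMap.range D.toLinearMap = LinearMap.ker ℓ := by
    ext U
    rw [LinearMap.mem_range, LinearMap.mem_ker, hℓ]
    constructor
    · rintro ⟨X, rfl⟩
      change funDeriv f (σ • c y) (D X).1 - deriv φ y * (D X).2 = 0
      rw [hD, hfA, sub_self]
    · intro hU
      -- Subtracting the motion along the curve with the prescribed vertical speed leaves a vector
      -- in `ker df`.
      obtain ⟨ξ, hξ⟩ := exists_orbitDeriv_eq (E' := E') hf hinv hsub horb (c y) σ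
        (U.1 - U.2 • A (1, 0)) (by
          rw [map_sub, map_smul, hfA, smul_eq_mul]
          linear_combination hU)
      refine ⟨(U.2, ξ), ?_⟩
      change D (U.2, ξ) = U
      have h1 : ((U.2, ξ) : ℝ × E') = U.2 • (1, 0) + (0, ξ) := by simp
      rw [hD]
      refine Prod.ext ?_ rfl
      rw [h1, map_add, map_smul, hAr, hξ]
      simp
  change Module.finrank ℝ (LinearMap.range D.toLinearMap) = _
  rw [hrange]
  have h1 := LinearMap.finrank_range_add_finrank_ker ℓ
  rw [hℓsurj, finrank_top, Module.finrank_prod, Module.finrank_self] at h1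
  omega

/-- The hypersurface swept out by the orbits through the points of a curve `c` over which `f` is a
solution of the soliton equation is a translating soliton. -/
theorem isTranslatingSolitonOn_orbit_hypersurface (hg : IsSemiRiemannianMetric 𝓘(ℝ, E) g)
    {ε ε' : ℝ} (hε : ε = 1 ∨ ε = -1) {f : M → ℝ} (hf : ContMDiff 𝓘(ℝ, E) 𝓘(ℝ, ℝ) ∞ f)
    (hgrad : ∀ x, g x (semiGradient 𝓘(ℝ, E) g f x) (semiGradient 𝓘(ℝ, E) g f x) = ε')
    (hε' : ε' = 1 ∨ ε' = -1) {h : ℝ → ℝ}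
    (hdiv : ∀ x, divergence 𝓘(ℝ, E) g (semiGradient 𝓘(ℝ, E) g f) x = h (f x))
    (hinv : ∀ (σ : S) (x : M), f (σ • x) = f x)
    (hsub : ∀ x, Function.Surjective (mfderiv 𝓘(ℝ, E) 𝓘(ℝ, ℝ) f x))
    (horb : ∀ x y : M, f y = f x → y ∈ MulAction.orbit S x)
    {φ : ℝ → ℝ} {c : ℝ → M} {V : Set ℝ} (hV : IsOpen V)
    (hc : ∀ y ∈ V, ContMDiffAt 𝓘(ℝ, ℝ) 𝓘(ℝ, E) ∞ c y) (hfc : ∀ y ∈ V, f (c y) = φ y)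
    (hφ : ∀ y ∈ V, ContDiffAt ℝ ∞ φ y)
    (hne : ∀ y ∈ V, ε' + ε * deriv φ y ^ 2 ≠ 0)
    (hode : ∀ y ∈ V, deriv (deriv φ) y = ε * ε' * (ε' + ε * deriv φ y ^ 2) *
      (h (φ y) - deriv φ y)) :
    IsTranslatingSolitonOn (𝓘(ℝ, ℝ).prod 𝓘(ℝ, E')) 𝓘(ℝ, E) g ε
      (fun q : ℝ × S => (q.2 • c q.1, q.1)) (V ×ˢ univ) := by
  refine ⟨fun p hp => (contMDiffAt_orbit_hypersurface (hc p.1 hp.1)).contMDiffWithinAt,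
    fun p hp => ?_⟩
  have hrank := finrank_range_orbit_hypersurface (E' := E') hf hinv hsub horb (hc p.1 hp.1)
    ((hφ p.1 hp.1).differentiableAt (by simp))
    (Filter.eventually_of_mem (hV.mem_nhds hp.1) hfc)
  refine ⟨hrank, translatingSoliton_at_of_equation hg hε hf hgrad hε'
    ((contMDiffAt_orbit_hypersurface (hc p.1 hp.1)).of_le ENat.LEInfty.out)
    ((hφ p.1 hp.1).of_le ENat.LEInfty.out) ?_ hrank (hne p.1 hp.1) ?_⟩
  · filter_upwards [continuousAt_fst.eventually (hV.mem_nhds hp.1)] with q hq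
    rw [hinv, hfc q.1 hq]
  · have := hode p.1 hp.1
    rw [← hfc p.1 hp.1, ← hinv p.2, ← hdiv] at this
    exact this

end Solitons

end

/-! ### Assembly: the soliton and its two graphical halves -/

theorem mainTheorem9
    {E : Type*} [NormedAddCommGroup E] [NormedSpace ℝ E] [FiniteDimensional ℝ E]
    {M : Type*} [TopologicalSpace M] [T2Space M] [SecondCountableTopology M] [ConnectedSpace M]
    [ChartedSpace E M] [IsManifold 𝓘(ℝ, E) ∞ M]
    {E' : Type*} [NormedAddCommGroup E'] [NormedSpace ℝ E'] [FiniteDimensional ℝ E']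
    {S : Type*} [TopologicalSpace S] [T2Space S] [SecondCountableTopology S]
    [ChartedSpace E' S] [Group S] [LieGroup 𝓘(ℝ, E') ∞ S]
    [MulAction S M] [ContMDiffSMul 𝓘(ℝ, E') 𝓘(ℝ, E) ∞ S M]
    (g : BilinField 𝓘(ℝ, E) M) (hg : IsSemiRiemannianMetric 𝓘(ℝ, E) g)
    (hisom : ∀ (σ : S) (x : M) (v w : TangentSpace 𝓘(ℝ, E) x),
      g (σ • x) (mfderiv 𝓘(ℝ, E) 𝓘(ℝ, E) (fun z : M => σ • z) x v)
        (mfderiv 𝓘(ℝ, E) 𝓘(ℝ, E) (fun z : M => σ • z) x w) = g x v w)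
    (I : Set ℝ) (hIopen : IsOpen I) (hIint : I.OrdConnected)
    (π : M → ℝ) (hπI : ∀ x, π x ∈ I)
    (hπ : ContMDiff 𝓘(ℝ, E) 𝓘(ℝ, ℝ) ∞ π)
    (hsub : ∀ x, Function.Surjective (mfderiv 𝓘(ℝ, E) 𝓘(ℝ, ℝ) π x))
    (hfib : ∀ s ∈ I, ∃ x : M, π ⁻¹' {s} = MulAction.orbit S x)
    (ε ε' : ℝ) (hε : ε = 1 ∨ ε = -1) (hε' : ε' = 1 ∨ ε' = -1)
    (hgrad : ∀ x, g x (semiGradient 𝓘(ℝ, E) g π x) (semiGradient 𝓘(ℝ, E) g π x) = ε')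
    (h : ℝ → ℝ)
    (hdiv : ∀ x, divergence 𝓘(ℝ, E) g (semiGradient 𝓘(ℝ, E) g π) x = h (π x))
    (y₀ s₀ : ℝ) (hs₀ : s₀ ∈ I) (hhs₀ : h s₀ ≠ 0) :
    ∃ ρ : ℝ, 0 < ρ ∧ ∃ F : ℝ × S → M × ℝ,
      IsTranslatingSolitonOn (𝓘(ℝ, ℝ).prod 𝓘(ℝ, E')) 𝓘(ℝ, E) g ε F
        (Ioo (y₀ - ρ) (y₀ + ρ) ×ˢ univ) ∧
      (∃ c : ℝ → M, ∀ y ∈ Ioo (y₀ - ρ) (y₀ + ρ),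
        (∀ σ : S, F (y, σ) = (σ • c y, y)) ∧
        MulAction.stabilizer S (c y) = MulAction.stabilizer S (c y₀)) ∧
      ∃ b₁ ∈ I, ∃ b₂ ∈ I, 0 < (b₁ - s₀) * (b₂ - s₀) ∧
        ∃ u₁ u₂ : M → ℝ,
          IsGraphicalTranslatingSolitonOn 𝓘(ℝ, E) g ε u₁ (π ⁻¹' uIoo s₀ b₁) ∧
          IsGraphicalTranslatingSolitonOn 𝓘(ℝ, E) g ε u₂ (π ⁻¹' uIoo s₀ b₂) ∧
          ContinuousOn u₁ (π ⁻¹' insert s₀ (uIoo s₀ b₁)) ∧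
          ContinuousOn u₂ (π ⁻¹' insert s₀ (uIoo s₀ b₂)) ∧
          (∀ x, π x = s₀ → u₁ x = y₀ ∧ u₂ x = y₀) ∧
          (∀ x, π x ∈ uIoo s₀ b₁ → u₁ x < y₀) ∧
          (∀ x, π x ∈ uIoo s₀ b₂ → y₀ < u₂ x) ∧
          F '' (Ioo (y₀ - ρ) (y₀ + ρ) ×ˢ univ) =
            graphOver u₁ (π ⁻¹' insert s₀ (uIoo s₀ b₁)) ∪
            graphOver u₂ (π ⁻¹' insert s₀ (uIoo s₀ b₂)) := by
  obtain ⟨x₀, hx₀⟩ := hfib s₀ hs₀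
  have hπx₀ : π x₀ = s₀ := by
    have : x₀ ∈ π ⁻¹' {s₀} := hx₀ ▸ MulAction.mem_orbit_self x₀
    exact this
  have hinv : ∀ (σ : S) (x : M), π (σ • x) = π x := by
    intro σ x
    obtain ⟨x₁, hx₁⟩ := hfib (π x) (hπI x)
    have h1 : x ∈ MulAction.orbit S x₁ := hx₁ ▸ (rfl : π x = π x)
    have h2 : σ • x ∈ π ⁻¹' {π x} := hx₁ ▸ MulAction.mem_orbit_of_mem_orbit σ h1
    exact h2
  have horb : ∀ x y : M, π y = π x → y ∈ MulAction.orbit S x := by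
    intro x y hxy
    obtain ⟨x₁, hx₁⟩ := hfib (π x) (hπI x)
    have h1 : x ∈ MulAction.orbit S x₁ := hx₁ ▸ (rfl : π x = π x)
    have h2 : y ∈ MulAction.orbit S x₁ := hx₁ ▸ hxy
    rwa [MulAction.orbit_eq_iff.2 h1]
  obtain ⟨δ, hδ, α, hα⟩ := exists_curve_of_gradient_unit E' hg hisom hπ hinv hε' hgrad x₀
  rw [hπx₀] at hα
  -- Smoothness of `h` is not assumed; it is read off along `α`, and only near `s₀`.
  have hh : ContDiffOn ℝ ∞ h (Ioo (s₀ - δ) (s₀ + δ)) := fun s hs =>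
    (contDiffAt_of_divergence_eq hg hπ hdiv (hα s hs).1
      (Filter.eventually_of_mem (isOpen_Ioo.mem_nhds hs)
        fun r hr => (hα r hr).2.1)).contDiffWithinAt
  obtain ⟨r, hr, φ, hφ0, hφ'0, hφs, hφ⟩ := exists_soliton_profile hε hε' hδ hh hhs₀ y₀
  -- Halving `r` keeps the closed interval inside the domain of the solution, so `φ` is smooth at
  -- both ends and its end values can serve as `b₁`, `b₂`.
  obtain ⟨⟨ψ₁, h₁⟩, ⟨ψ₂, h₂⟩, hside⟩ := exists_isSmoothInverseOn_pair (ρ := r / 2) (by linarith)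
    (by linarith) hφs hφ'0 fun y hy => (hφ y hy).2.2.2
  have hJ : Ioo (y₀ - r / 2) (y₀ + r / 2) ⊆ Ioo (y₀ - r) (y₀ + r) :=
    Ioo_subset_Ioo (by linarith) (by linarith)
  have hLJ : ∀ y ∈ uIoo y₀ (y₀ - r / 2), y ∈ Ioo (y₀ - r / 2) (y₀ + r / 2) ∧ y < y₀ := by
    intro y hy
    rw [uIoo_of_ge (by linarith)] at hy
    exact ⟨⟨hy.1, by linarith [hy.2]⟩, hy.2⟩
  have hRJ : ∀ y ∈ uIoo y₀ (y₀ + r / 2), y ∈ Ioo (y₀ - r / 2) (y₀ + r / 2) ∧ y₀ < y := by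
    intro y hy
    rw [uIoo_of_le (by linarith)] at hy
    exact ⟨⟨by linarith [hy.1], hy.2⟩, hy.1⟩
  have hy₀ : y₀ ∈ Ioo (y₀ - r / 2) (y₀ + r / 2) := ⟨by linarith, by linarith⟩
  have hφC : ∀ y ∈ Ioo (y₀ - r) (y₀ + r), ContDiffAt ℝ ∞ φ y := fun y hy =>
    hφs.contDiffAt (isOpen_Ioo.mem_nhds hy)
  -- Treats both halves at once, with `b = y₀ ± r / 2`.
  have hgraph : ∀ (ψ : ℝ → ℝ) (b : ℝ), IsSmoothInverseOn φ ψ y₀ b →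
      (∀ y ∈ uIoo y₀ b, y ∈ Ioo (y₀ - r / 2) (y₀ + r / 2)) →
      IsGraphicalTranslatingSolitonOn 𝓘(ℝ, E) g ε (fun x => ψ (π x)) (π ⁻¹' uIoo s₀ (φ b)) ∧
      ContinuousOn (fun x => ψ (π x)) (π ⁻¹' insert s₀ (uIoo s₀ (φ b))) ∧
      (∀ x, π x = s₀ → ψ (π x) = y₀) ∧
      (∀ y ∈ uIoo y₀ b, ∀ σ : S,
        (σ • α (φ y), y) ∈ graphOver (fun x => ψ (π x)) (π ⁻¹' insert s₀ (uIoo s₀ (φ b)))) ∧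
      (∀ σ : S,
        (σ • α (φ y₀), y₀) ∈ graphOver (fun x => ψ (π x)) (π ⁻¹' insert s₀ (uIoo s₀ (φ b)))) ∧
      graphOver (fun x => ψ (π x)) (π ⁻¹' insert s₀ (uIoo s₀ (φ b))) ⊆
        (fun q : ℝ × S => (q.2 • α (φ q.1), q.1)) '' (Ioo (y₀ - r / 2) (y₀ + r / 2) ×ˢ univ) := by
    intro ψ b hψ hb
    have hF : ∀ y ∈ Ioo (y₀ - r / 2) (y₀ + r / 2), ∀ σ : S, π (σ • α (φ y)) = φ y :=
      fun y hy σ => (hinv σ _).trans (hα _ (hφ y (hJ hy)).1).2.1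
    obtain ⟨hψ1, hψ2, hψ3, hψ4, hψ5, hψ6, hψ7⟩ := hψ
    rw [hφ0] at hψ1 hψ2 hψ3 hψ4 hψ5 hψ6
    have hJψ := fun s hs => hJ (hb (ψ s) (hψ3 s hs))
    refine ⟨?_, ?_, ?_, ?_, ?_, ?_⟩
    · exact isGraphicalTranslatingSolitonOn_comp hg hε hπ hgrad hε' hdiv isOpen_Ioo hψ5 hψ4
        (fun s hs => hφC _ (hJψ s hs)) (fun s hs => (hφ _ (hJψ s hs)).2.1)
        fun s hs => (hφ _ (hJψ s hs)).2.2.1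
    · exact hψ2.comp hπ.continuous.continuousOn fun x hx => hx
    · intro x hx
      rw [hx, hψ1]
    · intro y hy σ
      have h1 := hF y (hb y hy) σ
      refine ⟨σ • α (φ y), Or.inr ?_, ?_⟩
      · rw [h1]
        exact hψ6 y hy
      · simp only [h1, hψ7 y hy]
    · intro σ
      have h1 := hF y₀ hy₀ σ
      rw [hφ0] at h1 ⊢
      refine ⟨σ • α s₀, Or.inl h1, ?_⟩
      simp only [h1, hψ1]
    · rintro _ ⟨x, hx, rfl⟩
      have h1 : ψ (π x) ∈ Ioo (y₀ - r / 2) (y₀ + r / 2) ∧ φ (ψ (π x)) = π x := by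
        rcases hx with hx | hx
        · rw [hx, hψ1]
          exact ⟨hy₀, hφ0⟩
        · exact ⟨hb _ (hψ3 _ hx), hψ4 _ hx⟩
      have h2 := hF _ h1.1 1
      rw [one_smul, h1.2] at h2
      -- The points `x` and `α (π x)` have the same value of `π`, so they lie in one orbit; this
      -- puts every graph point in the image of `F`.
      obtain ⟨σ, hσ⟩ := horb _ x h2.symm
      refine ⟨(ψ (π x), σ), ⟨h1.1, mem_univ _⟩, ?_⟩
      simp only [h1.2]
      exact Prod.ext hσ rfl
  -- The neck lies in both graphs; for the union it is enough to take it from the second.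
  obtain ⟨hg₁, hc₁, hv₁, ha₁, -, hi₁⟩ := hgraph ψ₁ _ h₁ fun y hy => (hLJ y hy).1
  obtain ⟨hg₂, hc₂, hv₂, ha₂, hn₂, hi₂⟩ := hgraph ψ₂ _ h₂ fun y hy => (hRJ y hy).1
  have hmemI : ∀ y ∈ Ioo (y₀ - r) (y₀ + r), φ y ∈ I := fun y hy =>
    (hα _ (hφ y hy).1).2.1 ▸ hπI (α (φ y))
  refine ⟨r / 2, by linarith, fun q => (q.2 • α (φ q.1), q.1), ?_, ⟨fun y => α (φ y), ?_⟩,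
    φ (y₀ - r / 2), hmemI _ ⟨by linarith, by linarith⟩, φ (y₀ + r / 2),
    hmemI _ ⟨by linarith, by linarith⟩, by rwa [hφ0] at hside, fun x => ψ₁ (π x),
    fun x => ψ₂ (π x), hg₁, hg₂, hc₁, hc₂, fun x hx => ⟨hv₁ x hx, hv₂ x hx⟩, ?_, ?_, ?_⟩
  · exact isTranslatingSolitonOn_orbit_hypersurface (c := fun y => α (φ y)) hg hε hπ hgrad hε' hdiv
      hinv hsub horb isOpen_Ioo
      (fun y hy => (hα _ (hφ y (hJ hy)).1).1.comp y (hφC y (hJ hy)).contMDiffAt)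
      (fun y hy => (hα _ (hφ y (hJ hy)).1).2.1) (fun y hy => hφC y (hJ hy))
      (fun y hy => (hφ y (hJ hy)).2.1) fun y hy => (hφ y (hJ hy)).2.2.1
  · intro y hy
    refine ⟨fun σ => rfl, ?_⟩
    simp only [(hα _ (hφ y (hJ hy)).1).2.2, hφ0]
  · intro x hx
    rw [← hφ0] at hx
    exact (hLJ _ (h₁.mapsTo_uIoo _ hx)).2
  · intro x hx
    rw [← hφ0] at hx
    exact (hRJ _ (h₂.mapsTo_uIoo _ hx)).2
  · refine Subset.antisymm ?_ (union_subset hi₁ hi₂)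
    rintro _ ⟨⟨y, σ⟩, ⟨hy, -⟩, rfl⟩
    rcases lt_trichotomy y y₀ with h | rfl | h
    · exact Or.inl (ha₁ y (mem_uIoo_of_gt hy.1 h) σ)
    · exact Or.inr (hn₂ σ)
    · exact Or.inr (ha₂ y (mem_uIoo_of_lt h hy.2) σ)
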